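/- Let $\beta\in\mathbb C$ with $\beta^4=-1$. Everything takes place in the symmetric monoidal category of finite-dimensional complex super vector spaces, with braiding $\tau(x\otimes y)=(-1)^{|x||y|}y\otimes x$ and parity involution $\omega$; tensor products of superalgebras and their actions carry the corresponding signs. **The algebra $S$.** $S$ is the associative superalgebra with odd generators $x^\pm$, an even generator $L$ and relations $x^\pm L=Lx^\pm$, $x^+x^-+x^-x^+=\tfrac12(1-L)$, $(x^\pm)^2=0$, $L^2=1$. Put $e_0=\frac12(1+L)$, $e_1=\frac12(1-L)$, $S_a=e_aS$. It has the algebra maps $\Delta^S:S\to S\otimes S$, $\varepsilon:S\to\mathbb C$, $$\Delta^S(L)=L\otimes L,\quad \Delta^S(x^\pm)=x^\pm\otimes 1+(e_0-\mathrm i e_1)\otimes x^\pm\pm \mathrm i\,e_1\otimes e_1(x^+-x^-),\quad \varepsilon(L)=1,\ \varepsilon(x^\pm)=0 .$$ $\mathrm{Rep}\,S$ is the category of finite-dimensional representations of $S$ in super vector spaces, with tensor product via $\Delta^S$, tensor unit $\mathbb C$ via $\varepsilon$, and the unit isomorphisms of vector spaces. Let $\Lambda=\sum_{a,b,c\in\{0,1\}}\tilde\Lambda^{abc}\in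 S\otimes S\otimes S$ with $\tilde\Lambda^{abc}=\Lambda^{abc}\cdot(e_a\otimes e_b\otimes e_c)$, where $\Lambda^{000}=\Lambda^{100}=\Lambda^{001}=\Lambda^{011}=1$ and, with $p=x^+$, $m=x^-$, $q=x^+x^-$, and $xyz$ standing for $x\otimes y\otimes z$, $$\Lambda^{010}=111+(1+\mathrm i)\,m1p-(1-\mathrm i)\,p1m-2\,q1q,\qquad \Lambda^{110}=111-\mathrm i\;1\otimes(p+m)\otimes(p+m),$$ $$\Lambda^{101}=111+\mathrm i\;1\otimes(p+\mathrm im)\otimes(p+\mathrm im)+(1-\mathrm i)(p-m)\otimes q\otimes(\mathrm ip-m)+(1+\mathrm i)\,mp1-(1-\mathrm i)\,pm1+(1+\mathrm i)\,1q1-2\,qq1,$$ $$\begin{aligned}\Lambda^{111}=\beta^2\{&(\mathrm i-1)111+(1-\mathrm i)11q+(1+2\mathrm i)1mm+1mp+1pm+1pp+(1-\mathrm i)1q1-(2-2\mathrm i)1qq\\&-(1-\mathrm i)m1m+(1+\mathrm i)m1p-(1-\mathrm i)mmq+(1+\mathrm i)mpq+(1-\mathrm i)mqm-(1+\mathrm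 i)mqp\\&+(1-\mathrm i)pm1-(1-\mathrm i)pmq-(1+\mathrm i)pp1+(1+\mathrm i)ppq-(1-\mathrm i)pqm+(1+\mathrm i)pqp\\&+2\,q11-2\,q1q-2\mathrm i\,qmm-2\mathrm i\,qpp-2\,qq1+4\,qqq\}.\end{aligned}$$ **The category $SF$.** Let $G$ be the Grassmann algebra on odd generators $a_1,a_2$, with coproduct $\Delta(a_j)=a_j\otimes1+1\otimes a_j$, counit $a_j\mapsto 0$ and antipode $a_j\mapsto-a_j$ (denoted $S_G$). $SF=SF_0\oplus SF_1$, where $SF_0$ is the category of finite-dimensional representations of $G$ in super vector spaces and $SF_1$ is that of finite-dimensional super vector spaces. The tensor product $X*Y$ is $X\otimes Y\in SF_0$ (action via $\Delta$) for $X,Y\in SF_0$; $X\otimes Y\in SF_1$ if exactly one of $X,Y$ is in $SF_1$; and $G\otimes X\otimes Y\in SF_0$ (action on $G$) for $X,Y\in SF_1$. The unit is $\mathbb C\in SF_0$ with trivial action, with the evident unit isomorphisms. The associator $\alpha^{SF}_{X,Y,Z}:X*(Y*Z)\to(X*Y)*Z$ is, according to the sectors of $X,Y,Z$: 000, 001,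 100: the identity; 010: $\exp(C^{(13)})$ on $X\otimes Y\otimes Z$; 101: $\exp(C^{(13)})$ on the factors $G$ and $Y$ of $G\otimes X\otimes Y\otimes Z$; 011: $[\{\mathrm{id}_G\otimes(\rho^X\circ(S_G\otimes\mathrm{id}_X))\}\circ\{\Delta\otimes\mathrm{id}_X\}\circ\tau_{X,G}]\otimes\mathrm{id}_{Y\otimes Z}$; 110: $\{\mathrm{id}_{G\otimes X\otimes Y}\otimes\rho^Z\}\circ\{\mathrm{id}_G\otimes\tau_{G,X\otimes Y}\otimes\mathrm{id}_Z\}\circ\{\Delta\otimes\mathrm{id}_{X\otimes Y\otimes Z}\}$; 111: $\{\phi\otimes\mathrm{id}_{X\otimes Y\otimes Z}\}\circ\{\tau_{X,G}\otimes\mathrm{id}_{Y\otimes Z}\}$. Here $\rho$ denotes action maps, $C^{(13)}(x\otimes y\otimes z)=(-1)^{|x|+|y|}(a_2x\otimes y\otimes a_1z-a_1x\otimes y\otimes a_2z)$, and $\phi(1)=\beta^2a_1a_2$, $\phi(a_j)=\beta^2a_j$, $\phi(a_1a_2)=-\beta^2 1$. **The functor $D$ and $\Delta_{U,V}$.** Let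 $\mathsf b=x^-x^+e_1$, $B=S\mathsf b$, and let $R_a$ be right multiplication by $a$. Then $D:SF\to\mathrm{Rep}\,S$ sends $U\in SF_0$ to $U$ with $x^+u=a_1u$, $x^-u=a_2u$, $Lu=u$, and $U\in SF_1$ to $B\otimes U$ with $S$ acting on $B$. With $\delta_0=1\otimes1+x^-\otimes x^+$ and $\delta_1=1+x^+x^-$, the map $\Delta_{U,V}:D(U*V)\to D(U)\otimes D(V)$ is 00: $(\rho^U\otimes\rho^V)\circ(\mathrm{id}\otimes\tau_{S,U}\otimes\mathrm{id})\circ(\delta_0\otimes\mathrm{id}\otimes\mathrm{id})$; 01: $(\rho^U\otimes R_{\mathsf b}\otimes\mathrm{id})\circ(R_{\delta_1}\otimes\tau_{S,U}\otimes\mathrm{id})\circ(\Delta^S\otimes\mathrm{id}\otimes\mathrm{id})$; 10: $(R_{\mathsf b}\otimes\mathrm{id}\otimes\rho^V)\circ(\mathrm{id}\otimes\tau_{S,U}\otimes\mathrm{id})\circ(\Delta^S\otimes\mathrm{id}\otimes\mathrm{id})$; 11: $(\mathrm{id}\otimes\tau_{B,U}\otimes\mathrm{id})\circ([(R_{\mathsf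 b}\otimes R_{\mathsf b})\circ\Delta^S]\otimes\mathrm{id}\otimes\mathrm{id})$, where $G$ is identified with $S_0$ by $a_1\mapsto x^+e_0$, $a_2\mapsto x^-e_0$. **Proposition.** (1) The maps $\alpha^{\mathrm{Rep}S}_{U,V,W}:U\otimes(V\otimes W)\to(U\otimes V)\otimes W$ given by the action of $\Lambda$, $u\otimes v\otimes w\mapsto\Lambda.(u\otimes v\otimes w)$, are natural isomorphisms in $\mathrm{Rep}\,S$ and make $\mathrm{Rep}\,S$ a monoidal category; $SF$ is a monoidal category with $\alpha^{SF}$; the $\Delta_{U,V}$ are natural isomorphisms in $\mathrm{Rep}\,S$; and the equivalence $D$ with $\Delta_{U,V}$ and the isomorphism $D(1)\cong1$ is a monoidal equivalence $SF\to\mathrm{Rep}\,S$. (2) For all $a,b,c\in\{0,1\}$, $\tilde\Lambda^{abc}$ is the unique $t\in S_a\otimes S_b\otimes S_c$ such that for all $X\in SF_a$, $Y\in SF_b$, $Z\in SF_c$ $$ t\,.\,\big((\mathrm{id}\otimes\Delta_{Y,Z})\circ\Delta_{X,Y*Z}\big)=(\Delta_{X,Y}\otimes\mathrm{id})\circ\Delta_{X*Y,Z}\circ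 D(\alpha^{SF}_{X,Y,Z}).$$ -/

import Mathlib

noncomputable section

open CategoryTheory TensorProduct

namespace SympFerm

/-! ### Super vector spaces -/

/-- A finite-dimensional complex super vector space, given by a finite-dimensional vector space
together with its parity involution `ω`: the even part is the `+1` eigenspace of `ω`, the odd
part is its `-1` eigenspace. -/
structure SVect where
  carrier : Type
  [acg : AddCommGroup carrier]
  [mod : Module ℂ carrier]
  [fd : FiniteDimensional ℂ carrier]
  ω : carrier →ₗ[ℂ] carrier
  ω_ω : ∀ x, ω (ω x) = x

attribute [instance] SVect.acg SVect.mod SVect.fd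

/-- Morphisms of super vector spaces: the linear maps which preserve the parity. -/
@[ext]
structure SVect.Hom (X Y : SVect) where
  lin : X.carrier →ₗ[ℂ] Y.carrier
  lin_ω : ∀ x, lin (X.ω x) = Y.ω (lin x)

instance : Category SVect where
  Hom := SVect.Hom
  id X := ⟨LinearMap.id, fun _ => rfl⟩
  comp f g := ⟨g.lin ∘ₗ f.lin, fun x => by simp [f.lin_ω, g.lin_ω]⟩

/-- The even part of a super vector space. -/
def SVect.even (X : SVect) : Submodule ℂ X.carrier := LinearMap.ker (X.ω - LinearMap.id)

/-- The odd part of a super vector space. -/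
def SVect.odd (X : SVect) : Submodule ℂ X.carrier := LinearMap.ker (X.ω + LinearMap.id)

theorem SVect.isCompl_even_odd (X : SVect) : IsCompl X.even X.odd := by
  constructor
  · rw [Submodule.disjoint_def]
    intro x h0 h1
    simp only [SVect.even, SVect.odd, LinearMap.mem_ker, LinearMap.sub_apply, LinearMap.add_apply,
      LinearMap.id_apply] at h0 h1
    have h2 : X.ω x = x := sub_eq_zero.mp h0
    rw [h2, ← two_smul ℂ x] at h1
    exact (smul_eq_zero.mp h1).resolve_left two_ne_zero
  · rw [codisjoint_iff, eq_top_iff]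
    intro x _
    rw [Submodule.mem_sup]
    refine ⟨(2⁻¹ : ℂ) • (x + X.ω x), ?_, (2⁻¹ : ℂ) • (x - X.ω x), ?_, ?_⟩
    · simp [SVect.even, X.ω_ω, add_comm]
    · simp [SVect.odd, X.ω_ω]
    · module

section Linear

variable {A B X Y : Type} [AddCommGroup A] [AddCommGroup B] [AddCommGroup X] [AddCommGroup Y]
  [Module ℂ A] [Module ℂ B] [Module ℂ X] [Module ℂ Y]

/-- The projection to the even part. -/
def ev (ω : X →ₗ[ℂ] X) : X →ₗ[ℂ] X := (2⁻¹ : ℂ) • (LinearMap.id + ω)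

/-- The projection to the odd part. -/
def od (ω : X →ₗ[ℂ] X) : X →ₗ[ℂ] X := (2⁻¹ : ℂ) • (LinearMap.id - ω)

/-- The symmetric braiding `x ⊗ y ↦ (-1)^{|x||y|} y ⊗ x` of super vector spaces, for the parity
involutions `ω` on `X` and `ω'` on `Y`: if `y` is even it is `y ⊗ x`, if `y` is odd it is
`y ⊗ ω x`. -/
def sflip (ω : X →ₗ[ℂ] X) (ω' : Y →ₗ[ℂ] Y) : X ⊗[ℂ] Y →ₗ[ℂ] Y ⊗[ℂ] X :=
  (map (ev ω') LinearMap.id + map (od ω') ω) ∘ₗ (TensorProduct.comm ℂ X Y).toLinearMap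

/-- `id ⊗ sflip ⊗ id : A ⊗ B ⊗ X ⊗ Y → A ⊗ X ⊗ B ⊗ Y`, i.e. `(a ⊗ b) ⊗ (x ⊗ y)` is sent to
`(-1)^{|b||x|} (a ⊗ x) ⊗ (b ⊗ y)`. -/
def shuffle (ωB : B →ₗ[ℂ] B) (ωX : X →ₗ[ℂ] X) :
    (A ⊗[ℂ] B) ⊗[ℂ] (X ⊗[ℂ] Y) →ₗ[ℂ] (A ⊗[ℂ] X) ⊗[ℂ] (B ⊗[ℂ] Y) :=
  (map (map LinearMap.id LinearMap.id) (map (ev ωB) LinearMap.id)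
    + map (map LinearMap.id ωX) (map (od ωB) LinearMap.id)) ∘ₗ
    (TensorProduct.tensorTensorTensorComm ℂ A B X Y).toLinearMap

theorem sflip_even (ω : X →ₗ[ℂ] X) (ω' : Y →ₗ[ℂ] Y) (x : X) (y : Y) (hy : ω' y = y) :
    sflip ω ω' (x ⊗ₜ y) = y ⊗ₜ x := by
  have h : (2⁻¹ : ℂ) • y + (2⁻¹ : ℂ) • y = y := by module
  simp [sflip, ev, od, hy, h]

theorem sflip_odd (ω : X →ₗ[ℂ] X) (ω' : Y →ₗ[ℂ] Y) (x : X) (y : Y) (hy : ω' y = -y) :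
    sflip ω ω' (x ⊗ₜ y) = y ⊗ₜ ω x := by
  have h : (2⁻¹ : ℂ) • y + (2⁻¹ : ℂ) • y = y := by module
  simp [sflip, ev, od, hy, h]

end Linear

/-- The tensor product of super vector spaces. -/
abbrev SVect.tensor (X Y : SVect) : SVect where
  carrier := X.carrier ⊗[ℂ] Y.carrier
  ω := map X.ω Y.ω
  ω_ω x := by
    have h : map X.ω Y.ω ∘ₗ map X.ω Y.ω = LinearMap.id := by
      ext a b; simp [X.ω_ω, Y.ω_ω]
    exact LinearMap.congr_fun h x

/-- The direct sum of super vector spaces. -/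
abbrev SVect.dsum (X Y : SVect) : SVect where
  carrier := X.carrier × Y.carrier
  ω := LinearMap.prodMap X.ω Y.ω
  ω_ω x := by simp [X.ω_ω, Y.ω_ω]

/-- The zero super vector space. -/
abbrev SVect.zero : SVect where
  carrier := PUnit
  ω := LinearMap.id
  ω_ω _ := rfl

/-- The tensor product of morphisms of super vector spaces. -/
def SVect.tensorMap {X X' Y Y' : SVect} (f : X ⟶ X') (g : Y ⟶ Y') :
    X.tensor Y ⟶ X'.tensor Y' where
  lin := map f.lin g.lin
  lin_ω x := by
    have h : map f.lin g.lin ∘ₗ map X.ω Y.ω = map X'.ω Y'.ω ∘ₗ map f.lin g.lin := by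
      ext a b; simp [f.lin_ω, g.lin_ω]
    exact LinearMap.congr_fun h x

/-- The direct sum of morphisms of super vector spaces. -/
def SVect.dsumMap {X X' Y Y' : SVect} (f : X ⟶ X') (g : Y ⟶ Y') :
    X.dsum Y ⟶ X'.dsum Y' where
  lin := LinearMap.prodMap f.lin g.lin
  lin_ω x := by simp [f.lin_ω, g.lin_ω]

/-! ### Superalgebras and their representations in super vector spaces -/

/-- A superalgebra over `ℂ`: an algebra with an algebra involution `par`, the parity involution. -/
class SuperAlgebra (A : Type) [Ring A] [Algebra ℂ A] where
  par : A →ₐ[ℂ] A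
  par_par : ∀ a, par (par a) = a

open SuperAlgebra

/-- A finite-dimensional representation of a superalgebra `A` in super vector spaces. -/
structure SRep (A : Type) [Ring A] [Algebra ℂ A] [SuperAlgebra A] extends SVect where
  ρ : A →ₐ[ℂ] Module.End ℂ carrier
  ω_ρ : ∀ a x, ω (ρ a x) = ρ (par a) (ω x)

section SRep

set_option linter.unusedSectionVars false

variable {A B : Type} [Ring A] [Algebra ℂ A] [SuperAlgebra A]
  [Ring B] [Algebra ℂ B] [SuperAlgebra B]

/-- Morphisms of representations: parity preserving linear maps which commute with the action. -/
@[ext]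
structure SRep.Hom (U V : SRep A) where
  lin : U.carrier →ₗ[ℂ] V.carrier
  lin_ω : ∀ x, lin (U.ω x) = V.ω (lin x)
  lin_ρ : ∀ a x, lin (U.ρ a x) = V.ρ a (lin x)

instance : Category (SRep A) where
  Hom := SRep.Hom
  id X := ⟨LinearMap.id, fun _ => rfl, fun _ _ => rfl⟩
  comp f g := ⟨g.lin ∘ₗ f.lin, fun x => by simp [f.lin_ω, g.lin_ω],
    fun a x => by simp [f.lin_ρ, g.lin_ρ]⟩

/-- The morphism of super vector spaces underlying a morphism of representations. -/
def SRep.Hom.toSVect {U V : SRep A} (f : U ⟶ V) : U.toSVect ⟶ V.toSVect := ⟨f.lin, f.lin_ω⟩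

/-- The action map `A ⊗ U → U`. -/
def SRep.actMap (U : SRep A) : A ⊗[ℂ] U.carrier →ₗ[ℂ] U.carrier := TensorProduct.lift U.ρ.toLinearMap

/-- The direct sum of representations. -/
abbrev SRep.dsum (U V : SRep A) : SRep A where
  toSVect := U.toSVect.dsum V.toSVect
  ρ := (LinearMap.prodMapAlgHom ℂ U.carrier V.carrier).comp (U.ρ.prod V.ρ)
  ω_ρ a x := by simp [U.ω_ρ, V.ω_ρ]

/-- The direct sum of morphisms of representations. -/
def SRep.dsumMap {U U' V V' : SRep A} (f : U ⟶ U') (g : V ⟶ V') : U.dsum V ⟶ U'.dsum V' where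
  lin := LinearMap.prodMap f.lin g.lin
  lin_ω x := by simp [f.lin_ω, g.lin_ω]
  lin_ρ a x := by simp [f.lin_ρ, g.lin_ρ]

/-- The tensor product of a representation with a super vector space, with `A` acting on the
first tensor factor only. -/
abbrev SRep.tensorSVect (M : SRep A) (X : SVect) : SRep A where
  toSVect := M.toSVect.tensor X
  ρ := (Module.End.rTensorAlgHom ℂ M.carrier X.carrier).comp M.ρ
  ω_ρ a x := by
    have h : map M.ω X.ω ∘ₗ LinearMap.rTensor X.carrier (M.ρ a)
        = LinearMap.rTensor X.carrier (M.ρ (par a)) ∘ₗ map M.ω X.ω := by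
      ext u v; simp [M.ω_ρ]
    exact LinearMap.congr_fun h x

/-- `id ⊗ g` as a morphism of representations. -/
def SRep.tensorSVectMap (M : SRep A) {X X' : SVect} (g : X ⟶ X') :
    M.tensorSVect X ⟶ M.tensorSVect X' where
  lin := LinearMap.lTensor M.carrier g.lin
  lin_ω x := by
    have h : LinearMap.lTensor M.carrier g.lin ∘ₗ map M.ω X.ω
        = map M.ω X'.ω ∘ₗ LinearMap.lTensor M.carrier g.lin := by
      ext u v; simp [g.lin_ω]
    exact LinearMap.congr_fun h x
  lin_ρ a x := by
    have h : LinearMap.lTensor M.carrier g.lin ∘ₗ LinearMap.rTensor X.carrier (M.ρ a)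
        = LinearMap.rTensor X'.carrier (M.ρ a) ∘ₗ LinearMap.lTensor M.carrier g.lin := by
      ext u v; simp
    exact LinearMap.congr_fun h x

/-- The pull-back of a representation along a morphism of superalgebras. -/
abbrev SRep.res (φ : A →ₐ[ℂ] B) (hφ : ∀ a, φ (par a) = par (φ a)) (U : SRep B) : SRep A where
  toSVect := U.toSVect
  ρ := U.ρ.comp φ
  ω_ρ a x := by simp [U.ω_ρ, hφ]

/-! ### The tensor product of superalgebras -/

/-- The tensor product of two superalgebras; the underlying vector space is `A ⊗ B`, the product
(defined below) is `(a ⊗ b) (a' ⊗ b') = (-1)^{|b||a'|} (a a') ⊗ (b b')`. -/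
def STensor (A B : Type) [Ring A] [Algebra ℂ A] [Ring B] [Algebra ℂ B] : Type := A ⊗[ℂ] B

namespace STensor

instance : AddCommGroup (STensor A B) := inferInstanceAs (AddCommGroup (A ⊗[ℂ] B))
instance : Module ℂ (STensor A B) := inferInstanceAs (Module ℂ (A ⊗[ℂ] B))

/-- The identity map from the tensor product of superalgebras to the tensor product of the
underlying vector spaces. -/
def equiv (A B : Type) [Ring A] [Algebra ℂ A] [Ring B] [Algebra ℂ B] :
    STensor A B ≃ₗ[ℂ] A ⊗[ℂ] B := LinearEquiv.refl ℂ _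

/-- The linear map `A ⊗ B → End (U ⊗ V)` with
`(a ⊗ b) (u ⊗ v) = (-1)^{|b||u|} (a u) ⊗ (b v)`, where `A` acts on `U` by `ρ` and `B` acts on
`V` by `ρ'`, and `ω` is the parity involution of `U`. -/
def sact {U V : Type} [AddCommGroup U] [Module ℂ U] [AddCommGroup V] [Module ℂ V]
    (ω : U →ₗ[ℂ] U) (ρ : A →ₐ[ℂ] Module.End ℂ U) (ρ' : B →ₐ[ℂ] Module.End ℂ V) :
    STensor A B →ₗ[ℂ] Module.End ℂ (U ⊗[ℂ] V) :=
  (TensorProduct.lift <| LinearMap.mk₂ ℂ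
    (fun a b => map (ρ a) (ρ' (ev (par (A := B)).toLinearMap b))
      + map (ρ a ∘ₗ ω) (ρ' (od (par (A := B)).toLinearMap b)))
    (fun a a' b => by simp only [map_add, LinearMap.add_comp, map_add_left]; abel)
    (fun c a b => by simp only [map_smul, LinearMap.smul_comp, map_smul_left, smul_add])
    (fun a b b' => by simp only [map_add, map_add_right]; abel)
    (fun c a b => by simp only [map_smul, map_smul_right, smul_add])) ∘ₗ (equiv A B).toLinearMap

/-- Pure tensors. -/
def pt (a : A) (b : B) : STensor A B := (equiv A B).symm (a ⊗ₜ b)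

/-- The left regular representation, as an algebra homomorphism. -/
abbrev lreg (A : Type) [Ring A] [Algebra ℂ A] : A →ₐ[ℂ] Module.End ℂ A := Algebra.lmul ℂ A

instance : Mul (STensor A B) where
  mul s t := sact (par (A := A)).toLinearMap (lreg A) (lreg B) s t

instance : One (STensor A B) := ⟨pt 1 1⟩

theorem one_def : (1 : STensor A B) = pt 1 1 := rfl

theorem mul_def (s t : STensor A B) :
    s * t = sact (par (A := A)).toLinearMap (lreg A) (lreg B) s t := rfl

theorem ev_add_od (b : B) : ev (par (A := B)).toLinearMap b + od (par (A := B)).toLinearMap b = b := by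
  simp only [ev, od, LinearMap.smul_apply, LinearMap.add_apply, LinearMap.sub_apply,
    LinearMap.id_apply]
  module

theorem par_ev (b : B) : par (ev (par (A := B)).toLinearMap b) = ev (par (A := B)).toLinearMap b := by
  simp [ev, par_par, add_comm]

theorem par_od (b : B) :
    par (od (par (A := B)).toLinearMap b) = -od (par (A := B)).toLinearMap b := by
  simp only [od, LinearMap.smul_apply, LinearMap.sub_apply, LinearMap.id_apply,
    AlgHom.toLinearMap_apply, map_smul, map_sub, par_par]
  module

theorem ev_of_even {b : B} (h : par b = b) : ev (par (A := B)).toLinearMap b = b := by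
  simp only [ev, LinearMap.smul_apply, LinearMap.add_apply, LinearMap.id_apply,
    AlgHom.toLinearMap_apply, h]
  module

theorem od_of_even {b : B} (h : par b = b) : od (par (A := B)).toLinearMap b = 0 := by
  simp [od, h]

theorem ev_of_odd {b : B} (h : par b = -b) : ev (par (A := B)).toLinearMap b = 0 := by
  simp [ev, h]

theorem od_of_odd {b : B} (h : par b = -b) : od (par (A := B)).toLinearMap b = b := by
  simp only [od, LinearMap.smul_apply, LinearMap.sub_apply, LinearMap.id_apply,
    AlgHom.toLinearMap_apply, h]
  module

section Act

variable {U V : Type} [AddCommGroup U] [Module ℂ U] [AddCommGroup V] [Module ℂ V]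
  (ω : U →ₗ[ℂ] U) (ρ : A →ₐ[ℂ] Module.End ℂ U) (ρ' : B →ₐ[ℂ] Module.End ℂ V)

theorem sact_even (a : A) {b : B} (h : par b = b) (u : U) (v : V) :
    sact ω ρ ρ' (pt a b) (u ⊗ₜ v) = ρ a u ⊗ₜ ρ' b v := by
  simp [sact, pt, ev_of_even h, od_of_even h]

theorem sact_odd (a : A) {b : B} (h : par b = -b) (u : U) (v : V) :
    sact ω ρ ρ' (pt a b) (u ⊗ₜ v) = ρ a (ω u) ⊗ₜ ρ' b v := by
  simp [sact, pt, ev_of_odd h, od_of_odd h]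

end Act

/-- Induction on homogeneous pure tensors. -/
theorem induction {p : STensor A B → Prop} (s : STensor A B)
    (h_even : ∀ a b, par b = b → p (pt a b)) (h_odd : ∀ a b, par b = -b → p (pt a b))
    (h_add : ∀ s t, p s → p t → p (s + t)) : p s := by
  refine TensorProduct.induction_on (motive := p) s ?_ ?_ h_add
  · have := h_even 0 0 (by simp)
    rwa [pt, TensorProduct.zero_tmul, map_zero] at this
  · intro a b
    have := h_add _ _ (h_even a _ (par_ev b)) (h_odd a _ (par_od b))
    rwa [pt, pt, ← map_add, ← TensorProduct.tmul_add, ev_add_od] at this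

theorem pt_mul_even (a : A) {b : B} (h : par b = b) (a' : A) (b' : B) :
    pt a b * pt a' b' = pt (a * a') (b * b') :=
  sact_even _ _ _ a h a' b'

theorem pt_mul_odd (a : A) {b : B} (h : par b = -b) (a' : A) (b' : B) :
    pt a b * pt a' b' = pt (a * par a') (b * b') :=
  sact_odd _ _ _ a h a' b'

theorem sact_mul {U V : Type} [AddCommGroup U] [Module ℂ U] [AddCommGroup V] [Module ℂ V]
    (ω : U →ₗ[ℂ] U) (hω : ∀ u, ω (ω u) = u) (ρ : A →ₐ[ℂ] Module.End ℂ U)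
    (hρ : ∀ a u, ω (ρ a u) = ρ (par a) (ω u))
    (ρ' : B →ₐ[ℂ] Module.End ℂ V) (s t : STensor A B) :
    sact ω ρ ρ' (s * t : STensor A B) = sact ω ρ ρ' s * sact ω ρ ρ' t := by
  induction s using STensor.induction with
  | h_add s s' hs hs' =>
    have : (s + s') * t = s * t + s' * t := by
      rw [mul_def, mul_def, mul_def]
      exact LinearMap.congr_fun (map_add (sact _ _ _) s s') t
    rw [this]
    rw [map_add, map_add]
    rw [hs, hs', add_mul]
  | h_even a b hb =>
    induction t using STensor.induction with
    | h_add t t' ht ht' =>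
      have : pt a b * (t + t') = pt a b * t + pt a b * t' := by
        rw [mul_def, mul_def, mul_def]
        exact map_add (sact _ _ _ (pt a b)) t t'
      rw [this]
      rw [map_add, map_add]
      rw [ht, ht', mul_add]
    | h_even a' b' hb' =>
      rw [pt_mul_even a hb]
      refine TensorProduct.ext' fun u v => ?_
      rw [Module.End.mul_apply]
      rw [sact_even _ _ _ _ hb', sact_even _ _ _ _ hb, sact_even _ _ _ _ (by simp [hb, hb'])]
      simp
    | h_odd a' b' hb' =>
      rw [pt_mul_even a hb]
      refine TensorProduct.ext' fun u v => ?_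
      rw [Module.End.mul_apply]
      rw [sact_odd _ _ _ _ hb', sact_even _ _ _ _ hb, sact_odd _ _ _ _ (by simp [hb, hb'])]
      simp
  | h_odd a b hb =>
    induction t using STensor.induction with
    | h_add t t' ht ht' =>
      have : pt a b * (t + t') = pt a b * t + pt a b * t' := by
        rw [mul_def, mul_def, mul_def]
        exact map_add (sact _ _ _ (pt a b)) t t'
      rw [this]
      rw [map_add, map_add]
      rw [ht, ht', mul_add]
    | h_even a' b' hb' =>
      rw [pt_mul_odd a hb]
      refine TensorProduct.ext' fun u v => ?_
      rw [Module.End.mul_apply]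
      rw [sact_even _ _ _ _ hb', sact_odd _ _ _ _ hb, sact_odd _ _ _ _ (by simp [hb, hb'])]
      simp [hρ]
    | h_odd a' b' hb' =>
      rw [pt_mul_odd a hb]
      refine TensorProduct.ext' fun u v => ?_
      rw [Module.End.mul_apply]
      rw [sact_odd _ _ _ _ hb', sact_odd _ _ _ _ hb, sact_even _ _ _ _ (by simp [hb, hb'])]
      simp [hρ, hω]

theorem sact_one {U V : Type} [AddCommGroup U] [Module ℂ U] [AddCommGroup V] [Module ℂ V]
    (ω : U →ₗ[ℂ] U) (ρ : A →ₐ[ℂ] Module.End ℂ U) (ρ' : B →ₐ[ℂ] Module.End ℂ V) :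
    sact ω ρ ρ' (1 : STensor A B) = 1 := by
  refine TensorProduct.ext' fun u v => ?_
  rw [one_def, sact_even _ _ _ _ (by simp)]
  simp

instance : Ring (STensor A B) :=
  { (inferInstance : AddCommGroup (STensor A B)), (inferInstance : Mul (STensor A B)),
    (inferInstance : One (STensor A B)) with
    left_distrib := fun s t t' => by
      rw [mul_def, mul_def, mul_def]
      exact map_add (sact _ _ _ s) t t'
    right_distrib := fun s s' t => by
      rw [mul_def, mul_def, mul_def]
      exact LinearMap.congr_fun (map_add (sact _ _ _) s s') t
    zero_mul := fun t => by
      rw [mul_def]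
      exact LinearMap.congr_fun (map_zero (sact _ _ _)) t
    mul_zero := fun s => by
      rw [mul_def]
      exact map_zero (sact _ _ _ s)
    mul_assoc := fun s t r => by
      rw [mul_def (s * t) r, sact_mul _ (by simp [par_par]) _ (by simp)]
      rfl
    one_mul := fun t => by
      rw [mul_def, sact_one]; rfl
    mul_one := fun s => by
      induction s using STensor.induction with
      | h_even a b h => rw [one_def, pt_mul_even a h, mul_one, mul_one]
      | h_odd a b h => rw [one_def, pt_mul_odd a h, map_one, mul_one, mul_one]
      | h_add s t hs ht =>
        have : (s + t) * (1 : STensor A B) = s * 1 + t * 1 := by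
          rw [mul_def, mul_def, mul_def]
          exact LinearMap.congr_fun (map_add (sact _ _ _) s t) 1
        rw [this, hs, ht] }

instance : Algebra ℂ (STensor A B) :=
  Algebra.ofModule
    (fun c s t => by
      rw [mul_def, mul_def]
      exact LinearMap.congr_fun (map_smul (sact _ _ _) c s) t)
    (fun c s t => by
      rw [mul_def, mul_def]
      exact map_smul (sact _ _ _ s) c t)

theorem pt_add (a : A) (b b' : B) : pt a (b + b') = pt a b + pt a b' := by
  simp [pt, TensorProduct.tmul_add]

/-- The parity involution `par ⊗ par`. -/
def parLin : STensor A B →ₗ[ℂ] STensor A B :=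
  (equiv A B).symm.toLinearMap ∘ₗ
    map (par (A := A)).toLinearMap (par (A := B)).toLinearMap ∘ₗ (equiv A B).toLinearMap

theorem parLin_pt (a : A) (b : B) : parLin (pt a b) = pt (par a) (par b) := by
  simp [parLin, pt]

theorem parLin_mul (s t : STensor A B) : parLin (s * t) = parLin s * parLin t := by
  induction s using STensor.induction with
  | h_add s s' hs hs' => rw [add_mul, map_add, map_add, hs, hs', add_mul]
  | h_even a b hb =>
    induction t using STensor.induction with
    | h_add t t' ht ht' => rw [mul_add, map_add, map_add, ht, ht', mul_add]
    | h_even a' b' hb' =>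
      simp only [pt_mul_even, hb, parLin_pt, map_mul]
    | h_odd a' b' hb' =>
      simp only [pt_mul_even, hb, parLin_pt, map_mul]
  | h_odd a b hb =>
    have hb2 : par (-b) = -(-b) := by rw [map_neg, hb]
    induction t using STensor.induction with
    | h_add t t' ht ht' => rw [mul_add, map_add, map_add, ht, ht', mul_add]
    | h_even a' b' hb' =>
      rw [pt_mul_odd _ hb, parLin_pt, parLin_pt, parLin_pt, hb, pt_mul_odd _ hb2]
      simp [hb]
    | h_odd a' b' hb' =>
      rw [pt_mul_odd _ hb, parLin_pt, parLin_pt, parLin_pt, hb, pt_mul_odd _ hb2]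
      simp [hb]

/-- The parity of a tensor product is the sum of the parities. -/
instance : SuperAlgebra (STensor A B) where
  par := AlgHom.ofLinearMap parLin (by simp [one_def, parLin_pt]) parLin_mul
  par_par s := by
    change parLin (parLin s) = s
    induction s using STensor.induction with
    | h_add s t hs ht => rw [map_add, map_add, hs, ht]
    | h_even a b h => rw [parLin_pt, parLin_pt, par_par, par_par]
    | h_odd a b h => rw [parLin_pt, parLin_pt, par_par, par_par]

theorem par_pt (a : A) (b : B) : par (pt a b) = pt (par a) (par b) := parLin_pt a b

end STensor

open STensor

/-- The external tensor product: `A ⊗ B` acts on `U ⊗ V` by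
`(a ⊗ b) (u ⊗ v) = (-1)^{|b||u|} (a u) ⊗ (b v)`. -/
abbrev SRep.ext (U : SRep A) (V : SRep B) : SRep (STensor A B) where
  toSVect := U.toSVect.tensor V.toSVect
  ρ := AlgHom.ofLinearMap (sact U.ω U.ρ V.ρ) (sact_one _ _ _)
    (sact_mul _ U.ω_ω _ U.ω_ρ _)
  ω_ρ s x := by
    induction s using STensor.induction with
    | h_add s t hs ht =>
      simp only [map_add, LinearMap.add_apply, hs, ht]
    | h_even a b h =>
      induction x using TensorProduct.induction_on with
      | zero => simp
      | add x y hx hy => simp only [map_add, hx, hy]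
      | tmul u v =>
        have h2 : par (par b) = par b := by rw [h, h]
        simp [sact_even, par_pt, h, U.ω_ρ, V.ω_ρ]
    | h_odd a b h =>
      induction x using TensorProduct.induction_on with
      | zero => simp
      | add x y hx hy => simp only [map_add, hx, hy]
      | tmul u v =>
        have h2 : par (-b) = -(-b) := by rw [map_neg, h]
        simp only [AlgHom.ofLinearMap_apply, par_pt, h, sact_odd _ _ _ _ h, map_tmul,
          sact_odd _ _ _ _ h2, U.ω_ρ, V.ω_ρ]

theorem SRep.ext_lin_ρ {U U' : SRep A} {V V' : SRep B} (f : U ⟶ U') (g : V ⟶ V')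
    (s : STensor A B) (x : (U.ext V).carrier) :
    map f.lin g.lin ((U.ext V).ρ s x) = (U'.ext V').ρ s (map f.lin g.lin x) := by
  induction s using STensor.induction with
  | h_add s t hs ht => simp only [map_add, LinearMap.add_apply, hs, ht]
  | h_even a b h =>
    induction x using TensorProduct.induction_on with
    | zero => simp
    | add x y hx hy => simp only [map_add, hx, hy]
    | tmul u v => simp [sact_even, h, f.lin_ρ, g.lin_ρ]
  | h_odd a b h =>
    induction x using TensorProduct.induction_on with
    | zero => simp
    | add x y hx hy => simp only [map_add, hx, hy]
    | tmul u v => simp [sact_odd, h, f.lin_ρ, g.lin_ρ, f.lin_ω]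

/-- The tensor product of representations of a superalgebra `A` with respect to a coproduct
`Δ : A → A ⊗ A`. -/
abbrev SRep.tensor (Δ : A →ₐ[ℂ] STensor A A) (hΔ : ∀ a, Δ (par a) = par (Δ a)) (U V : SRep A) :
    SRep A :=
  (U.ext V).res Δ hΔ

/-- The tensor product of morphisms of representations. -/
def SRep.tensorMap (Δ : A →ₐ[ℂ] STensor A A) (hΔ : ∀ a, Δ (par a) = par (Δ a))
    {U U' V V' : SRep A} (f : U ⟶ U') (g : V ⟶ V') :
    SRep.tensor Δ hΔ U V ⟶ SRep.tensor Δ hΔ U' V' where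
  lin := map f.lin g.lin
  lin_ω x := (SVect.tensorMap f.toSVect g.toSVect).lin_ω x
  lin_ρ a x := SRep.ext_lin_ρ f g (Δ a) x

end SRep

open STensor

/-! ### The Grassmann algebra on two generators -/

/-- The Grassmann algebra on two generators: the algebra with basis `1, a₁, a₂, a₁ a₂` and
relations `a₁² = a₂² = 0`, `a₂ a₁ = - a₁ a₂`. -/
abbrev Grass : Type := QuaternionAlgebra ℂ 0 0 0

namespace Grass

def a1 : Grass := ⟨0, 1, 0, 0⟩
def a2 : Grass := ⟨0, 0, 1, 0⟩

theorem a1_mul_a1 : a1 * a1 = 0 := by ext <;> simp [a1]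
theorem a2_mul_a2 : a2 * a2 = 0 := by ext <;> simp [a2]
theorem a1_mul_a2 : a1 * a2 = ⟨0, 0, 0, 1⟩ := by ext <;> simp [a1, a2]
theorem a2_mul_a1 : a2 * a1 = -(a1 * a2) := by ext <;> simp [a1, a2]

/-- The algebra homomorphism from the Grassmann algebra with given values on `a₁` and `a₂`. -/
def lift {C : Type} [Ring C] [Algebra ℂ C] (i j : C) (hi : i * i = 0) (hj : j * j = 0)
    (hij : j * i = -(i * j)) : Grass →ₐ[ℂ] C :=
  QuaternionAlgebra.Basis.liftHom
    { i := i, j := j, k := i * j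
      i_mul_i := by simp [hi]
      j_mul_j := by simp [hj]
      i_mul_j := rfl
      j_mul_i := by simp [hij] }

section

variable {C : Type} [Ring C] [Algebra ℂ C] (i j : C) (hi : i * i = 0) (hj : j * j = 0)
    (hij : j * i = -(i * j))

theorem lift_a1 : lift i j hi hj hij a1 = i := by
  simp [lift, QuaternionAlgebra.Basis.lift, a1]

theorem lift_a2 : lift i j hi hj hij a2 = j := by
  simp [lift, QuaternionAlgebra.Basis.lift, a2]

theorem algHom_ext {f g : Grass →ₐ[ℂ] C} (h1 : f a1 = g a1) (h2 : f a2 = g a2) : f = g :=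
  QuaternionAlgebra.hom_ext h1 h2

end

/-- The generators `a₁`, `a₂` are odd. -/
instance : SuperAlgebra Grass where
  par := lift (-a1) (-a2) (by simp [a1_mul_a1]) (by simp [a2_mul_a2]) (by simp [a2_mul_a1])
  par_par a := by
    have h : (lift (-a1) (-a2) (by simp [a1_mul_a1]) (by simp [a2_mul_a2])
        (by simp [a2_mul_a1])).comp (lift (-a1) (-a2) (by simp [a1_mul_a1])
        (by simp [a2_mul_a2]) (by simp [a2_mul_a1])) = AlgHom.id ℂ Grass := by
      apply algHom_ext <;> simp [lift_a1, lift_a2]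
    exact AlgHom.congr_fun h a

theorem par_a1 : par a1 = -a1 := lift_a1 _ _ _ _ _
theorem par_a2 : par a2 = -a2 := lift_a2 _ _ _ _ _

theorem cop_aux (x y : Grass) (hx : par x = -x) (hy : par y = -y) :
    (pt x 1 + pt 1 x) * (pt y 1 + pt 1 y)
      = pt (x * y) 1 + pt x y - pt y x + pt 1 (x * y) := by
  have h1 : par (1 : Grass) = 1 := map_one _
  have hn : pt (-y) x = -pt y x := by simp [pt, TensorProduct.neg_tmul]
  rw [add_mul, mul_add, mul_add, pt_mul_even _ h1, pt_mul_even _ h1, pt_mul_odd _ hx,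
    pt_mul_odd _ hx, hy, h1]
  simp only [one_mul, mul_one, hn]
  abel

/-- The coproduct `Δ(a_j) = a_j ⊗ 1 + 1 ⊗ a_j`. -/
def cop : Grass →ₐ[ℂ] STensor Grass Grass :=
  lift (pt a1 1 + pt 1 a1) (pt a2 1 + pt 1 a2)
    (by rw [cop_aux _ _ par_a1 par_a1, a1_mul_a1]; simp [pt])
    (by rw [cop_aux _ _ par_a2 par_a2, a2_mul_a2]; simp [pt])
    (by
      rw [cop_aux _ _ par_a1 par_a2, cop_aux _ _ par_a2 par_a1, a2_mul_a1]
      simp only [pt, TensorProduct.neg_tmul, TensorProduct.tmul_neg, map_neg]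
      abel)

theorem cop_par (a : Grass) : cop (par a) = par (cop a) := by
  have h : cop.comp (par (A := Grass)) = (par (A := STensor Grass Grass)).comp cop := by
    apply algHom_ext
    · simp [par_a1, cop, lift_a1, par_pt]
      simp [pt, TensorProduct.neg_tmul, TensorProduct.tmul_neg]
      abel
    · simp [par_a2, cop, lift_a2, par_pt]
      simp [pt, TensorProduct.neg_tmul, TensorProduct.tmul_neg]
      abel
  exact AlgHom.congr_fun h a

/-- The coproduct as a linear map. -/
def copLin : Grass →ₗ[ℂ] Grass ⊗[ℂ] Grass := (equiv Grass Grass).toLinearMap ∘ₗ cop.toLinearMap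

/-- The counit. -/
def counit : Grass →ₐ[ℂ] ℂ := lift 0 0 (by simp) (by simp) (by simp)

theorem counit_par (a : Grass) : counit (par a) = counit a := by
  have h : counit.comp (par (A := Grass)) = counit := by
    apply algHom_ext <;> simp [par_a1, par_a2, counit, lift_a1, lift_a2]
  exact AlgHom.congr_fun h a

/-- The antipode: `1 ↦ 1`, `a_j ↦ - a_j`, and `a₁ a₂ ↦ - S(a₂) S(a₁) = a₁ a₂`. -/
def antipode : Grass →ₗ[ℂ] Grass where
  toFun g := ⟨g.re, -g.imI, -g.imJ, g.imK⟩
  map_add' g h := by ext <;> simp <;> ring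
  map_smul' c g := by ext <;> simp

/-- The linear map `φ` with `φ(1) = β² a₁ a₂`, `φ(a₁) = β² a₁`, `φ(a₂) = β² a₂`,
`φ(a₁ a₂) = - β² 1`. -/
def phi (β : ℂ) : Grass →ₗ[ℂ] Grass where
  toFun g := ⟨-β ^ 2 * g.imK, β ^ 2 * g.imI, β ^ 2 * g.imJ, β ^ 2 * g.re⟩
  map_add' g h := by ext <;> simp <;> ring
  map_smul' c g := by ext <;> simp <;> ring

/-- The left regular representation. -/
abbrev reg : SRep Grass where
  carrier := Grass
  ω := (par (A := Grass)).toLinearMap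
  ω_ω := par_par
  ρ := Algebra.lmul ℂ Grass
  ω_ρ a x := by simp

end Grass

/-! ### The algebra `S` -/

/-- The generators `x⁺`, `x⁻`, `L`. -/
inductive SGen : Type
  | xp : SGen
  | xm : SGen
  | L : SGen

open SGen in
/-- The defining relations. -/
inductive SRel : FreeAlgebra ℂ SGen → FreeAlgebra ℂ SGen → Prop
  | xp_L : SRel (FreeAlgebra.ι ℂ xp * FreeAlgebra.ι ℂ L) (FreeAlgebra.ι ℂ L * FreeAlgebra.ι ℂ xp)
  | xm_L : SRel (FreeAlgebra.ι ℂ xm * FreeAlgebra.ι ℂ L) (FreeAlgebra.ι ℂ L * FreeAlgebra.ι ℂ xm)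
  | anti : SRel (FreeAlgebra.ι ℂ xp * FreeAlgebra.ι ℂ xm + FreeAlgebra.ι ℂ xm * FreeAlgebra.ι ℂ xp)
      ((1 / 2 : ℂ) • (1 - FreeAlgebra.ι ℂ L))
  | xp_xp : SRel (FreeAlgebra.ι ℂ xp * FreeAlgebra.ι ℂ xp) 0
  | xm_xm : SRel (FreeAlgebra.ι ℂ xm * FreeAlgebra.ι ℂ xm) 0
  | L_L : SRel (FreeAlgebra.ι ℂ L * FreeAlgebra.ι ℂ L) 1

/-- The algebra `S`: the associative `ℂ`-algebra with generators `x⁺`, `x⁻`, `L` and relations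
`x^± L = L x^±`, `x⁺ x⁻ + x⁻ x⁺ = (1 - L) / 2`, `(x^±)² = 0`, `L² = 1`. -/
def SAlg : Type := RingQuot SRel

namespace SAlg

instance : Ring SAlg := inferInstanceAs (Ring (RingQuot SRel))
instance : Algebra ℂ SAlg := inferInstanceAs (Algebra ℂ (RingQuot SRel))

/-- The quotient map from the free algebra. -/
def mk : FreeAlgebra ℂ SGen →ₐ[ℂ] SAlg := RingQuot.mkAlgHom ℂ SRel

def xp : SAlg := mk (FreeAlgebra.ι ℂ SGen.xp)
def xm : SAlg := mk (FreeAlgebra.ι ℂ SGen.xm)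
def L : SAlg := mk (FreeAlgebra.ι ℂ SGen.L)

theorem mk_surjective : Function.Surjective mk := RingQuot.mkAlgHom_surjective ℂ SRel

theorem mk_rel {a b : FreeAlgebra ℂ SGen} (h : SRel a b) : mk a = mk b := RingQuot.mkAlgHom_rel ℂ h

theorem xp_L : xp * L = L * xp := by simpa [xp, L] using mk_rel SRel.xp_L
theorem xm_L : xm * L = L * xm := by simpa [xm, L] using mk_rel SRel.xm_L
theorem anti : xp * xm + xm * xp = (1 / 2 : ℂ) • (1 - L) := by simpa [xp, xm, L] using mk_rel SRel.anti
theorem xp_xp : xp * xp = 0 := by simpa [xp] using mk_rel SRel.xp_xp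
theorem xm_xm : xm * xm = 0 := by simpa [xm] using mk_rel SRel.xm_xm
theorem L_L : L * L = 1 := by simpa [L] using mk_rel SRel.L_L

section

variable {C : Type} [Ring C] [Algebra ℂ C]

theorem algHom_ext {f g : SAlg →ₐ[ℂ] C} (hp : f xp = g xp) (hm : f xm = g xm) (hL : f L = g L) :
    f = g := by
  refine RingQuot.ringQuot_ext' ℂ f g (FreeAlgebra.hom_ext (funext fun s => ?_))
  cases s
  · exact hp
  · exact hm
  · exact hL

/-- The algebra homomorphism from `S` with given values on the generators. -/
def lift (p m l : C) (hpl : p * l = l * p) (hml : m * l = l * m)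
    (h : p * m + m * p = (1 / 2 : ℂ) • (1 - l)) (hp : p * p = 0) (hm : m * m = 0)
    (hl : l * l = 1) : SAlg →ₐ[ℂ] C :=
  RingQuot.liftAlgHom ℂ ⟨FreeAlgebra.lift ℂ (fun s => SGen.casesOn s p m l), fun x y r => by
    cases r <;> simp only [map_mul, map_add, map_sub, map_smul, map_one, map_zero,
      FreeAlgebra.lift_ι_apply] <;> assumption⟩

variable (p m l : C) (hpl : p * l = l * p) (hml : m * l = l * m)
    (h : p * m + m * p = (1 / 2 : ℂ) • (1 - l)) (hp : p * p = 0) (hm : m * m = 0)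
    (hl : l * l = 1)

theorem lift_xp : lift p m l hpl hml h hp hm hl xp = p := by
  unfold lift xp mk
  exact (RingQuot.liftAlgHom_mkAlgHom_apply ..).trans (FreeAlgebra.lift_ι_apply ..)

theorem lift_xm : lift p m l hpl hml h hp hm hl xm = m := by
  unfold lift xm mk
  exact (RingQuot.liftAlgHom_mkAlgHom_apply ..).trans (FreeAlgebra.lift_ι_apply ..)

theorem lift_L : lift p m l hpl hml h hp hm hl L = l := by
  unfold lift L mk
  exact (RingQuot.liftAlgHom_mkAlgHom_apply ..).trans (FreeAlgebra.lift_ι_apply ..)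

end

/-- The generators `x^±` are odd and `L` is even. -/
instance : SuperAlgebra SAlg where
  par := lift (-xp) (-xm) L (by simp [xp_L]) (by simp [xm_L]) (by simp [anti]) (by simp [xp_xp])
    (by simp [xm_xm]) L_L
  par_par a := by
    have h : (lift (-xp) (-xm) L (by simp [xp_L]) (by simp [xm_L]) (by simp [anti])
        (by simp [xp_xp]) (by simp [xm_xm]) L_L).comp (lift (-xp) (-xm) L (by simp [xp_L])
        (by simp [xm_L]) (by simp [anti]) (by simp [xp_xp]) (by simp [xm_xm]) L_L)
        = AlgHom.id ℂ SAlg := by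
      apply algHom_ext <;> simp [lift_xp, lift_xm, lift_L]
    exact AlgHom.congr_fun h a

theorem par_xp : par xp = -xp := lift_xp ..
theorem par_xm : par xm = -xm := lift_xm ..
theorem par_L : par L = L := lift_L ..

/-- The central idempotents `e₀ = (1 + L) / 2` and `e₁ = (1 - L) / 2`. -/
def e0 : SAlg := (1 / 2 : ℂ) • (1 + L)
def e1 : SAlg := (1 / 2 : ℂ) • (1 - L)

theorem par_e0 : par e0 = e0 := by simp [e0, par_L]
theorem par_e1 : par e1 = e1 := by simp [e1, par_L]
theorem xp_e1 : xp * e1 = e1 * xp := by simp [e1, mul_sub, sub_mul, xp_L]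
theorem xm_e1 : xm * e1 = e1 * xm := by simp [e1, mul_sub, sub_mul, xm_L]
theorem xp_e0 : xp * e0 = e0 * xp := by simp [e0, mul_add, add_mul, xp_L]
theorem xm_e0 : xm * e0 = e0 * xm := by simp [e0, mul_add, add_mul, xm_L]
theorem L_e1 : L * e1 = -e1 := by simp [e1, mul_sub, L_L, ← smul_neg]
theorem e1_e1 : e1 * e1 = e1 := by
  nth_rw 1 [e1]
  rw [smul_mul_assoc, sub_mul, L_e1, one_mul]
  module
theorem e0_add_e1 : e0 + e1 = 1 := by rw [e0, e1]; module
theorem e0_eq : e0 = 1 - e1 := by rw [← e0_add_e1]; simp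
theorem e1_e0 : e1 * e0 = 0 := by rw [e0_eq, mul_sub, e1_e1, mul_one, sub_self]
theorem e0_e1 : e0 * e1 = 0 := by rw [e0_eq, sub_mul, e1_e1, one_mul, sub_self]
theorem e0_e0 : e0 * e0 = e0 := by
  nth_rw 1 [e0_eq]
  rw [sub_mul, one_mul, e1_e0, sub_zero]
theorem L_eq : L = e0 - e1 := by rw [e0, e1]; module
theorem anti' : xp * xm + xm * xp = e1 := anti

/-- The images of `x^±` under the coproduct of `S`, with `c = i` for `x⁺` and `c = - i` for `x⁻`:
`x ⊗ 1 + (e₀ - i e₁) ⊗ x + c e₁ ⊗ e₁ (x⁺ - x⁻)`. -/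
def copX (x : SAlg) (c : ℂ) : STensor SAlg SAlg :=
  pt x 1 + pt (e0 - Complex.I • e1) x + c • pt e1 (e1 * (xp - xm))

theorem pt_smul (c : ℂ) (a b : SAlg) : pt a (c • b) = c • pt a b := by
  simp [pt]
theorem smul_pt (c : ℂ) (a b : SAlg) : pt (c • a) b = c • pt a b := by
  rw [pt, pt, ← TensorProduct.smul_tmul', map_smul]
theorem add_pt (a a' b : SAlg) : pt (a + a') b = pt a b + pt a' b := by
  simp [pt, TensorProduct.add_tmul]
theorem neg_pt (a b : SAlg) : pt (-a) b = -pt a b := by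
  simp [pt, TensorProduct.neg_tmul]
theorem pt_neg (a b : SAlg) : pt a (-b) = -pt a b := by
  simp [pt, TensorProduct.tmul_neg]

theorem zero_pt (b : SAlg) : pt (0 : SAlg) b = 0 := by
  simp [pt]
theorem pt_zero (a : SAlg) : pt a (0 : SAlg) = 0 := by
  simp [pt]

theorem copX_aux (x y : SAlg) (hx : par x = -x) (hy : par y = -y) (hxe : x * e1 = e1 * x)
    (hye : y * e1 = e1 * y) (c d : ℂ) :
    copX x c * copX y d + copX y d * copX x c
      = pt (x * y + y * x) 1 + pt L (x * y + y * x)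
        + (-Complex.I * d) • pt e1 (e1 * (x * (xp - xm) + (xp - xm) * x))
        + (-Complex.I * c) • pt e1 (e1 * (y * (xp - xm) + (xp - xm) * y))
        + (c * d) • pt e1 (-2 • e1) := by
  have h1 : par (1 : SAlg) = 1 := map_one _
  set z : SAlg := e0 - Complex.I • e1 with hz
  set w : SAlg := e1 * (xp - xm) with hw
  have hpz : par z = z := by simp [hz, par_e0, par_e1]
  have hpw : par w = -w := by
    rw [hw]; simp only [map_mul, map_sub, par_e1, par_xp, par_xm]; noncomm_ring
  have hxz : x * z = z * x := by
    rw [hz, e0_eq]; simp only [mul_sub, sub_mul, mul_smul_comm, smul_mul_assoc, hxe, mul_one, one_mul]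
  have hyz : y * z = z * y := by
    rw [hz, e0_eq]; simp only [mul_sub, sub_mul, mul_smul_comm, smul_mul_assoc, hye, mul_one, one_mul]
  have hzz : z * z = L := by
    rw [hz, L_eq]
    simp only [mul_sub, sub_mul, mul_smul_comm, smul_mul_assoc, e0_e0, e1_e0, e0_e1, e1_e1,
      smul_smul, smul_sub, Complex.I_mul_I]
    module
  have hze : z * e1 = (-Complex.I) • e1 := by
    rw [hz, sub_mul, smul_mul_assoc, e0_e1, e1_e1]; module
  have hez : e1 * z = (-Complex.I) • e1 := by
    rw [hz, mul_sub, mul_smul_comm, e1_e0, e1_e1]; module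
  have hww : w * w = -e1 := by
    have hc : (xp - xm) * e1 = e1 * (xp - xm) := by rw [sub_mul, mul_sub, xp_e1, xm_e1]
    have h2 : (xp - xm) * (xp - xm) = -e1 := by
      rw [← anti', sub_mul, mul_sub, mul_sub, xp_xp, xm_xm]; abel
    rw [hw, mul_assoc, ← mul_assoc (xp - xm), hc, mul_assoc e1, h2, ← mul_assoc, e1_e1, mul_neg,
      e1_e1]
  have hxw : e1 * (x * (xp - xm) + (xp - xm) * x) = x * w + w * x := by
    rw [hw, mul_add, ← mul_assoc, ← mul_assoc, ← mul_assoc, hxe]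
  have hyw : e1 * (y * (xp - xm) + (xp - xm) * y) = y * w + w * y := by
    rw [hw, mul_add, ← mul_assoc, ← mul_assoc, ← mul_assoc, hye]
  rw [hxw, hyw]
  simp only [copX, ← hz, ← hw, mul_add, add_mul, mul_smul_comm, smul_mul_assoc,
    pt_mul_even _ h1, pt_mul_odd _ hx, pt_mul_odd _ hy, pt_mul_odd _ hpw, hpz, par_e1,
    h1, hx, hy, one_mul, mul_one, mul_neg, neg_mul, hxz, hyz, hxe, hye, hzz, hze, hez, e1_e1, hww,
    add_pt, STensor.pt_add, neg_pt, pt_neg, smul_pt, pt_smul]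
  simp only [show (-2 • e1 : SAlg) = (-2 : ℂ) • e1 by module, pt_smul]
  module

theorem mul_self_eq_zero_of {C : Type} [Ring C] [Algebra ℂ C] {a : C} (h : a * a + a * a = 0) :
    a * a = 0 := by
  rw [← two_smul ℂ (a * a)] at h
  exact (smul_eq_zero.mp h).resolve_left two_ne_zero

theorem copX_L (x : SAlg) (hx : par x = -x) (hxL : x * L = L * x) (c : ℂ) :
    copX x c * pt L L = pt L L * copX x c := by
  have h1 : par (1 : SAlg) = 1 := map_one _
  have hLe : e1 * L = L * e1 := by rw [L_eq, mul_sub, sub_mul, e1_e0, e0_e1]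
  have hpw : par (e1 * (xp - xm)) = -(e1 * (xp - xm)) := by
    simp only [map_mul, map_sub, par_e1, par_xp, par_xm]; noncomm_ring
  have hwL : e1 * (xp - xm) * L = L * (e1 * (xp - xm)) := by
    rw [mul_assoc, sub_mul, xp_L, xm_L, ← mul_sub, ← mul_assoc, ← mul_assoc, hLe]
  have hzL : (e0 - Complex.I • e1) * L = L * (e0 - Complex.I • e1) := by
    rw [e0_eq]; simp only [mul_sub, sub_mul, mul_smul_comm, smul_mul_assoc, hLe, mul_one, one_mul]
  simp only [copX, mul_add, add_mul, mul_smul_comm, smul_mul_assoc, pt_mul_even _ h1,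
    pt_mul_odd _ hx, pt_mul_odd _ hpw, pt_mul_even _ par_L, par_L, one_mul, mul_one, hxL,
    hwL, hzL, hLe]

/-- The coproduct of `S`: `L ↦ L ⊗ L` and
`x^± ↦ x^± ⊗ 1 + (e₀ - i e₁) ⊗ x^± ± i e₁ ⊗ e₁ (x⁺ - x⁻)`. -/
def cop : SAlg →ₐ[ℂ] STensor SAlg SAlg :=
  lift (copX xp Complex.I) (copX xm (-Complex.I)) (pt L L)
    (copX_L xp par_xp xp_L _) (copX_L xm par_xm xm_L _)
    (by
      rw [copX_aux _ _ par_xp par_xm xp_e1 xm_e1, anti', mul_sub, sub_mul, mul_sub, sub_mul,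
        xp_xp, xm_xm]
      have h1 : (0 - xp * xm + (0 - xm * xp) : SAlg) = -e1 := by rw [← anti']; abel
      have h2 : (xm * xp - 0 + (xp * xm - 0) : SAlg) = e1 := by rw [← anti']; abel
      rw [h1, h2, mul_neg, e1_e1, show (-2 • e1 : SAlg) = (-2 : ℂ) • e1 by module, one_def]
      have hone : (1 : SAlg) = L + (2 : ℂ) • e1 := by rw [e1]; module
      simp only [mul_neg, e1_e1]
      simp only [hone, add_pt, STensor.pt_add, pt_neg, smul_pt, pt_smul, smul_smul]
      have hI : Complex.I * Complex.I = -1 := Complex.I_mul_I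
      match_scalars <;> simp [hI]
      norm_num)
    (by
      apply mul_self_eq_zero_of
      rw [copX_aux _ _ par_xp par_xp xp_e1 xp_e1, mul_sub, sub_mul, xp_xp]
      have h1 : (0 - xp * xm + (0 - xm * xp) : SAlg) = -e1 := by rw [← anti']; abel
      rw [h1, mul_neg, e1_e1, show (-2 • e1 : SAlg) = (-2 : ℂ) • e1 by module]
      rw [add_zero, zero_pt, pt_zero]
      simp only [pt_neg, pt_smul, smul_smul]
      have hI : Complex.I * Complex.I = -1 := Complex.I_mul_I
      match_scalars
      simp [hI]
      norm_num)
    (by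
      apply mul_self_eq_zero_of
      rw [copX_aux _ _ par_xm par_xm xm_e1 xm_e1, mul_sub, sub_mul, xm_xm]
      have h1 : (xm * xp - 0 + (xp * xm - 0) : SAlg) = e1 := by rw [← anti']; abel
      rw [h1, e1_e1, show (-2 • e1 : SAlg) = (-2 : ℂ) • e1 by module]
      rw [add_zero, zero_pt, pt_zero]
      simp only [pt_neg, pt_smul, smul_smul]
      have hI : Complex.I * Complex.I = -1 := Complex.I_mul_I
      match_scalars
      simp [hI]
      norm_num)
    (by rw [pt_mul_even _ par_L, L_L]; rfl)

theorem cop_par (a : SAlg) : cop (par a) = par (cop a) := by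
  have h : cop.comp (par (A := SAlg)) = (par (A := STensor SAlg SAlg)).comp cop := by
    apply algHom_ext
    · simp only [AlgHom.comp_apply, par_xp, cop, lift_xp, map_neg, copX, map_add, map_smul,
        par_pt, map_one, map_sub, map_mul, par_e0, par_e1, par_xm]
      simp only [neg_pt, pt_neg, show e1 * (-xp - -xm) = -(e1 * (xp - xm)) by noncomm_ring]
      module
    · simp only [AlgHom.comp_apply, par_xm, cop, lift_xm, map_neg, copX, map_add, map_smul,
        par_pt, map_one, map_sub, map_mul, par_e0, par_e1, par_xp]
      simp only [neg_pt, pt_neg, show e1 * (-xp - -xm) = -(e1 * (xp - xm)) by noncomm_ring]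
      module
    · simp [par_L, cop, lift_L, par_pt]
  exact AlgHom.congr_fun h a

/-- The coproduct as a linear map. -/
def copLin : SAlg →ₗ[ℂ] SAlg ⊗[ℂ] SAlg := (equiv SAlg SAlg).toLinearMap ∘ₗ cop.toLinearMap

/-- The counit. -/
def counit : SAlg →ₐ[ℂ] ℂ := lift 0 0 1 (by simp) (by simp) (by simp) (by simp) (by simp) (by simp)

theorem counit_par (a : SAlg) : counit (par a) = counit a := by
  have h : counit.comp (par (A := SAlg)) = counit := by
    apply algHom_ext <;> simp [par_xp, par_xm, par_L, counit, lift_xp, lift_xm, lift_L]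
  exact AlgHom.congr_fun h a

/-- Right multiplication by `a`. -/
def R (a : SAlg) : SAlg →ₗ[ℂ] SAlg := LinearMap.mulRight ℂ a

/-! ### The module `B` -/

/-- The idempotent `b = x⁻ x⁺ e₁`. -/
def b : SAlg := xm * xp * e1

/-- The left ideal `B = S b`. -/
def B : Submodule ℂ SAlg := LinearMap.range (R b)

/-- Right multiplication by `b`, as a map from `S` to `B`. -/
def Rb : SAlg →ₗ[ℂ] B := (R b).rangeRestrict

theorem par_b : par b = b := by simp [b, par_xp, par_xm, par_e1]

theorem mul_mem_B (s : SAlg) {x : SAlg} (hx : x ∈ B) : s * x ∈ B := by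
  obtain ⟨y, rfl⟩ := hx
  exact ⟨s * y, by simp [R, mul_assoc]⟩

theorem par_mem_B {x : SAlg} (hx : x ∈ B) : par x ∈ B := by
  obtain ⟨y, rfl⟩ := hx
  exact ⟨par y, by simp [R, par_b]⟩

theorem B_le : B ≤ Submodule.span ℂ {b, xp * b} := by
  have key : ∀ f : FreeAlgebra ℂ SGen, ∀ v ∈ Submodule.span ℂ {b, xp * b},
      mk f * v ∈ Submodule.span ℂ {b, xp * b} := by
    intro f
    have hb : b ∈ Submodule.span ℂ {b, xp * b} := Submodule.subset_span (by simp)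
    have hc : xp * b ∈ Submodule.span ℂ {b, xp * b} := Submodule.subset_span (by simp)
    have aux : ∀ s : SAlg, s * b ∈ Submodule.span ℂ {b, xp * b} →
        s * (xp * b) ∈ Submodule.span ℂ {b, xp * b} →
        ∀ v ∈ Submodule.span ℂ {b, xp * b}, s * v ∈ Submodule.span ℂ {b, xp * b} := by
      intro s h1 h2 v hv
      obtain ⟨c, d, rfl⟩ := Submodule.mem_span_pair.mp hv
      rw [mul_add, mul_smul_comm, mul_smul_comm]
      exact Submodule.add_mem _ (Submodule.smul_mem _ _ h1) (Submodule.smul_mem _ _ h2)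
    have hmb : xm * b = 0 := by rw [b, ← mul_assoc, ← mul_assoc, xm_xm, zero_mul, zero_mul]
    have heb : e1 * b = b := by
      rw [b, ← mul_assoc, ← mul_assoc, ← xm_e1, mul_assoc xm, ← xp_e1, mul_assoc, mul_assoc, e1_e1,
        ← mul_assoc]
    have hLb : L * b = -b := by
      have : L = 1 - (2 : ℂ) • e1 := by rw [e1]; module
      rw [this, sub_mul, smul_mul_assoc, heb]; rw [one_mul]; module
    induction f using FreeAlgebra.induction with
    | grade0 r =>
      intro v hv
      rw [AlgHom.commutes, Algebra.algebraMap_eq_smul_one, smul_mul_assoc, one_mul]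
      exact Submodule.smul_mem _ _ hv
    | grade1 g =>
      cases g with
      | xp =>
        refine aux xp hc ?_
        rw [← mul_assoc, xp_xp, zero_mul]; exact Submodule.zero_mem _
      | xm =>
        refine aux xm (by rw [hmb]; exact Submodule.zero_mem _) ?_
        have : xm * (xp * b) = b := by
          rw [← mul_assoc, show xm * xp = e1 - xp * xm by rw [← anti']; abel, sub_mul, mul_assoc,
            hmb, mul_zero, sub_zero, heb]
        rw [this]; exact hb
      | L =>
        refine aux L (by rw [hLb]; exact Submodule.neg_mem _ hb) ?_
        rw [← mul_assoc, ← xp_L, mul_assoc, hLb, mul_neg]; exact Submodule.neg_mem _ hc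
    | mul f g hf hg =>
      intro v hv
      rw [map_mul, mul_assoc]
      exact hf _ (hg _ hv)
    | add f g hf hg =>
      intro v hv
      rw [map_add, add_mul]
      exact Submodule.add_mem _ (hf _ hv) (hg _ hv)
  rintro _ ⟨y, rfl⟩
  obtain ⟨f, rfl⟩ := mk_surjective y
  exact key f b (Submodule.subset_span (by simp))

instance : FiniteDimensional ℂ B := by
  have : FiniteDimensional ℂ (Submodule.span ℂ {b, xp * b}) :=
    FiniteDimensional.span_of_finite ℂ (by simp)
  exact Submodule.finiteDimensional_of_le B_le

/-- `B` as a representation of `S`, by left multiplication. -/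
abbrev BRep : SRep SAlg where
  carrier := B
  ω := (par (A := SAlg)).toLinearMap.restrict fun _ hx => par_mem_B hx
  ω_ω x := Subtype.ext (par_par x.1)
  ρ := AlgHom.ofLinearMap
    { toFun := fun s => (LinearMap.mulLeft ℂ s).restrict fun _ hx => mul_mem_B s hx
      map_add' := fun s t => by ext x; exact add_mul s t x.1
      map_smul' := fun c s => by ext x; exact smul_mul_assoc c s x.1 }
    (by ext x; exact one_mul x.1) (fun s t => by ext x; exact mul_assoc s t x.1)
  ω_ρ s x := Subtype.ext (map_mul par s x.1)

end SAlg

/-! ### Isomorphisms and trivial representations -/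

/-- An isomorphism of super vector spaces from a parity preserving linear equivalence. -/
def SVect.isoOfLin {X Y : SVect} (e : X.carrier ≃ₗ[ℂ] Y.carrier)
    (hω : ∀ x, e (X.ω x) = Y.ω (e x)) : X ≅ Y where
  hom := ⟨e.toLinearMap, hω⟩
  inv := ⟨e.symm.toLinearMap, fun y => by
    change e.symm (Y.ω y) = X.ω (e.symm y)
    rw [LinearEquiv.symm_apply_eq, hω, LinearEquiv.apply_symm_apply]⟩
  hom_inv_id := SVect.Hom.ext (LinearMap.ext fun x => e.symm_apply_apply x)
  inv_hom_id := SVect.Hom.ext (LinearMap.ext fun x => e.apply_symm_apply x)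

section

variable {A : Type} [Ring A] [Algebra ℂ A] [SuperAlgebra A]

/-- An isomorphism of representations from a linear equivalence. -/
def SRep.isoOfLin {U V : SRep A} (e : U.carrier ≃ₗ[ℂ] V.carrier)
    (hω : ∀ x, e (U.ω x) = V.ω (e x)) (hρ : ∀ a x, e (U.ρ a x) = V.ρ a (e x)) : U ≅ V where
  hom := ⟨e.toLinearMap, hω, hρ⟩
  inv := ⟨e.symm.toLinearMap, fun y => by
    change e.symm (V.ω y) = U.ω (e.symm y)
    rw [LinearEquiv.symm_apply_eq, hω, LinearEquiv.apply_symm_apply], fun a y => by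
    change e.symm (V.ρ a y) = U.ρ a (e.symm y)
    rw [LinearEquiv.symm_apply_eq, hρ, LinearEquiv.apply_symm_apply]⟩
  hom_inv_id := SRep.Hom.ext (LinearMap.ext fun x => e.symm_apply_apply x)
  inv_hom_id := SRep.Hom.ext (LinearMap.ext fun x => e.apply_symm_apply x)

/-- The representation on `ℂ` given by a counit. -/
abbrev SRep.triv (ε : A →ₐ[ℂ] ℂ) (hε : ∀ a, ε (par a) = ε a) : SRep A where
  carrier := ℂ
  ω := LinearMap.id
  ω_ω _ := rfl
  ρ := (Algebra.lmul ℂ ℂ).comp ε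
  ω_ρ a x := by simp [hε]

theorem SRep.lin_ρ_of_algHom {U V : SRep A} (e : U.carrier ≃ₗ[ℂ] V.carrier)
    (h : (e.conjAlgEquiv ℂ).toAlgHom.comp U.ρ = V.ρ) (a : A) (x : U.carrier) :
    e (U.ρ a x) = V.ρ a (e x) := by
  rw [← h]
  simp [LinearEquiv.conjAlgEquiv_apply]

end

theorem Grass.lid_ρ (U : SRep Grass) (a : Grass)
    (x : (SRep.tensor Grass.cop Grass.cop_par (SRep.triv Grass.counit Grass.counit_par) U).carrier) :
    TensorProduct.lid ℂ U.carrier ((SRep.tensor Grass.cop Grass.cop_par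
      (SRep.triv Grass.counit Grass.counit_par) U).ρ a x) = U.ρ a (TensorProduct.lid ℂ U.carrier x) := by
  refine SRep.lin_ρ_of_algHom (U := SRep.tensor Grass.cop Grass.cop_par
      (SRep.triv Grass.counit Grass.counit_par) U) (V := U) (TensorProduct.lid ℂ U.carrier) ?_ a x
  apply Grass.algHom_ext
  · refine LinearMap.ext fun u => ?_
    simp [LinearEquiv.conjAlgEquiv_apply, Grass.cop, Grass.lift_a1, sact_even, sact_odd,
      Grass.par_a1, Grass.counit]
  · refine LinearMap.ext fun u => ?_
    simp [LinearEquiv.conjAlgEquiv_apply, Grass.cop, Grass.lift_a2, sact_even, sact_odd,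
      Grass.par_a2, Grass.counit]

theorem Grass.rid_ρ (U : SRep Grass) (a : Grass)
    (x : (SRep.tensor Grass.cop Grass.cop_par U (SRep.triv Grass.counit Grass.counit_par)).carrier) :
    TensorProduct.rid ℂ U.carrier ((SRep.tensor Grass.cop Grass.cop_par U
      (SRep.triv Grass.counit Grass.counit_par)).ρ a x) = U.ρ a (TensorProduct.rid ℂ U.carrier x) := by
  refine SRep.lin_ρ_of_algHom (U := SRep.tensor Grass.cop Grass.cop_par
      U (SRep.triv Grass.counit Grass.counit_par)) (V := U) (TensorProduct.rid ℂ U.carrier) ?_ a x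
  apply Grass.algHom_ext
  · refine LinearMap.ext fun u => ?_
    simp [LinearEquiv.conjAlgEquiv_apply, Grass.cop, Grass.lift_a1, sact_even, sact_odd,
      Grass.par_a1, Grass.counit]
  · refine LinearMap.ext fun u => ?_
    simp [LinearEquiv.conjAlgEquiv_apply, Grass.cop, Grass.lift_a2, sact_even, sact_odd,
      Grass.par_a2, Grass.counit]

theorem SAlg.par_w : par (SAlg.e1 * (SAlg.xp - SAlg.xm)) = -(SAlg.e1 * (SAlg.xp - SAlg.xm)) := by
  simp only [map_mul, map_sub, SAlg.par_e1, SAlg.par_xp, SAlg.par_xm]; noncomm_ring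

theorem SAlg.counit_e1 : SAlg.counit SAlg.e1 = 0 := by
  simp [SAlg.e1, SAlg.counit, SAlg.lift_L]

theorem SAlg.counit_e0 : SAlg.counit SAlg.e0 = 1 := by
  rw [SAlg.e0_eq, map_sub, map_one, SAlg.counit_e1, sub_zero]

theorem SAlg.lid_ρ (U : SRep SAlg) (a : SAlg)
    (x : (SRep.tensor SAlg.cop SAlg.cop_par (SRep.triv SAlg.counit SAlg.counit_par) U).carrier) :
    TensorProduct.lid ℂ U.carrier ((SRep.tensor SAlg.cop SAlg.cop_par
      (SRep.triv SAlg.counit SAlg.counit_par) U).ρ a x) = U.ρ a (TensorProduct.lid ℂ U.carrier x) := by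
  refine SRep.lin_ρ_of_algHom (U := SRep.tensor SAlg.cop SAlg.cop_par
      (SRep.triv SAlg.counit SAlg.counit_par) U) (V := U) (TensorProduct.lid ℂ U.carrier) ?_ a x
  have hp : SAlg.counit SAlg.xp = 0 := SAlg.lift_xp ..
  have hm : SAlg.counit SAlg.xm = 0 := SAlg.lift_xm ..
  have hL : SAlg.counit SAlg.L = 1 := SAlg.lift_L ..
  apply SAlg.algHom_ext
  · refine LinearMap.ext fun u => ?_
    simp [LinearEquiv.conjAlgEquiv_apply, SAlg.cop, SAlg.lift_xp, SAlg.copX, sact_even, sact_odd,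
      SAlg.par_xp, SAlg.par_w, SAlg.counit_e0, SAlg.counit_e1, hp, -map_mul]
  · refine LinearMap.ext fun u => ?_
    simp [LinearEquiv.conjAlgEquiv_apply, SAlg.cop, SAlg.lift_xm, SAlg.copX, sact_even, sact_odd,
      SAlg.par_xm, SAlg.par_w, SAlg.counit_e0, SAlg.counit_e1, hm, -map_mul]
  · refine LinearMap.ext fun u => ?_
    simp [LinearEquiv.conjAlgEquiv_apply, SAlg.cop, SAlg.lift_L, sact_even,
      SAlg.par_L, hL]

theorem SAlg.rid_ρ (U : SRep SAlg) (a : SAlg)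
    (x : (SRep.tensor SAlg.cop SAlg.cop_par U (SRep.triv SAlg.counit SAlg.counit_par)).carrier) :
    TensorProduct.rid ℂ U.carrier ((SRep.tensor SAlg.cop SAlg.cop_par U
      (SRep.triv SAlg.counit SAlg.counit_par)).ρ a x) = U.ρ a (TensorProduct.rid ℂ U.carrier x) := by
  refine SRep.lin_ρ_of_algHom (U := SRep.tensor SAlg.cop SAlg.cop_par U
      (SRep.triv SAlg.counit SAlg.counit_par)) (V := U) (TensorProduct.rid ℂ U.carrier) ?_ a x
  have hp : SAlg.counit SAlg.xp = 0 := SAlg.lift_xp ..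
  have hm : SAlg.counit SAlg.xm = 0 := SAlg.lift_xm ..
  have hL : SAlg.counit SAlg.L = 1 := SAlg.lift_L ..
  apply SAlg.algHom_ext
  · refine LinearMap.ext fun u => ?_
    simp [LinearEquiv.conjAlgEquiv_apply, SAlg.cop, SAlg.lift_xp, SAlg.copX, sact_even, sact_odd,
      SAlg.par_xp, SAlg.par_w, SAlg.counit_e1, hp]
  · refine LinearMap.ext fun u => ?_
    simp [LinearEquiv.conjAlgEquiv_apply, SAlg.cop, SAlg.lift_xm, SAlg.copX, sact_even, sact_odd,
      SAlg.par_xm, SAlg.par_w, SAlg.counit_e1, hm]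
  · refine LinearMap.ext fun u => ?_
    simp [LinearEquiv.conjAlgEquiv_apply, SAlg.cop, SAlg.lift_L, sact_even,
      SAlg.par_L, hL]

/-! ### The category `Rep S` -/

/-- The category of finite-dimensional representations of `S` in super vector spaces. -/
abbrev RepS : Type 1 := SRep SAlg

namespace RepS

/-- The tensor product of representations of `S`, via the coproduct. -/
abbrev tensor (U V : RepS) : RepS := SRep.tensor SAlg.cop SAlg.cop_par U V

/-- The tensor unit: `ℂ` with the action given by the counit. -/
abbrev unit : RepS := SRep.triv SAlg.counit SAlg.counit_par

/-- The left unit isomorphism `z ⊗ u ↦ z u`. -/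
def leftUnitor (U : RepS) : tensor unit U ≅ U :=
  SRep.isoOfLin (U := tensor unit U) (V := U) (TensorProduct.lid ℂ U.carrier)
    (fun x => by
      induction x using TensorProduct.induction_on with
      | zero => simp
      | add x y hx hy => simp only [map_add, hx, hy]
      | tmul z u => simp)
    (SAlg.lid_ρ U)

/-- The right unit isomorphism `u ⊗ z ↦ z u`. -/
def rightUnitor (U : RepS) : tensor U unit ≅ U :=
  SRep.isoOfLin (U := tensor U unit) (V := U) (TensorProduct.rid ℂ U.carrier)
    (fun x => by
      induction x using TensorProduct.induction_on with
      | zero => simp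
      | add x y hx hy => simp only [map_add, hx, hy]
      | tmul u z => simp)
    (SAlg.rid_ρ U)

/-- The tensor product functor, unit and unit isomorphisms of `Rep S`, together with a family of
isomorphisms as candidate for the associator. -/
abbrev monStruct (α : ∀ U V W : RepS, tensor (tensor U V) W ≅ tensor U (tensor V W)) :
    MonoidalCategoryStruct RepS where
  tensorObj := tensor
  tensorHom f g := SRep.tensorMap SAlg.cop SAlg.cop_par f g
  whiskerLeft U _ _ g := SRep.tensorMap SAlg.cop SAlg.cop_par (𝟙 U) g
  whiskerRight f V := SRep.tensorMap SAlg.cop SAlg.cop_par f (𝟙 V)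
  tensorUnit := unit
  associator := α
  leftUnitor := leftUnitor
  rightUnitor := rightUnitor

end RepS

/-! ### The category `SF` -/

/-- The category `SF = SF₀ ⊕ SF₁`, with `SF₀` the finite-dimensional representations of the
Grassmann algebra `G` in super vector spaces and `SF₁` the finite-dimensional super vector spaces.
An object is a pair of a component `X.1` in `SF₀` and a component `X.2` in `SF₁`, a morphism is a
pair of morphisms. -/
abbrev SF : Type 1 := SRep Grass × SVect

namespace SF

/-- The tensor product `X * Y`:
`X ⊗ Y` with `G` acting via the coproduct if `X, Y ∈ SF₀`,
`G ⊗ X ⊗ Y ∈ SF₀` with `G` acting on the first factor if `X, Y ∈ SF₁`,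
and `X ⊗ Y ∈ SF₁` if one of them is in `SF₀` and the other one in `SF₁`. -/
abbrev tensor (X Y : SF) : SF :=
  ((SRep.tensor Grass.cop Grass.cop_par X.1 Y.1).dsum (Grass.reg.tensorSVect (X.2.tensor Y.2)),
    (X.1.toSVect.tensor Y.2).dsum (X.2.tensor Y.1.toSVect))

/-- The tensor product of morphisms. -/
def tensorHom {X X' Y Y' : SF} (f : X ⟶ X') (g : Y ⟶ Y') : tensor X Y ⟶ tensor X' Y' :=
  Prod.mkHom
    (SRep.dsumMap (SRep.tensorMap Grass.cop Grass.cop_par f.1 g.1)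
      (SRep.tensorSVectMap Grass.reg (SVect.tensorMap f.2 g.2)))
    (SVect.dsumMap (SVect.tensorMap f.1.toSVect g.2) (SVect.tensorMap f.2 g.1.toSVect))

/-- The tensor unit: `ℂ ∈ SF₀` with the trivial action of `G`. -/
abbrev unit : SF := (SRep.triv Grass.counit Grass.counit_par, SVect.zero)

/-- The left unit isomorphism `z ⊗ x ↦ z x`. -/
def leftUnitor (X : SF) : tensor unit X ≅ X :=
  Iso.prod
    (SRep.isoOfLin (U := (tensor unit X).1) (V := X.1)
      (LinearEquiv.prodUnique.trans (TensorProduct.lid ℂ X.1.carrier))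
      (fun x => by
        obtain ⟨x, y⟩ := x
        induction x using TensorProduct.induction_on with
        | zero => simp
        | add x y hx hy => simp_all
        | tmul z u => simp)
      (fun a x => Grass.lid_ρ X.1 a x.1))
    (SVect.isoOfLin (X := (tensor unit X).2) (Y := X.2)
      (LinearEquiv.prodUnique.trans (TensorProduct.lid ℂ X.2.carrier))
      (fun x => by
        obtain ⟨x, y⟩ := x
        induction x using TensorProduct.induction_on with
        | zero => simp
        | add x y hx hy => simp_all
        | tmul z u => simp))

/-- The right unit isomorphism `x ⊗ z ↦ z x`. -/
def rightUnitor (X : SF) : tensor X unit ≅ X :=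
  Iso.prod
    (SRep.isoOfLin (U := (tensor X unit).1) (V := X.1)
      (LinearEquiv.prodUnique.trans (TensorProduct.rid ℂ X.1.carrier))
      (fun x => by
        obtain ⟨x, y⟩ := x
        induction x using TensorProduct.induction_on with
        | zero => simp
        | add x y hx hy => simp_all
        | tmul z u => simp)
      (fun a x => Grass.rid_ρ X.1 a x.1))
    (SVect.isoOfLin (X := (tensor X unit).2) (Y := X.2)
      (LinearEquiv.uniqueProd.trans (TensorProduct.rid ℂ X.2.carrier))
      (fun x => by
        obtain ⟨y, x⟩ := x
        induction x using TensorProduct.induction_on with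
        | zero => simp
        | add x y hx hy => simp_all
        | tmul z u => simp))

/-- The tensor product functor, unit and unit isomorphisms of `SF`, together with a family of
isomorphisms as candidate for the associator. -/
abbrev monStruct (α : ∀ X Y Z : SF, tensor (tensor X Y) Z ≅ tensor X (tensor Y Z)) :
    MonoidalCategoryStruct SF where
  tensorObj := tensor
  tensorHom := tensorHom
  whiskerLeft X _ _ g := tensorHom (𝟙 X) g
  whiskerRight f Y := tensorHom f (𝟙 Y)
  tensorUnit := unit
  associator := α
  leftUnitor := leftUnitor
  rightUnitor := rightUnitor

/-! The associator of `SF` -/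

/-- The action `C⁽¹³⁾` of the copairing `C = a₂ ⊗ a₁ - a₁ ⊗ a₂` on the first and third factor of
`X ⊗ Y ⊗ Z`. -/
def C13 (X : SRep Grass) (Y : SVect) (Z : SRep Grass) :
    Module.End ℂ (X.carrier ⊗[ℂ] (Y.carrier ⊗[ℂ] Z.carrier)) :=
  map (X.ρ Grass.a2 ∘ₗ X.ω) (map Y.ω (Z.ρ Grass.a1))
    - map (X.ρ Grass.a1 ∘ₗ X.ω) (map Y.ω (Z.ρ Grass.a2))

/-- The third power of `C⁽¹³⁾` vanishes, so that its exponential series ends with the quadratic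
term. -/
theorem C13_pow_three (X : SRep Grass) (Y : SVect) (Z : SRep Grass) : C13 X Y Z ^ 3 = 0 := by
  have h11 : ∀ (U : SRep Grass) u, U.ρ Grass.a1 (U.ρ Grass.a1 u) = 0 := fun U u => by
    rw [← Module.End.mul_apply, ← map_mul, Grass.a1_mul_a1]; simp
  have h22 : ∀ (U : SRep Grass) u, U.ρ Grass.a2 (U.ρ Grass.a2 u) = 0 := fun U u => by
    rw [← Module.End.mul_apply, ← map_mul, Grass.a2_mul_a2]; simp
  have h21 : ∀ (U : SRep Grass) u, U.ρ Grass.a2 (U.ρ Grass.a1 u)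
      = -U.ρ Grass.a1 (U.ρ Grass.a2 u) := fun U u => by
    rw [← Module.End.mul_apply, ← map_mul, Grass.a2_mul_a1]; simp
  refine TensorProduct.ext' fun x yz => ?_
  induction yz using TensorProduct.induction_on with
  | zero => simp
  | add a b ha hb => rw [TensorProduct.tmul_add, map_add, ha, hb]; simp
  | tmul y z =>
    simp [C13, pow_succ, X.ω_ρ, Y.ω_ω, X.ω_ω, Grass.par_a1, Grass.par_a2, h11, h22, h21,
      TensorProduct.neg_tmul, TensorProduct.tmul_neg]

/-- `exp(C⁽¹³⁾)`. -/
def expC13 (X : SRep Grass) (Y : SVect) (Z : SRep Grass) :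
    Module.End ℂ (X.carrier ⊗[ℂ] (Y.carrier ⊗[ℂ] Z.carrier)) :=
  1 + C13 X Y Z + (1 / 2 : ℂ) • C13 X Y Z ^ 2

section Sectors

variable (β : ℂ) (X Y Z : SF)

/-- Rebracketing `x ⊗ (y ⊗ z) ↦ (x ⊗ y) ⊗ z`. -/
abbrev bra (A B C : Type) [AddCommGroup A] [AddCommGroup B] [AddCommGroup C] [Module ℂ A]
    [Module ℂ B] [Module ℂ C] : A ⊗[ℂ] (B ⊗[ℂ] C) →ₗ[ℂ] (A ⊗[ℂ] B) ⊗[ℂ] C :=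
  (TensorProduct.assoc ℂ A B C).symm.toLinearMap

/-- Rebracketing `(x ⊗ y) ⊗ z ↦ x ⊗ (y ⊗ z)`. -/
abbrev ket (A B C : Type) [AddCommGroup A] [AddCommGroup B] [AddCommGroup C] [Module ℂ A]
    [Module ℂ B] [Module ℂ C] : (A ⊗[ℂ] B) ⊗[ℂ] C →ₗ[ℂ] A ⊗[ℂ] (B ⊗[ℂ] C) :=
  (TensorProduct.assoc ℂ A B C).toLinearMap

/-- Sector 000: the identity. -/
def assoc000 : X.1.carrier ⊗[ℂ] (Y.1.carrier ⊗[ℂ] Z.1.carrier) →ₗ[ℂ]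
    (X.1.carrier ⊗[ℂ] Y.1.carrier) ⊗[ℂ] Z.1.carrier := bra _ _ _

/-- Sector 001: the identity. -/
def assoc001 : X.1.carrier ⊗[ℂ] (Y.1.carrier ⊗[ℂ] Z.2.carrier) →ₗ[ℂ]
    (X.1.carrier ⊗[ℂ] Y.1.carrier) ⊗[ℂ] Z.2.carrier := bra _ _ _

/-- Sector 100: the identity. -/
def assoc100 : X.2.carrier ⊗[ℂ] (Y.1.carrier ⊗[ℂ] Z.1.carrier) →ₗ[ℂ]
    (X.2.carrier ⊗[ℂ] Y.1.carrier) ⊗[ℂ] Z.1.carrier := bra _ _ _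

/-- Sector 010: `exp(C⁽¹³⁾)`. -/
def assoc010 : X.1.carrier ⊗[ℂ] (Y.2.carrier ⊗[ℂ] Z.1.carrier) →ₗ[ℂ]
    (X.1.carrier ⊗[ℂ] Y.2.carrier) ⊗[ℂ] Z.1.carrier := bra _ _ _ ∘ₗ expC13 X.1 Y.2 Z.1

/-- Sector 011:
`[{id_G ⊗ (ρ^X ∘ (S ⊗ id_X))} ∘ {Δ ⊗ id_X} ∘ τ_{X,G}] ⊗ id_{Y ⊗ Z}`. -/
def assoc011 : X.1.carrier ⊗[ℂ] (Grass ⊗[ℂ] (Y.2.carrier ⊗[ℂ] Z.2.carrier)) →ₗ[ℂ]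
    Grass ⊗[ℂ] ((X.1.carrier ⊗[ℂ] Y.2.carrier) ⊗[ℂ] Z.2.carrier) :=
  LinearMap.lTensor Grass (bra _ _ _) ∘ₗ ket _ _ _ ∘ₗ
    LinearMap.rTensor _
      (LinearMap.lTensor Grass (X.1.actMap ∘ₗ LinearMap.rTensor _ Grass.antipode) ∘ₗ
        ket _ _ _ ∘ₗ LinearMap.rTensor _ Grass.copLin ∘ₗ sflip X.1.ω Grass.reg.ω) ∘ₗ
    bra _ _ _

/-- Sector 101: `exp(C⁽¹³⁾)` acting on the tensor factors `G` and `Y` of `G ⊗ X ⊗ Y ⊗ Z`. -/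
def assoc101 : Grass ⊗[ℂ] (X.2.carrier ⊗[ℂ] (Y.1.carrier ⊗[ℂ] Z.2.carrier)) →ₗ[ℂ]
    Grass ⊗[ℂ] ((X.2.carrier ⊗[ℂ] Y.1.carrier) ⊗[ℂ] Z.2.carrier) :=
  ket _ _ _ ∘ₗ LinearMap.rTensor _ (expC13 Grass.reg X.2 Y.1) ∘ₗ bra _ _ _ ∘ₗ
    LinearMap.lTensor Grass (bra _ _ _)

/-- Sector 110:
`{id_{G ⊗ X ⊗ Y} ⊗ ρ^Z} ∘ {id_G ⊗ τ_{G, X ⊗ Y} ⊗ id_Z} ∘ {Δ ⊗ id_{X ⊗ Y ⊗ Z}}`. -/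
def assoc110 : Grass ⊗[ℂ] (X.2.carrier ⊗[ℂ] (Y.2.carrier ⊗[ℂ] Z.1.carrier)) →ₗ[ℂ]
    (Grass ⊗[ℂ] (X.2.carrier ⊗[ℂ] Y.2.carrier)) ⊗[ℂ] Z.1.carrier :=
  LinearMap.lTensor _ Z.1.actMap ∘ₗ shuffle Grass.reg.ω (X.2.tensor Y.2).ω ∘ₗ
    map Grass.copLin (bra _ _ _)

/-- Sector 111: `{φ ⊗ id_{X ⊗ Y ⊗ Z}} ∘ {τ_{X,G} ⊗ id_{Y ⊗ Z}}`. -/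
def assoc111 : X.2.carrier ⊗[ℂ] (Grass ⊗[ℂ] (Y.2.carrier ⊗[ℂ] Z.2.carrier)) →ₗ[ℂ]
    (Grass ⊗[ℂ] (X.2.carrier ⊗[ℂ] Y.2.carrier)) ⊗[ℂ] Z.2.carrier :=
  bra _ _ _ ∘ₗ LinearMap.lTensor Grass (bra _ _ _) ∘ₗ ket _ _ _ ∘ₗ
    LinearMap.rTensor _ (LinearMap.rTensor _ (Grass.phi β) ∘ₗ sflip X.2.ω Grass.reg.ω) ∘ₗ
    bra _ _ _

/-- The component in `SF₀` of `α^{SF} : X * (Y * Z) → (X * Y) * Z`: the sum of its parts in the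
sectors 000, 011, 101, 110. -/
def assoc0 : (tensor X (tensor Y Z)).1.carrier →ₗ[ℂ] (tensor (tensor X Y) Z).1.carrier :=
  LinearMap.inl ℂ _ _ ∘ₗ LinearMap.rTensor _ (LinearMap.inl ℂ _ _) ∘ₗ assoc000 X Y Z ∘ₗ
      LinearMap.lTensor _ (LinearMap.fst ℂ _ _) ∘ₗ LinearMap.fst ℂ _ _
    + LinearMap.inr ℂ _ _ ∘ₗ
      LinearMap.lTensor _ (LinearMap.rTensor _ (LinearMap.inl ℂ _ _)) ∘ₗ assoc011 X Y Z ∘ₗ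
      LinearMap.lTensor _ (LinearMap.snd ℂ _ _) ∘ₗ LinearMap.fst ℂ _ _
    + LinearMap.inr ℂ _ _ ∘ₗ
      LinearMap.lTensor _ (LinearMap.rTensor _ (LinearMap.inr ℂ _ _)) ∘ₗ assoc101 X Y Z ∘ₗ
      LinearMap.lTensor _ (LinearMap.lTensor _ (LinearMap.fst ℂ _ _)) ∘ₗ LinearMap.snd ℂ _ _
    + LinearMap.inl ℂ _ _ ∘ₗ LinearMap.rTensor _ (LinearMap.inr ℂ _ _) ∘ₗ assoc110 X Y Z ∘ₗ
      LinearMap.lTensor _ (LinearMap.lTensor _ (LinearMap.snd ℂ _ _)) ∘ₗ LinearMap.snd ℂ _ _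

/-- The component in `SF₁` of `α^{SF} : X * (Y * Z) → (X * Y) * Z`: the sum of its parts in the
sectors 001, 010, 100, 111. -/
def assoc1 : (tensor X (tensor Y Z)).2.carrier →ₗ[ℂ] (tensor (tensor X Y) Z).2.carrier :=
  LinearMap.inl ℂ _ _ ∘ₗ LinearMap.rTensor _ (LinearMap.inl ℂ _ _) ∘ₗ assoc001 X Y Z ∘ₗ
      LinearMap.lTensor _ (LinearMap.fst ℂ _ _) ∘ₗ LinearMap.fst ℂ _ _
    + LinearMap.inr ℂ _ _ ∘ₗ LinearMap.rTensor _ (LinearMap.inl ℂ _ _) ∘ₗ assoc010 X Y Z ∘ₗ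
      LinearMap.lTensor _ (LinearMap.snd ℂ _ _) ∘ₗ LinearMap.fst ℂ _ _
    + LinearMap.inr ℂ _ _ ∘ₗ LinearMap.rTensor _ (LinearMap.inr ℂ _ _) ∘ₗ assoc100 X Y Z ∘ₗ
      LinearMap.lTensor _ (LinearMap.fst ℂ _ _) ∘ₗ LinearMap.snd ℂ _ _
    + LinearMap.inl ℂ _ _ ∘ₗ LinearMap.rTensor _ (LinearMap.inr ℂ _ _) ∘ₗ assoc111 β X Y Z ∘ₗ
      LinearMap.lTensor _ (LinearMap.snd ℂ _ _) ∘ₗ LinearMap.snd ℂ _ _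

end Sectors

end SF

/-! ### The element `Λ` -/

namespace SAlg

/-- `S ⊗ S ⊗ S` as a superalgebra. -/
abbrev S3 : Type := STensor (STensor SAlg SAlg) SAlg

/-- The pure tensor `x ⊗ y ⊗ z`. -/
def t3 (x y z : SAlg) : S3 := pt (pt x y) z

/-- The idempotents `e₀`, `e₁`. -/
def e : Fin 2 → SAlg := ![e0, e1]

open Complex in
/-- The coefficients `Λ^{abc}`. -/
def LamCoef (β : ℂ) : Fin 2 → Fin 2 → Fin 2 → S3
  | 0, 1, 0 =>
    t3 1 1 1 + (1 + I) • t3 xm 1 xp - (1 - I) • t3 xp 1 xm - (2 : ℂ) • t3 (xp * xm) 1 (xp * xm)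
  | 1, 1, 0 => t3 1 1 1 - I • t3 1 (xp + xm) (xp + xm)
  | 1, 0, 1 =>
    t3 1 1 1 + I • t3 1 (xp + I • xm) (xp + I • xm)
      + (1 - I) • t3 (xp - xm) (xp * xm) (I • xp - xm)
      + (1 + I) • t3 xm xp 1 - (1 - I) • t3 xp xm 1
      + (1 + I) • t3 1 (xp * xm) 1 - (2 : ℂ) • t3 (xp * xm) (xp * xm) 1
  | 1, 1, 1 => β ^ 2 •
    ((I - 1) • t3 1 1 1 + (1 - I) • t3 1 1 (xp * xm) + (1 + 2 * I) • t3 1 xm xm + t3 1 xm xp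
      + t3 1 xp xm + t3 1 xp xp + (1 - I) • t3 1 (xp * xm) 1
      - (2 - 2 * I) • t3 1 (xp * xm) (xp * xm)
      - (1 - I) • t3 xm 1 xm + (1 + I) • t3 xm 1 xp - (1 - I) • t3 xm xm (xp * xm)
      + (1 + I) • t3 xm xp (xp * xm) + (1 - I) • t3 xm (xp * xm) xm
      - (1 + I) • t3 xm (xp * xm) xp
      + (1 - I) • t3 xp xm 1 - (1 - I) • t3 xp xm (xp * xm) - (1 + I) • t3 xp xp 1
      + (1 + I) • t3 xp xp (xp * xm) - (1 - I) • t3 xp (xp * xm) xm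
      + (1 + I) • t3 xp (xp * xm) xp
      + (2 : ℂ) • t3 (xp * xm) 1 1 - (2 : ℂ) • t3 (xp * xm) 1 (xp * xm)
      - (2 * I) • t3 (xp * xm) xm xm - (2 * I) • t3 (xp * xm) xp xp
      - (2 : ℂ) • t3 (xp * xm) (xp * xm) 1 + (4 : ℂ) • t3 (xp * xm) (xp * xm) (xp * xm))
  | _, _, _ => 1

/-- The component `Λ^{abc} · e_a ⊗ e_b ⊗ e_c` of `Λ` in `S_a ⊗ S_b ⊗ S_c`. -/
def LamSector (β : ℂ) (a b c : Fin 2) : S3 := LamCoef β a b c * t3 (e a) (e b) (e c)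

/-- The element `Λ`. -/
def Lam (β : ℂ) : S3 := ∑ a, ∑ b, ∑ c, LamSector β a b c

end SAlg

/-- The linear map `U ⊗ (V ⊗ W) → (U ⊗ V) ⊗ W` given by the action of `t ∈ S ⊗ S ⊗ S`. -/
def RepS.assocBy (t : SAlg.S3) (U V W : RepS) :
    (tensor U (tensor V W)).carrier →ₗ[ℂ] (tensor (tensor U V) W).carrier :=
  ((U.ext V).ext W).ρ t ∘ₗ (TensorProduct.assoc ℂ U.carrier V.carrier W.carrier).symm.toLinearMap

/-! ### The functor `D : SF ⥤ Rep S` -/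

/-- The algebra map `S → G` with `x⁺ ↦ a₁`, `x⁻ ↦ a₂` and `L ↦ 1`. -/
def SAlg.toGrass : SAlg →ₐ[ℂ] Grass :=
  SAlg.lift Grass.a1 Grass.a2 1 (by simp) (by simp) (by simp [Grass.a2_mul_a1]) Grass.a1_mul_a1
    Grass.a2_mul_a2 (by simp)

theorem SAlg.toGrass_par (a : SAlg) : SAlg.toGrass (par a) = par (SAlg.toGrass a) := by
  have h : SAlg.toGrass.comp (par (A := SAlg)) = (par (A := Grass)).comp SAlg.toGrass := by
    apply SAlg.algHom_ext
    · simp [SAlg.par_xp, SAlg.toGrass, SAlg.lift_xp, Grass.par_a1]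
    · simp [SAlg.par_xm, SAlg.toGrass, SAlg.lift_xm, Grass.par_a2]
    · simp [SAlg.par_L, SAlg.toGrass, SAlg.lift_L]
  exact AlgHom.congr_fun h a

/-- The part of `D` on `SF₀`: the action of `S` is given by `x⁺.u = a₁.u`, `x⁻.u = a₂.u`. -/
abbrev D0 (U : SRep Grass) : RepS := U.res SAlg.toGrass SAlg.toGrass_par

/-- The functor `D`: the component `X.1` in `SF₀` is sent to `X.1` with the action
`x⁺.u = a₁.u`, `x⁻.u = a₂.u`, the component `X.2` in `SF₁` is sent to `B ⊗ X.2` with `S` acting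
on `B`. -/
def D : SF ⥤ RepS where
  obj X := (D0 X.1).dsum (SAlg.BRep.tensorSVect X.2)
  map {X Y} f := SRep.dsumMap (U := D0 X.1) (U' := D0 Y.1)
    ⟨f.1.lin, f.1.lin_ω, fun a x => f.1.lin_ρ (SAlg.toGrass a) x⟩
    (SRep.tensorSVectMap SAlg.BRep f.2)
  map_id X := by
    refine SRep.Hom.ext (LinearMap.ext fun x => Prod.ext rfl ?_)
    exact LinearMap.congr_fun (LinearMap.lTensor_id _ _) x.2
  map_comp f g := by
    refine SRep.Hom.ext (LinearMap.ext fun x => Prod.ext rfl ?_)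
    exact LinearMap.congr_fun (LinearMap.lTensor_comp _ _ _) x.2

/-! ### The isomorphisms `Δ_{U,V} : D (U * V) → D U ⊗ D V` -/

section Delta

open SAlg

/-- `δ₀ = 1 ⊗ 1 + x⁻ ⊗ x⁺`. -/
def del0 : SAlg ⊗[ℂ] SAlg := 1 ⊗ₜ 1 + xm ⊗ₜ xp

/-- `δ₁ = 1 + x⁺ x⁻`. -/
def del1 : SAlg := 1 + xp * xm

/-- The identification of `G` with `S₀ = e₀ S ⊆ S`, sending `1 ↦ e₀`, `a₁ ↦ x⁺ e₀`,
`a₂ ↦ x⁻ e₀`, `a₁ a₂ ↦ x⁺ x⁻ e₀`. -/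
def grassToS : Grass →ₗ[ℂ] SAlg where
  toFun g := g.re • e0 + g.imI • (xp * e0) + g.imJ • (xm * e0) + g.imK • (xp * xm * e0)
  map_add' g h := by simp only [QuaternionAlgebra.re_add, QuaternionAlgebra.imI_add,
    QuaternionAlgebra.imJ_add, QuaternionAlgebra.imK_add]; module
  map_smul' c g := by simp only [QuaternionAlgebra.re_smul, QuaternionAlgebra.imI_smul,
    QuaternionAlgebra.imJ_smul, QuaternionAlgebra.imK_smul, smul_eq_mul, RingHom.id_apply]; module

variable (U V : SF)

/-- Sector 00: `(ρ^U ⊗ ρ^V) ∘ (id_S ⊗ τ_{S,U} ⊗ id_V) ∘ (δ₀ ⊗ id_U ⊗ id_V)`. -/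
def delta00 : U.1.carrier ⊗[ℂ] V.1.carrier →ₗ[ℂ] U.1.carrier ⊗[ℂ] V.1.carrier :=
  map (D0 U.1).actMap (D0 V.1).actMap ∘ₗ shuffle (par (A := SAlg)).toLinearMap U.1.ω ∘ₗ
    TensorProduct.mk ℂ _ _ del0

/-- Sector 01:
`(ρ^U ⊗ R_b ⊗ id_V) ∘ (R_{δ₁} ⊗ τ_{S,U} ⊗ id_V) ∘ (Δ^S ⊗ id_U ⊗ id_V)`. -/
def delta01 : B ⊗[ℂ] (U.1.carrier ⊗[ℂ] V.2.carrier) →ₗ[ℂ]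
    U.1.carrier ⊗[ℂ] (B ⊗[ℂ] V.2.carrier) :=
  map ((D0 U.1).actMap ∘ₗ LinearMap.rTensor _ (R del1)) (LinearMap.rTensor _ Rb) ∘ₗ
    shuffle (par (A := SAlg)).toLinearMap U.1.ω ∘ₗ
    LinearMap.rTensor _ (copLin ∘ₗ B.subtype)

/-- Sector 10:
`(R_b ⊗ id_U ⊗ ρ^V) ∘ (id_S ⊗ τ_{S,U} ⊗ id_V) ∘ (Δ^S ⊗ id_U ⊗ id_V)`. -/
def delta10 : B ⊗[ℂ] (U.2.carrier ⊗[ℂ] V.1.carrier) →ₗ[ℂ]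
    (B ⊗[ℂ] U.2.carrier) ⊗[ℂ] V.1.carrier :=
  map (LinearMap.rTensor _ Rb) (D0 V.1).actMap ∘ₗ
    shuffle (par (A := SAlg)).toLinearMap U.2.ω ∘ₗ
    LinearMap.rTensor _ (copLin ∘ₗ B.subtype)

/-- Sector 11:
`(id_B ⊗ τ_{B,U} ⊗ id_V) ∘ ([(R_b ⊗ R_b) ∘ Δ^S] ⊗ id_U ⊗ id_V)`, with `G` identified with
`S₀`. -/
def delta11 : Grass ⊗[ℂ] (U.2.carrier ⊗[ℂ] V.2.carrier) →ₗ[ℂ]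
    (B ⊗[ℂ] U.2.carrier) ⊗[ℂ] (B ⊗[ℂ] V.2.carrier) :=
  shuffle BRep.ω U.2.ω ∘ₗ
    LinearMap.rTensor _ (map Rb Rb ∘ₗ copLin ∘ₗ grassToS)

/-- `Δ_{U,V} : D (U * V) → D U ⊗ D V`, the sum of its parts in the four sectors. -/
def deltaLin : (D.obj (SF.tensor U V)).carrier →ₗ[ℂ]
    (RepS.tensor (D.obj U) (D.obj V)).carrier :=
  map (LinearMap.inl ℂ _ _) (LinearMap.inl ℂ _ _) ∘ₗ delta00 U V ∘ₗ
      LinearMap.fst ℂ _ _ ∘ₗ LinearMap.fst ℂ _ _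
    + map (LinearMap.inl ℂ _ _) (LinearMap.inr ℂ _ _) ∘ₗ delta01 U V ∘ₗ
      LinearMap.lTensor _ (LinearMap.fst ℂ _ _) ∘ₗ LinearMap.snd ℂ _ _
    + map (LinearMap.inr ℂ _ _) (LinearMap.inl ℂ _ _) ∘ₗ delta10 U V ∘ₗ
      LinearMap.lTensor _ (LinearMap.snd ℂ _ _) ∘ₗ LinearMap.snd ℂ _ _
    + map (LinearMap.inr ℂ _ _) (LinearMap.inr ℂ _ _) ∘ₗ delta11 U V ∘ₗ
      LinearMap.snd ℂ _ _ ∘ₗ LinearMap.fst ℂ _ _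

end Delta

/-! ### Monoidal structures and transport -/

/-- The data of a tensor product functor, unit, associator and unit isomorphisms satisfy the
axioms of a monoidal category (in particular naturality, the pentagon and the triangle). -/
def IsMonoidal {C : Type 1} [Category.{0} C] (s : MonoidalCategoryStruct C) : Prop :=
  ∃ m : MonoidalCategory C, m.toMonoidalCategoryStruct = s

/-- The monoidal category given by the data `s`. -/
abbrev IsMonoidal.monoidalCategory {C : Type 1} [Category.{0} C] {s : MonoidalCategoryStruct C}
    (h : IsMonoidal s) : MonoidalCategory C where
  toMonoidalCategoryStruct := s
  tensorHom_def := by obtain ⟨m, rfl⟩ := h; exact m.tensorHom_def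
  id_tensorHom_id := by obtain ⟨m, rfl⟩ := h; exact m.id_tensorHom_id
  tensorHom_comp_tensorHom := by obtain ⟨m, rfl⟩ := h; exact m.tensorHom_comp_tensorHom
  whiskerLeft_id := by obtain ⟨m, rfl⟩ := h; exact m.whiskerLeft_id
  id_whiskerRight := by obtain ⟨m, rfl⟩ := h; exact m.id_whiskerRight
  associator_naturality := by obtain ⟨m, rfl⟩ := h; exact m.associator_naturality
  leftUnitor_naturality := by obtain ⟨m, rfl⟩ := h; exact m.leftUnitor_naturality
  rightUnitor_naturality := by obtain ⟨m, rfl⟩ := h; exact m.rightUnitor_naturality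
  pentagon := by obtain ⟨m, rfl⟩ := h; exact m.pentagon
  triangle := by obtain ⟨m, rfl⟩ := h; exact m.triangle

/-- `F`, equipped with the isomorphisms `Θ_{X,Y} : F (X ⊗ Y) → F X ⊗ F Y` and
`θ : F 1 → 1`, is a monoidal functor. -/
def IsMonoidalFunctor {C E : Type 1} [Category.{0} C] [Category.{0} E]
    (mC : MonoidalCategory C) (mE : MonoidalCategory E) (F : C ⥤ E)
    (Θ : ∀ X Y, F.obj (mC.tensorObj X Y) ⟶ mE.tensorObj (F.obj X) (F.obj Y))
    (θ : F.obj mC.tensorUnit ⟶ mE.tensorUnit) : Prop :=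
  ∃ m : F.Monoidal, (∀ X Y, m.toOplaxMonoidal.δ X Y = Θ X Y) ∧ m.toOplaxMonoidal.η = θ

/-- An object of `SF` which lies in the sector `SF_a`: its other component is zero. -/
def SF.InSector (X : SF) (a : Fin 2) : Prop :=
  if a = 0 then Subsingleton X.2.carrier else Subsingleton X.1.carrier

/-- Commutativity of the diagram
`α^t ∘ (id ⊗ Δ_{Y,Z}) ∘ Δ_{X,Y*Z} = (Δ_{X,Y} ⊗ id) ∘ Δ_{X*Y,Z} ∘ D(α^{SF})`,
where `α^t` is given by the action of `t ∈ S ⊗ S ⊗ S`. -/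
def TransportDiagram (β : ℂ) (t : SAlg.S3) (X Y Z : SF) : Prop :=
  RepS.assocBy t (D.obj X) (D.obj Y) (D.obj Z) ∘ₗ
      LinearMap.lTensor (D.obj X).carrier (deltaLin Y Z) ∘ₗ deltaLin X (SF.tensor Y Z)
    = LinearMap.rTensor (D.obj Z).carrier (deltaLin X Y) ∘ₗ deltaLin (SF.tensor X Y) Z ∘ₗ
      LinearMap.prodMap (SF.assoc0 X Y Z) (LinearMap.lTensor SAlg.B (SF.assoc1 β X Y Z))

end SympFerm

end

open CategoryTheory SympFerm

/-! The algebra `S` splits along the central idempotents `e0`, `e1`. On `S₀` the generators `x^±`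
anticommute, so `S₀` is the Grassmann algebra; on `S₁` they satisfy the Clifford relation `x⁺x⁻ +
x⁻x⁺ = 1`, so a module over `S₁` is `B` tensored with its multiplicity space, the kernel of `x⁻`.
This makes `D` an equivalence. The proof establishes the monoidal structure only on the simpler side
`SF` and carries it over to `Rep S`; neither the pentagon nor the `S`-linearity of the action of `Λ`
is ever checked directly.

On `SF` every claim is an identity between linear maps, tested on pure tensors whose Grassmann
entries are `1, a₁, a₂, a₁a₂`. The formulas `al0_…`, `al1_…` give the associator on these vectors,
and `al_pentagon0`, `al_pentagon1` compare the two sides of the pentagon. The condition `β ^ 4 = -1`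
is needed in the pentagon only when all four objects lie in `SF₁`: there one side contains `φ` twice
and the other side does not contain it.

The maps `Δ` are isomorphisms of representations. Outside sector 00 they have the form "let `S` act
on a fixed vector", so linearity is automatic (`delta_ρ_of`); preimages of generators are written
down and a dimension count gives bijectivity (`delta_bijective`).

The heart of the matter is the transport diagram: on pure tensors of each of the eight sectors, the
action of `Λ` agrees with the associator of `SF` conjugated by `Δ` (`transport_of_actsAs`). Hence on
the image of `D` the action of `Λ` is a composite of isomorphisms of representations
(`assocD_hom_lin`). The action of any fixed element of `S ⊗ S ⊗ S` is natural (`as_naturality`), so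
essential surjectivity extends this to all of `Rep S` (`assocS_hom_lin`), and the pentagon of `SF`
becomes that of `Rep S` (`pentagon_D`, `pentagonS`). The triangle holds because `x^±` act by zero on
the unit, and the transport diagram is also the associativity axiom for the monoidal functor `D`.

For uniqueness, invertibility of `Δ` shows that the diagram determines the action of `t` on `D X ⊗ D
Y ⊗ D Z` (`as_eq_of_transportDiagram`). By naturality it determines the action on all vectors of
sector `abc` in arbitrary representations, in particular on `e_a ⊗ e_b ⊗ e_c` in the cube of the
regular representation. The result of that action is `t` itself (`eq_LamSector_iff`). -/

noncomputable section

open CategoryTheory TensorProduct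

namespace SympFerm

section

open SuperAlgebra STensor

/-! ### Multiplication, coproduct, antipode and `φ` on the monomials of the Grassmann algebra -/

namespace Grass

/-- The top element `a₁ a₂`. -/
def a3 : Grass := ⟨0, 0, 0, 1⟩

@[simp] theorem a1_a1 : a1 * a1 = 0 := a1_mul_a1
@[simp] theorem a2_a2 : a2 * a2 = 0 := a2_mul_a2
@[simp] theorem a1_a2 : a1 * a2 = a3 := a1_mul_a2
@[simp] theorem a2_a1 : a2 * a1 = -a3 := by rw [a2_mul_a1, a1_a2]
@[simp] theorem a1_a3 : a1 * a3 = 0 := by ext <;> simp [a1, a3]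
@[simp] theorem a2_a3 : a2 * a3 = 0 := by ext <;> simp [a2, a3]
theorem par_a3 : par a3 = a3 := by simp [← a1_a2, par_a1, par_a2]

theorem eq_sum (g : Grass) : g = g.re • 1 + g.imI • a1 + g.imJ • a2 + g.imK • a3 := by
  ext <;> simp [a1, a2, a3]

theorem cop_a1 : cop a1 = pt a1 1 + pt 1 a1 := lift_a1 ..
theorem cop_a2 : cop a2 = pt a2 1 + pt 1 a2 := lift_a2 ..

theorem copLin_one : copLin 1 = 1 ⊗ₜ 1 := by
  change equiv Grass Grass (cop 1) = _
  rw [map_one]; rfl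

theorem copLin_a1 : copLin a1 = a1 ⊗ₜ 1 + 1 ⊗ₜ a1 := by
  change equiv Grass Grass (cop a1) = _
  rw [cop_a1]; rfl

theorem copLin_a2 : copLin a2 = a2 ⊗ₜ 1 + 1 ⊗ₜ a2 := by
  change equiv Grass Grass (cop a2) = _
  rw [cop_a2]; rfl

theorem copLin_a3 : copLin a3 = a3 ⊗ₜ 1 + a1 ⊗ₜ a2 - a2 ⊗ₜ a1 + 1 ⊗ₜ a3 := by
  change equiv Grass Grass (cop a3) = _
  rw [← a1_a2, map_mul, cop_a1, cop_a2, cop_aux _ _ par_a1 par_a2]; rfl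

theorem antipode_one : antipode 1 = 1 := by ext <;> simp [antipode]
theorem antipode_a1 : antipode a1 = -a1 := by ext <;> simp [antipode, a1]
theorem antipode_a2 : antipode a2 = -a2 := by ext <;> simp [antipode, a2]
theorem antipode_a3 : antipode a3 = a3 := by ext <;> simp [antipode, a3]

theorem phi_one (β : ℂ) : phi β 1 = β ^ 2 • a3 := by ext <;> simp [phi, a3]
theorem phi_a1 (β : ℂ) : phi β a1 = β ^ 2 • a1 := by ext <;> simp [phi, a1]
theorem phi_a2 (β : ℂ) : phi β a2 = β ^ 2 • a2 := by ext <;> simp [phi, a2]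
theorem phi_a3 (β : ℂ) : phi β a3 = -(β ^ 2 • 1) := by ext <;> simp [phi, a3]

end Grass

/-! ### Calculus in representations of the Grassmann algebra -/

section GrassRep

variable (U : SRep Grass) (x : U.carrier)

/-- These rules form a rewriting system: parity involutions move inwards past the generators, and
`a₁` moves to the left of `a₂`. Every word then has a normal form, so identities between sums of
pure tensors reduce to additive bookkeeping. -/
theorem ρ_one : U.ρ 1 x = x := by simp
theorem ρ_a3 : U.ρ Grass.a3 x = U.ρ Grass.a1 (U.ρ Grass.a2 x) := by
  rw [← Module.End.mul_apply, ← map_mul, Grass.a1_a2]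
theorem ρ_a1_a1 : U.ρ Grass.a1 (U.ρ Grass.a1 x) = 0 := by
  rw [← Module.End.mul_apply, ← map_mul, Grass.a1_a1, map_zero, LinearMap.zero_apply]
theorem ρ_a2_a2 : U.ρ Grass.a2 (U.ρ Grass.a2 x) = 0 := by
  rw [← Module.End.mul_apply, ← map_mul, Grass.a2_a2, map_zero, LinearMap.zero_apply]
theorem ρ_a2_a1 : U.ρ Grass.a2 (U.ρ Grass.a1 x) = -U.ρ Grass.a1 (U.ρ Grass.a2 x) := by
  rw [← Module.End.mul_apply, ← map_mul, Grass.a2_a1, map_neg, LinearMap.neg_apply, ρ_a3]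
theorem ω_ρ_a1 : U.ω (U.ρ Grass.a1 x) = -U.ρ Grass.a1 (U.ω x) := by
  rw [U.ω_ρ, Grass.par_a1, map_neg, LinearMap.neg_apply]
theorem ω_ρ_a2 : U.ω (U.ρ Grass.a2 x) = -U.ρ Grass.a2 (U.ω x) := by
  rw [U.ω_ρ, Grass.par_a2, map_neg, LinearMap.neg_apply]

end GrassRep

/-! ### Pure elements of the tensor product of `SF` -/

namespace SF

/-- The tensor product of `SF`, not unfolded by `simp`. -/
def tens (X Y : SF) : SF := tensor X Y

section Inj

variable (X Y : SF)

/-- `x ⊗ y` for `x` and `y` in sector 0. -/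
def i00 : X.1.carrier →ₗ[ℂ] Y.1.carrier →ₗ[ℂ] (tens X Y).1.carrier :=
  (TensorProduct.mk ℂ X.1.carrier Y.1.carrier).compr₂ (LinearMap.inl ℂ _ _)

/-- `x ⊗ y` for `x` in sector 0 and `y` in sector 1. -/
def i01 : X.1.carrier →ₗ[ℂ] Y.2.carrier →ₗ[ℂ] (tens X Y).2.carrier :=
  (TensorProduct.mk ℂ X.1.carrier Y.2.carrier).compr₂ (LinearMap.inl ℂ _ _)

/-- `x ⊗ y` for `x` in sector 1 and `y` in sector 0. -/
def i10 : X.2.carrier →ₗ[ℂ] Y.1.carrier →ₗ[ℂ] (tens X Y).2.carrier :=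
  (TensorProduct.mk ℂ X.2.carrier Y.1.carrier).compr₂ (LinearMap.inr ℂ _ _)

/-- `g ⊗ x ⊗ y` for `x` and `y` in sector 1. -/
def i11 : Grass →ₗ[ℂ] X.2.carrier →ₗ[ℂ] Y.2.carrier →ₗ[ℂ] (tens X Y).1.carrier :=
  TensorProduct.lcurry (.id ℂ) X.2.carrier Y.2.carrier (tens X Y).1.carrier ∘ₗ
    (TensorProduct.mk ℂ Grass (X.2.carrier ⊗[ℂ] Y.2.carrier)).compr₂ (LinearMap.inr ℂ _ _)

variable {X Y}

end Inj

end SF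

/-! ### Spanning vectors of products and tensor products -/

/-- The elements `1`, `a₁`, `a₂`, `a₁ a₂` of the Grassmann algebra. -/
inductive Grass.Mono : Grass → Prop
  | one : Mono 1
  | a1 : Mono Grass.a1
  | a2 : Mono Grass.a2
  | a3 : Mono Grass.a3

/-- Linear identities are treated below as membership in a submodule, usually an `eqLocus` of two
maps or a range. Pulling the submodule back along one tensor slot at a time reduces membership to
spanning vectors of each slot. -/
theorem Grass.mem_of_mono (N : Submodule ℂ Grass) (h : ∀ g, Grass.Mono g → g ∈ N) (g : Grass) :
    g ∈ N := by
  rw [Grass.eq_sum g]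
  exact add_mem (add_mem (add_mem (N.smul_mem _ (h _ .one)) (N.smul_mem _ (h _ .a1)))
    (N.smul_mem _ (h _ .a2))) (N.smul_mem _ (h _ .a3))

/-- Pure tensors generate the tensor product. -/
theorem tensor_mem {A B : Type} [AddCommGroup A] [Module ℂ A] [AddCommGroup B] [Module ℂ B]
    (N : Submodule ℂ (A ⊗[ℂ] B)) (h : ∀ a b, a ⊗ₜ b ∈ N) (v : A ⊗[ℂ] B) : v ∈ N :=
  TensorProduct.induction_on v N.zero_mem h fun _ _ => N.add_mem

theorem prod_mem' {A B : Type} [AddCommGroup A] [Module ℂ A] [AddCommGroup B] [Module ℂ B]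
    (N : Submodule ℂ (A × B)) (h0 : ∀ a, (a, 0) ∈ N) (h1 : ∀ b, (0, b) ∈ N) (v : A × B) :
    v ∈ N := by
  have := N.add_mem (h0 v.1) (h1 v.2)
  simpa using this

/-- The structure maps of `SF.tens` and of `D.obj X` are block diagonal by definition. This lemma
and the next evaluate them on a single summand. -/
theorem prodMap_left {A B A' B' : Type} [AddCommGroup A] [Module ℂ A] [AddCommGroup B]
    [Module ℂ B] [AddCommGroup A'] [Module ℂ A'] [AddCommGroup B'] [Module ℂ B']
    (f : A →ₗ[ℂ] A') (g : B →ₗ[ℂ] B') (x : A) : f.prodMap g (x, 0) = (f x, 0) :=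
  Prod.ext rfl (map_zero g)

theorem prodMap_right {A B A' B' : Type} [AddCommGroup A] [Module ℂ A] [AddCommGroup B]
    [Module ℂ B] [AddCommGroup A'] [Module ℂ A'] [AddCommGroup B'] [Module ℂ B']
    (f : A →ₗ[ℂ] A') (g : B →ₗ[ℂ] B') (x : B) : f.prodMap g (0, x) = (0, g x) :=
  Prod.ext (map_zero f) rfl

/-! ### Braidings on homogeneous elements -/

section Shuffle

variable {A B X Y : Type} [AddCommGroup A] [AddCommGroup B] [AddCommGroup X] [AddCommGroup Y]
  [Module ℂ A] [Module ℂ B] [Module ℂ X] [Module ℂ Y]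

theorem shuffle_even (ωB : B →ₗ[ℂ] B) (ωX : X →ₗ[ℂ] X) (a : A) (x : X) (y : Y) (b : B)
    (h : ωB b = b) :
    shuffle ωB ωX ((a ⊗ₜ b) ⊗ₜ (x ⊗ₜ y)) = (a ⊗ₜ x) ⊗ₜ (b ⊗ₜ y) := by
  have h' : (2⁻¹ : ℂ) • b + (2⁻¹ : ℂ) • b = b := by module
  simp [shuffle, ev, od, h, h']

theorem shuffle_odd (ωB : B →ₗ[ℂ] B) (ωX : X →ₗ[ℂ] X) (a : A) (x : X) (y : Y) (b : B)
    (h : ωB b = -b) :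
    shuffle ωB ωX ((a ⊗ₜ b) ⊗ₜ (x ⊗ₜ y)) = (a ⊗ₜ ωX x) ⊗ₜ (b ⊗ₜ y) := by
  have h' : (2⁻¹ : ℂ) • b + (2⁻¹ : ℂ) • b = b := by module
  simp [shuffle, ev, od, h, h']

theorem sflip_grass_one (ω : X →ₗ[ℂ] X) (x : X) :
    sflip ω Grass.reg.ω (x ⊗ₜ 1) = 1 ⊗ₜ x :=
  sflip_even (Y := Grass) ω (par (A := Grass)).toLinearMap x 1 (map_one (par (A := Grass)))

theorem sflip_grass_a1 (ω : X →ₗ[ℂ] X) (x : X) :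
    sflip ω Grass.reg.ω (x ⊗ₜ Grass.a1) = Grass.a1 ⊗ₜ ω x :=
  sflip_odd (Y := Grass) ω (par (A := Grass)).toLinearMap x Grass.a1 Grass.par_a1

theorem sflip_grass_a2 (ω : X →ₗ[ℂ] X) (x : X) :
    sflip ω Grass.reg.ω (x ⊗ₜ Grass.a2) = Grass.a2 ⊗ₜ ω x :=
  sflip_odd (Y := Grass) ω (par (A := Grass)).toLinearMap x Grass.a2 Grass.par_a2

theorem sflip_grass_a3 (ω : X →ₗ[ℂ] X) (x : X) :
    sflip ω Grass.reg.ω (x ⊗ₜ Grass.a3) = Grass.a3 ⊗ₜ x :=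
  sflip_even (Y := Grass) ω (par (A := Grass)).toLinearMap x Grass.a3 Grass.par_a3

end Shuffle

namespace SF

/-! ### Generators of iterated products in `SF` -/

section Gen

variable {X Y Z W : SF}

theorem mem_tens0 (N : Submodule ℂ (tens X Y).1.carrier) (h00 : ∀ x y, i00 X Y x y ∈ N)
    (h11 : ∀ g, Grass.Mono g → ∀ x y, i11 X Y g x y ∈ N) (v) : v ∈ N := by
  refine prod_mem' (A := X.1.carrier ⊗[ℂ] Y.1.carrier)
    (B := Grass ⊗[ℂ] (X.2.carrier ⊗[ℂ] Y.2.carrier)) N (fun v => ?_) (fun v => ?_) v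
  · exact tensor_mem (N.comap (LinearMap.inl ℂ _ (Grass ⊗[ℂ] (X.2.carrier ⊗[ℂ] Y.2.carrier)))) h00 v
  · refine tensor_mem (N.comap (LinearMap.inr ℂ (X.1.carrier ⊗[ℂ] Y.1.carrier) _)) (fun g v => ?_) v
    -- The splitting of `x ⊗ y` is done for a fixed Grassmann element; once `x` and `y` are fixed,
    -- linearity in the Grassmann slot leaves only the four monomials.
    refine tensor_mem (N.comap (LinearMap.inr ℂ (X.1.carrier ⊗[ℂ] Y.1.carrier) _ ∘ₗ
      TensorProduct.mk ℂ Grass (X.2.carrier ⊗[ℂ] Y.2.carrier) g)) (fun x y => ?_) v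
    exact Grass.mem_of_mono (N.comap (((i11 X Y).flip x).flip y)) (fun g hg => h11 g hg x y) g

theorem mem_tens1 (N : Submodule ℂ (tens X Y).2.carrier) (h01 : ∀ x y, i01 X Y x y ∈ N)
    (h10 : ∀ x y, i10 X Y x y ∈ N) (v) : v ∈ N := by
  refine prod_mem' (A := X.1.carrier ⊗[ℂ] Y.2.carrier)
    (B := X.2.carrier ⊗[ℂ] Y.1.carrier) N (fun v => ?_) (fun v => ?_) v
  · exact tensor_mem (N.comap (LinearMap.inl ℂ _ (X.2.carrier ⊗[ℂ] Y.1.carrier))) h01 v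
  · exact tensor_mem (N.comap (LinearMap.inr ℂ (X.1.carrier ⊗[ℂ] Y.2.carrier) _)) h10 v

/-- The generators of the component in `SF₀` of `X * (Y * Z)`. -/
theorem mem_right0 (N : Submodule ℂ (tens X (tens Y Z)).1.carrier)
    (h000 : ∀ x y z, i00 X (tens Y Z) x (i00 Y Z y z) ∈ N)
    (h011 : ∀ g, Grass.Mono g → ∀ x y z, i00 X (tens Y Z) x (i11 Y Z g y z) ∈ N)
    (h101 : ∀ g, Grass.Mono g → ∀ x y z, i11 X (tens Y Z) g x (i01 Y Z y z) ∈ N)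
    (h110 : ∀ g, Grass.Mono g → ∀ x y z, i11 X (tens Y Z) g x (i10 Y Z y z) ∈ N) (v) : v ∈ N :=
  mem_tens0 N
    (fun x => mem_tens0 (N.comap (i00 _ _ x)) (fun y z => h000 x y z)
      (fun g hg y z => h011 g hg x y z))
    (fun g hg x => mem_tens1 (N.comap (i11 _ _ g x)) (fun y z => h101 g hg x y z)
      (fun y z => h110 g hg x y z)) v

/-- The generators of the component in `SF₁` of `X * (Y * Z)`. -/
theorem mem_right1 (N : Submodule ℂ (tens X (tens Y Z)).2.carrier)
    (h001 : ∀ x y z, i01 X (tens Y Z) x (i01 Y Z y z) ∈ N)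
    (h010 : ∀ x y z, i01 X (tens Y Z) x (i10 Y Z y z) ∈ N)
    (h100 : ∀ x y z, i10 X (tens Y Z) x (i00 Y Z y z) ∈ N)
    (h111 : ∀ g, Grass.Mono g → ∀ x y z, i10 X (tens Y Z) x (i11 Y Z g y z) ∈ N) (v) : v ∈ N :=
  mem_tens1 N
    (fun x => mem_tens1 (N.comap (i01 _ _ x)) (fun y z => h001 x y z) (fun y z => h010 x y z))
    (fun x => mem_tens0 (N.comap (i10 _ _ x)) (fun y z => h100 x y z)
      (fun g hg y z => h111 g hg x y z)) v

/-- The generators of the component in `SF₀` of `(X * Y) * Z`. -/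
theorem mem_left0 (N : Submodule ℂ (tens (tens X Y) Z).1.carrier)
    (h000 : ∀ x y z, i00 (tens X Y) Z (i00 X Y x y) z ∈ N)
    (h011 : ∀ g, Grass.Mono g → ∀ x y z, i11 (tens X Y) Z g (i01 X Y x y) z ∈ N)
    (h101 : ∀ g, Grass.Mono g → ∀ x y z, i11 (tens X Y) Z g (i10 X Y x y) z ∈ N)
    (h110 : ∀ g, Grass.Mono g → ∀ x y z, i00 (tens X Y) Z (i11 X Y g x y) z ∈ N) (v) : v ∈ N :=
  mem_tens0 N
    (fun v z => mem_tens0 (N.comap ((i00 _ _).flip z)) (fun x y => h000 x y z)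
      (fun g hg x y => h110 g hg x y z) v)
    (fun g hg v z => mem_tens1 (N.comap ((i11 _ _ g).flip z)) (fun x y => h011 g hg x y z)
      (fun x y => h101 g hg x y z) v) v

/-- The generators of the component in `SF₁` of `(X * Y) * Z`. -/
theorem mem_left1 (N : Submodule ℂ (tens (tens X Y) Z).2.carrier)
    (h001 : ∀ x y z, i01 (tens X Y) Z (i00 X Y x y) z ∈ N)
    (h010 : ∀ x y z, i10 (tens X Y) Z (i01 X Y x y) z ∈ N)
    (h100 : ∀ x y z, i10 (tens X Y) Z (i10 X Y x y) z ∈ N)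
    (h111 : ∀ g, Grass.Mono g → ∀ x y z, i01 (tens X Y) Z (i11 X Y g x y) z ∈ N) (v) : v ∈ N :=
  mem_tens1 N
    (fun v z => mem_tens0 (N.comap ((i01 _ _).flip z)) (fun x y => h001 x y z)
      (fun g hg x y => h111 g hg x y z) v)
    (fun v z => mem_tens1 (N.comap ((i10 _ _).flip z)) (fun x y => h010 x y z)
      (fun x y => h100 x y z) v) v

end Gen

/-! ### Structure maps on pure elements -/

section Structure

variable (X Y : SF)

theorem ω_i00 (x y) : (tens X Y).1.ω (i00 X Y x y) = i00 X Y (X.1.ω x) (Y.1.ω y) :=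
  prodMap_left (map X.1.ω Y.1.ω) _ _
theorem ω_i11 (g x y) : (tens X Y).1.ω (i11 X Y g x y) = i11 X Y (par g) (X.2.ω x) (Y.2.ω y) :=
  prodMap_right _ (map (par (A := Grass)).toLinearMap (map X.2.ω Y.2.ω)) _
theorem ω_i01 (x y) : (tens X Y).2.ω (i01 X Y x y) = i01 X Y (X.1.ω x) (Y.2.ω y) :=
  prodMap_left (map X.1.ω Y.2.ω) _ _
theorem ω_i10 (x y) : (tens X Y).2.ω (i10 X Y x y) = i10 X Y (X.2.ω x) (Y.1.ω y) :=
  prodMap_right _ (map X.2.ω Y.1.ω) _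

theorem ρ_i11 (h g x y) : (tens X Y).1.ρ h (i11 X Y g x y) = i11 X Y (h * g) x y :=
  prodMap_right (sact X.1.ω X.1.ρ Y.1.ρ (Grass.cop h))
    (LinearMap.rTensor _ (LinearMap.mulLeft ℂ h)) _

theorem ρ_a1_i00 (x y) : (tens X Y).1.ρ Grass.a1 (i00 X Y x y)
    = i00 X Y (X.1.ρ Grass.a1 x) y + i00 X Y (X.1.ω x) (Y.1.ρ Grass.a1 y) := by
  refine (prodMap_left (sact X.1.ω X.1.ρ Y.1.ρ (Grass.cop Grass.a1))
    (LinearMap.rTensor _ (LinearMap.mulLeft ℂ Grass.a1)) (x ⊗ₜ y)).trans ?_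
  rw [Grass.cop_a1, map_add, LinearMap.add_apply, sact_even _ _ _ _ (map_one _),
    sact_odd _ _ _ _ Grass.par_a1, map_one, map_one]
  -- In the summand coming from `SF₁` both sides vanish; on the right it is a sum of two zeros.
  exact Prod.ext rfl (add_zero (0 : Grass ⊗[ℂ] (X.2.carrier ⊗[ℂ] Y.2.carrier))).symm

theorem ρ_a2_i00 (x y) : (tens X Y).1.ρ Grass.a2 (i00 X Y x y)
    = i00 X Y (X.1.ρ Grass.a2 x) y + i00 X Y (X.1.ω x) (Y.1.ρ Grass.a2 y) := by
  refine (prodMap_left (sact X.1.ω X.1.ρ Y.1.ρ (Grass.cop Grass.a2))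
    (LinearMap.rTensor _ (LinearMap.mulLeft ℂ Grass.a2)) (x ⊗ₜ y)).trans ?_
  rw [Grass.cop_a2, map_add, LinearMap.add_apply, sact_even _ _ _ _ (map_one _),
    sact_odd _ _ _ _ Grass.par_a2, map_one, map_one]
  exact Prod.ext rfl (add_zero (0 : Grass ⊗[ℂ] (X.2.carrier ⊗[ℂ] Y.2.carrier))).symm

/-- The tensor product of morphisms, as a morphism between the products `tens`. -/
def tensHom {X X' Y Y' : SF} (f : X ⟶ X') (g : Y ⟶ Y') : tens X Y ⟶ tens X' Y' := tensorHom f g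

variable {X Y} {X' Y' : SF} (f : X ⟶ X') (g : Y ⟶ Y')

theorem tensHom_i00 (x y) : (tensHom f g).1.lin (i00 X Y x y) = i00 X' Y' (f.1.lin x) (g.1.lin y) :=
  prodMap_left (map f.1.lin g.1.lin) _ _
theorem tensHom_i11 (h x y) :
    (tensHom f g).1.lin (i11 X Y h x y) = i11 X' Y' h (f.2.lin x) (g.2.lin y) :=
  prodMap_right _ (LinearMap.lTensor Grass (map f.2.lin g.2.lin)) _
theorem tensHom_i01 (x y) : (tensHom f g).2.lin (i01 X Y x y) = i01 X' Y' (f.1.lin x) (g.2.lin y) :=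
  prodMap_left (map f.1.lin g.2.lin) _ _
theorem tensHom_i10 (x y) : (tensHom f g).2.lin (i10 X Y x y) = i10 X' Y' (f.2.lin x) (g.1.lin y) :=
  prodMap_right _ (map f.2.lin g.1.lin) _

end Structure

/-! ### The associator on pure elements -/

section Assoc

variable (β : ℂ) (X Y Z : SF)

/-- The component in `SF₀` of the associator `X * (Y * Z) → (X * Y) * Z`. -/
def al0 : (tens X (tens Y Z)).1.carrier →ₗ[ℂ] (tens (tens X Y) Z).1.carrier := assoc0 X Y Z

/-- The component in `SF₁` of the associator `X * (Y * Z) → (X * Y) * Z`. -/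
def al1 : (tens X (tens Y Z)).2.carrier →ₗ[ℂ] (tens (tens X Y) Z).2.carrier := assoc1 β X Y Z

variable {X Y Z}

theorem al0_000 (x y z) : al0 X Y Z (i00 X (tens Y Z) x (i00 Y Z y z))
    = i00 (tens X Y) Z (i00 X Y x y) z := by
  change assoc0 X Y Z (x ⊗ₜ (y ⊗ₜ z, 0), 0) = ((x ⊗ₜ y, 0) ⊗ₜ z, 0)
  simp [assoc0, assoc000, assoc011]

theorem al1_001 (x y z) : al1 β X Y Z (i01 X (tens Y Z) x (i01 Y Z y z))
    = i01 (tens X Y) Z (i00 X Y x y) z := by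
  change assoc1 β X Y Z (x ⊗ₜ (y ⊗ₜ z, 0), 0) = ((x ⊗ₜ y, 0) ⊗ₜ z, 0)
  simp [assoc1, assoc001]

theorem al1_100 (x y z) : al1 β X Y Z (i10 X (tens Y Z) x (i00 Y Z y z))
    = i10 (tens X Y) Z (i10 X Y x y) z := by
  change assoc1 β X Y Z (0, x ⊗ₜ (y ⊗ₜ z, 0)) = (0, (0, x ⊗ₜ y) ⊗ₜ z)
  simp [assoc1, assoc100]

/-- In the square of `C13` the terms with `a₁²` and `a₂²` vanish and the two cross terms coincide,
which absorbs the factor `1/2`. The two involutions on `V` cancel there, and reordering the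
generators, together with moving `ω` past one of them, produces the remaining minus sign. -/
theorem expC13_apply (U : SRep Grass) (V : SVect) (W : SRep Grass) (x y z) :
    expC13 U V W (x ⊗ₜ (y ⊗ₜ z)) = x ⊗ₜ (y ⊗ₜ z)
      + U.ρ Grass.a2 (U.ω x) ⊗ₜ (V.ω y ⊗ₜ W.ρ Grass.a1 z)
      - U.ρ Grass.a1 (U.ω x) ⊗ₜ (V.ω y ⊗ₜ W.ρ Grass.a2 z)
      - U.ρ Grass.a1 (U.ρ Grass.a2 x) ⊗ₜ (y ⊗ₜ W.ρ Grass.a1 (W.ρ Grass.a2 z)) := by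
  simp only [expC13, C13, LinearMap.add_apply, LinearMap.smul_apply, pow_two, Module.End.mul_apply,
    LinearMap.sub_apply, map_tmul, LinearMap.comp_apply, map_sub, Module.End.one_apply,
    ω_ρ_a1, ω_ρ_a2, U.ω_ω, V.ω_ω, map_neg, ρ_a1_a1, ρ_a2_a2, ρ_a2_a1, TensorProduct.tmul_neg,
    TensorProduct.neg_tmul, TensorProduct.tmul_zero]
  module

theorem al1_010 (x y z) : al1 β X Y Z (i01 X (tens Y Z) x (i10 Y Z y z))
    = i10 (tens X Y) Z (i01 X Y x y) z
      + i10 (tens X Y) Z (i01 X Y (X.1.ρ Grass.a2 (X.1.ω x)) (Y.2.ω y)) (Z.1.ρ Grass.a1 z)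
      - i10 (tens X Y) Z (i01 X Y (X.1.ρ Grass.a1 (X.1.ω x)) (Y.2.ω y)) (Z.1.ρ Grass.a2 z)
      - i10 (tens X Y) Z (i01 X Y (X.1.ρ Grass.a1 (X.1.ρ Grass.a2 x)) y)
          (Z.1.ρ Grass.a1 (Z.1.ρ Grass.a2 z)) := by
  let J : (X.1.carrier ⊗[ℂ] Y.2.carrier) ⊗[ℂ] Z.1.carrier →ₗ[ℂ] (tens (tens X Y) Z).2.carrier :=
    LinearMap.inr ℂ _ _ ∘ₗ LinearMap.rTensor Z.1.carrier (LinearMap.inl ℂ _ _)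
  have h : al1 β X Y Z (i01 X (tens Y Z) x (i10 Y Z y z)) = J (assoc010 X Y Z (x ⊗ₜ (y ⊗ₜ z))) := by
    change assoc1 β X Y Z (x ⊗ₜ (0, y ⊗ₜ z), 0) = _
    simp [assoc1, J]
    rfl
  rw [h, assoc010, LinearMap.comp_apply, expC13_apply]
  simp only [map_add, map_sub]
  rfl

/-- The sign of the braiding past `g` depends on the parity of `g`, hence the splitting into even
and odd part. For a monomial only one of the two terms survives. -/
theorem al1_111 (g x y z) : al1 β X Y Z (i10 X (tens Y Z) x (i11 Y Z g y z))
    = i01 (tens X Y) Z (i11 X Y (Grass.phi β (ev (par (A := Grass)).toLinearMap g)) x y) z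
      + i01 (tens X Y) Z
          (i11 X Y (Grass.phi β (od (par (A := Grass)).toLinearMap g)) (X.2.ω x) y) z := by
  let J : (Grass ⊗[ℂ] (X.2.carrier ⊗[ℂ] Y.2.carrier)) ⊗[ℂ] Z.2.carrier →ₗ[ℂ]
      (tens (tens X Y) Z).2.carrier :=
    LinearMap.inl ℂ _ _ ∘ₗ LinearMap.rTensor Z.2.carrier (LinearMap.inr ℂ _ _)
  have h : al1 β X Y Z (i10 X (tens Y Z) x (i11 Y Z g y z))
      = J (assoc111 β X Y Z (x ⊗ₜ (g ⊗ₜ (y ⊗ₜ z)))) := by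
    change assoc1 β X Y Z (0, x ⊗ₜ (0, g ⊗ₜ (y ⊗ₜ z))) = _
    simp [assoc1, J]
    rfl
  rw [h, assoc111]
  simp only [LinearMap.comp_apply, LinearEquiv.coe_coe, TensorProduct.assoc_symm_tmul,
    LinearMap.rTensor_tmul, sflip, TensorProduct.comm_tmul, LinearMap.add_apply, map_tmul,
    LinearMap.id_apply, map_add, TensorProduct.add_tmul, TensorProduct.assoc_tmul,
    LinearMap.lTensor_tmul]
  rfl

/-- The first leg of `C13` acts on `G` by left multiplication, and the parity involution of that leg
appears as `par g`. The corrections raise the Grassmann degree of `g`, in contrast to the sectors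
011 and 110. -/
theorem al0_101 (g x y z) : al0 X Y Z (i11 X (tens Y Z) g x (i01 Y Z y z))
    = i11 (tens X Y) Z g (i10 X Y x y) z
      + i11 (tens X Y) Z (Grass.a2 * par g) (i10 X Y (X.2.ω x) (Y.1.ρ Grass.a1 y)) z
      - i11 (tens X Y) Z (Grass.a1 * par g) (i10 X Y (X.2.ω x) (Y.1.ρ Grass.a2 y)) z
      - i11 (tens X Y) Z (Grass.a1 * (Grass.a2 * g))
          (i10 X Y x (Y.1.ρ Grass.a1 (Y.1.ρ Grass.a2 y))) z := by
  let J : Grass ⊗[ℂ] ((X.2.carrier ⊗[ℂ] Y.1.carrier) ⊗[ℂ] Z.2.carrier) →ₗ[ℂ]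
      (tens (tens X Y) Z).1.carrier :=
    LinearMap.inr ℂ _ _ ∘ₗ LinearMap.lTensor Grass (LinearMap.rTensor _ (LinearMap.inr ℂ _ _))
  have h : al0 X Y Z (i11 X (tens Y Z) g x (i01 Y Z y z))
      = J (assoc101 X Y Z (g ⊗ₜ (x ⊗ₜ (y ⊗ₜ z)))) := by
    change assoc0 X Y Z (0, g ⊗ₜ (x ⊗ₜ (y ⊗ₜ z, 0))) = _
    simp [assoc0, J]
    rfl
  rw [h, assoc101]
  simp only [LinearMap.comp_apply, LinearEquiv.coe_coe, TensorProduct.assoc_symm_tmul,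
    LinearMap.lTensor_tmul, LinearMap.rTensor_tmul]
  rw [expC13_apply Grass.reg X.2 Y.1 g x y]
  simp only [map_add, map_sub, TensorProduct.add_tmul, TensorProduct.sub_tmul,
    TensorProduct.assoc_tmul]
  rfl

/-- The inclusion of the sector 011 into `(X * Y) * Z`. -/
def j011 : Grass ⊗[ℂ] ((X.1.carrier ⊗[ℂ] Y.2.carrier) ⊗[ℂ] Z.2.carrier) →ₗ[ℂ]
    (tens (tens X Y) Z).1.carrier :=
  LinearMap.inr ℂ _ _ ∘ₗ LinearMap.lTensor Grass (LinearMap.rTensor _ (LinearMap.inl ℂ _ _))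

/-- The inclusion of the sector 110 into `(X * Y) * Z`. -/
def j110 : (Grass ⊗[ℂ] (X.2.carrier ⊗[ℂ] Y.2.carrier)) ⊗[ℂ] Z.1.carrier →ₗ[ℂ]
    (tens (tens X Y) Z).1.carrier :=
  LinearMap.inl ℂ _ _ ∘ₗ LinearMap.rTensor _ (LinearMap.inr ℂ _ _)

/-- The value of the associator on the sector 110, as a function of the coproduct. -/
def k110 (x : X.2.carrier) (y : Y.2.carrier) (z : Z.1.carrier) :
    Grass ⊗[ℂ] Grass →ₗ[ℂ] (tens (tens X Y) Z).1.carrier :=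
  j110 ∘ₗ LinearMap.lTensor _ Z.1.actMap ∘ₗ shuffle Grass.reg.ω (X.2.tensor Y.2).ω ∘ₗ
    (TensorProduct.mk ℂ _ _).flip ((x ⊗ₜ y) ⊗ₜ z)

theorem k110_even (x : X.2.carrier) (y : Y.2.carrier) (z : Z.1.carrier) (a : Grass) {g : Grass}
    (h : par g = g) :
    k110 x y z (a ⊗ₜ g) = i00 (tens X Y) Z (i11 X Y a x y) (Z.1.ρ g z) := by
  refine (congrArg (fun t => j110 (LinearMap.lTensor _ Z.1.actMap t))
    (shuffle_even (B := Grass) (par (A := Grass)).toLinearMap (X.2.tensor Y.2).ω a (x ⊗ₜ y) z g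
      h)).trans rfl

theorem k110_odd (x : X.2.carrier) (y : Y.2.carrier) (z : Z.1.carrier) (a : Grass) {g : Grass}
    (h : par g = -g) : k110 x y z (a ⊗ₜ g)
      = i00 (tens X Y) Z (i11 X Y a (X.2.ω x) (Y.2.ω y)) (Z.1.ρ g z) := by
  refine (congrArg (fun t => j110 (LinearMap.lTensor _ Z.1.actMap t))
    (shuffle_odd (B := Grass) (par (A := Grass)).toLinearMap (X.2.tensor Y.2).ω a (x ⊗ₜ y) z g
      h)).trans rfl

theorem al0_011 (x g y z) : al0 X Y Z (i00 X (tens Y Z) x (i11 Y Z g y z))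
    = j011 (assoc011 X Y Z (x ⊗ₜ (g ⊗ₜ (y ⊗ₜ z)))) := by
  change assoc0 X Y Z (x ⊗ₜ (0, g ⊗ₜ (y ⊗ₜ z)), 0) = _
  simp [assoc0]
  generalize assoc011 X Y Z _ = t
  rfl

theorem al0_110 (g x y z) : al0 X Y Z (i11 X (tens Y Z) g x (i10 Y Z y z))
    = k110 x y z (Grass.copLin g) := by
  have : al0 X Y Z (i11 X (tens Y Z) g x (i10 Y Z y z))
      = j110 (assoc110 X Y Z (g ⊗ₜ (x ⊗ₜ (y ⊗ₜ z)))) := by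
    change assoc0 X Y Z (0, g ⊗ₜ (x ⊗ₜ (0, y ⊗ₜ z))) = _
    simp [assoc0]
    generalize assoc110 X Y Z _ = t
    rfl
  rw [this, assoc110]
  simp only [LinearMap.comp_apply, map_tmul, TensorProduct.assoc_symm_tmul, LinearEquiv.coe_coe]
  generalize Grass.copLin g = t
  rfl

theorem al0_011_one (x y z) : al0 X Y Z (i00 X (tens Y Z) x (i11 Y Z 1 y z))
    = i11 (tens X Y) Z 1 (i01 X Y x y) z := by
  rw [al0_011, assoc011]
  simp only [LinearMap.comp_apply, LinearEquiv.coe_coe, TensorProduct.assoc_symm_tmul,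
    LinearMap.rTensor_tmul]
  rw [sflip_grass_one]
  simp only [LinearMap.comp_apply, LinearEquiv.coe_coe, LinearMap.rTensor_tmul, Grass.copLin_one,
    TensorProduct.assoc_tmul, LinearMap.lTensor_tmul, Grass.antipode_one, SRep.actMap, lift.tmul,
    AlgHom.toLinearMap_apply, map_one, Module.End.one_apply]
  rfl

theorem al0_011_a1 (x y z) : al0 X Y Z (i00 X (tens Y Z) x (i11 Y Z Grass.a1 y z))
    = i11 (tens X Y) Z Grass.a1 (i01 X Y (X.1.ω x) y) z
      - i11 (tens X Y) Z 1 (i01 X Y (X.1.ρ Grass.a1 (X.1.ω x)) y) z := by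
  rw [al0_011, assoc011]
  simp only [LinearMap.comp_apply, LinearEquiv.coe_coe, TensorProduct.assoc_symm_tmul,
    LinearMap.rTensor_tmul]
  rw [sflip_grass_a1]
  simp only [LinearMap.comp_apply, LinearEquiv.coe_coe, LinearMap.rTensor_tmul, Grass.copLin_a1,
    TensorProduct.add_tmul, TensorProduct.sub_tmul, TensorProduct.assoc_tmul, map_add, map_sub,
    LinearMap.lTensor_tmul, Grass.antipode_one, Grass.antipode_a1, SRep.actMap, lift.tmul,
    AlgHom.toLinearMap_apply, map_neg, TensorProduct.tmul_neg, TensorProduct.neg_tmul, map_one,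
    Module.End.one_apply, ← sub_eq_add_neg]
  rfl

theorem al0_011_a2 (x y z) : al0 X Y Z (i00 X (tens Y Z) x (i11 Y Z Grass.a2 y z))
    = i11 (tens X Y) Z Grass.a2 (i01 X Y (X.1.ω x) y) z
      - i11 (tens X Y) Z 1 (i01 X Y (X.1.ρ Grass.a2 (X.1.ω x)) y) z := by
  rw [al0_011, assoc011]
  simp only [LinearMap.comp_apply, LinearEquiv.coe_coe, TensorProduct.assoc_symm_tmul,
    LinearMap.rTensor_tmul]
  rw [sflip_grass_a2]
  simp only [LinearMap.comp_apply, LinearEquiv.coe_coe, LinearMap.rTensor_tmul, Grass.copLin_a2,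
    TensorProduct.add_tmul, TensorProduct.sub_tmul, TensorProduct.assoc_tmul, map_add, map_sub,
    LinearMap.lTensor_tmul, Grass.antipode_one, Grass.antipode_a2, SRep.actMap, lift.tmul,
    AlgHom.toLinearMap_apply, map_neg, TensorProduct.tmul_neg, TensorProduct.neg_tmul, map_one,
    Module.End.one_apply, ← sub_eq_add_neg]
  rfl

/-- The second leg of the coproduct of `a₁a₂` goes through the antipode, which flips the sign of the
two mixed terms but not of the last one. -/
theorem al0_011_a3 (x y z) : al0 X Y Z (i00 X (tens Y Z) x (i11 Y Z Grass.a3 y z))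
    = i11 (tens X Y) Z Grass.a3 (i01 X Y x y) z
      - i11 (tens X Y) Z Grass.a1 (i01 X Y (X.1.ρ Grass.a2 x) y) z
      + i11 (tens X Y) Z Grass.a2 (i01 X Y (X.1.ρ Grass.a1 x) y) z
      + i11 (tens X Y) Z 1 (i01 X Y (X.1.ρ Grass.a1 (X.1.ρ Grass.a2 x)) y) z := by
  rw [al0_011, assoc011]
  simp only [LinearMap.comp_apply, LinearEquiv.coe_coe, TensorProduct.assoc_symm_tmul,
    LinearMap.rTensor_tmul]
  rw [sflip_grass_a3]
  simp only [LinearMap.comp_apply, LinearEquiv.coe_coe, LinearMap.rTensor_tmul, Grass.copLin_a3,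
    TensorProduct.add_tmul, TensorProduct.sub_tmul, TensorProduct.assoc_tmul, map_add, map_sub,
    LinearMap.lTensor_tmul, Grass.antipode_one, Grass.antipode_a1, Grass.antipode_a2,
    Grass.antipode_a3, SRep.actMap, lift.tmul, AlgHom.toLinearMap_apply, map_neg,
    TensorProduct.tmul_neg, TensorProduct.neg_tmul, map_one, Module.End.one_apply, ρ_a3,
    sub_neg_eq_add, ← sub_eq_add_neg]
  rfl

theorem al0_110_one (x y z) : al0 X Y Z (i11 X (tens Y Z) 1 x (i10 Y Z y z))
    = i00 (tens X Y) Z (i11 X Y 1 x y) z := by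
  rw [al0_110, Grass.copLin_one]
  simp only [k110_even _ _ _ _ (map_one par), ρ_one]

theorem al0_110_a1 (x y z) : al0 X Y Z (i11 X (tens Y Z) Grass.a1 x (i10 Y Z y z))
    = i00 (tens X Y) Z (i11 X Y Grass.a1 x y) z
      + i00 (tens X Y) Z (i11 X Y 1 (X.2.ω x) (Y.2.ω y)) (Z.1.ρ Grass.a1 z) := by
  rw [al0_110, Grass.copLin_a1]
  simp only [map_add, k110_even _ _ _ _ (map_one par), k110_odd _ _ _ _ Grass.par_a1, ρ_one]

theorem al0_110_a2 (x y z) : al0 X Y Z (i11 X (tens Y Z) Grass.a2 x (i10 Y Z y z))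
    = i00 (tens X Y) Z (i11 X Y Grass.a2 x y) z
      + i00 (tens X Y) Z (i11 X Y 1 (X.2.ω x) (Y.2.ω y)) (Z.1.ρ Grass.a2 z) := by
  rw [al0_110, Grass.copLin_a2]
  simp only [map_add, k110_even _ _ _ _ (map_one par), k110_odd _ _ _ _ Grass.par_a2, ρ_one]

theorem al0_110_a3 (x y z) : al0 X Y Z (i11 X (tens Y Z) Grass.a3 x (i10 Y Z y z))
    = i00 (tens X Y) Z (i11 X Y Grass.a3 x y) z
      + i00 (tens X Y) Z (i11 X Y Grass.a1 (X.2.ω x) (Y.2.ω y)) (Z.1.ρ Grass.a2 z)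
      - i00 (tens X Y) Z (i11 X Y Grass.a2 (X.2.ω x) (Y.2.ω y)) (Z.1.ρ Grass.a1 z)
      + i00 (tens X Y) Z (i11 X Y 1 x y) (Z.1.ρ Grass.a1 (Z.1.ρ Grass.a2 z)) := by
  rw [al0_110, Grass.copLin_a3]
  simp only [map_add, map_sub, k110_even _ _ _ _ (map_one par), k110_odd _ _ _ _ Grass.par_a1,
    k110_odd _ _ _ _ Grass.par_a2, k110_even _ _ _ _ Grass.par_a3, ρ_one, ρ_a3]

end Assoc

end SF

end

/-! ### Fourfold products; compatibility of the associator of `SF` with parity and action -/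

section

open SuperAlgebra STensor

namespace SF

section Gen4

variable {X Y Z W : SF}

/-- The generators of the component in `SF₀` of `X * (Y * (Z * W))`. -/
theorem mem_right4_0 (N : Submodule ℂ (tens X (tens Y (tens Z W))).1.carrier)
    (h0000 : ∀ x y z w, i00 X (tens Y (tens Z W)) x (i00 Y (tens Z W) y (i00 Z W z w)) ∈ N)
    (h0011 : ∀ g, Grass.Mono g → ∀ x y z w,
      i00 X (tens Y (tens Z W)) x (i00 Y (tens Z W) y (i11 Z W g z w)) ∈ N)
    (h0101 : ∀ g, Grass.Mono g → ∀ x y z w,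
      i00 X (tens Y (tens Z W)) x (i11 Y (tens Z W) g y (i01 Z W z w)) ∈ N)
    (h0110 : ∀ g, Grass.Mono g → ∀ x y z w,
      i00 X (tens Y (tens Z W)) x (i11 Y (tens Z W) g y (i10 Z W z w)) ∈ N)
    (h1001 : ∀ g, Grass.Mono g → ∀ x y z w,
      i11 X (tens Y (tens Z W)) g x (i01 Y (tens Z W) y (i01 Z W z w)) ∈ N)
    (h1010 : ∀ g, Grass.Mono g → ∀ x y z w,
      i11 X (tens Y (tens Z W)) g x (i01 Y (tens Z W) y (i10 Z W z w)) ∈ N)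
    (h1100 : ∀ g, Grass.Mono g → ∀ x y z w,
      i11 X (tens Y (tens Z W)) g x (i10 Y (tens Z W) y (i00 Z W z w)) ∈ N)
    (h1111 : ∀ g, Grass.Mono g → ∀ h, Grass.Mono h → ∀ x y z w,
      i11 X (tens Y (tens Z W)) g x (i10 Y (tens Z W) y (i11 Z W h z w)) ∈ N) (v) : v ∈ N :=
  mem_tens0 N
    (fun x => mem_right0 (N.comap (i00 _ _ x)) (h0000 x) (fun g hg => h0011 g hg x)
      (fun g hg => h0101 g hg x) (fun g hg => h0110 g hg x))
    (fun g hg x => mem_right1 (N.comap (i11 _ _ g x)) (h1001 g hg x) (h1010 g hg x)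
      (h1100 g hg x) (fun h hh => h1111 g hg h hh x)) v

/-- The generators of the component in `SF₁` of `X * (Y * (Z * W))`. -/
theorem mem_right4_1 (N : Submodule ℂ (tens X (tens Y (tens Z W))).2.carrier)
    (h0001 : ∀ x y z w, i01 X (tens Y (tens Z W)) x (i01 Y (tens Z W) y (i01 Z W z w)) ∈ N)
    (h0010 : ∀ x y z w, i01 X (tens Y (tens Z W)) x (i01 Y (tens Z W) y (i10 Z W z w)) ∈ N)
    (h0100 : ∀ x y z w, i01 X (tens Y (tens Z W)) x (i10 Y (tens Z W) y (i00 Z W z w)) ∈ N)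
    (h0111 : ∀ g, Grass.Mono g → ∀ x y z w,
      i01 X (tens Y (tens Z W)) x (i10 Y (tens Z W) y (i11 Z W g z w)) ∈ N)
    (h1000 : ∀ x y z w, i10 X (tens Y (tens Z W)) x (i00 Y (tens Z W) y (i00 Z W z w)) ∈ N)
    (h1011 : ∀ g, Grass.Mono g → ∀ x y z w,
      i10 X (tens Y (tens Z W)) x (i00 Y (tens Z W) y (i11 Z W g z w)) ∈ N)
    (h1101 : ∀ g, Grass.Mono g → ∀ x y z w,
      i10 X (tens Y (tens Z W)) x (i11 Y (tens Z W) g y (i01 Z W z w)) ∈ N)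
    (h1110 : ∀ g, Grass.Mono g → ∀ x y z w,
      i10 X (tens Y (tens Z W)) x (i11 Y (tens Z W) g y (i10 Z W z w)) ∈ N) (v) : v ∈ N :=
  mem_tens1 N
    (fun x => mem_right1 (N.comap (i01 _ _ x)) (h0001 x) (h0010 x)
      (h0100 x) (fun g hg => h0111 g hg x))
    (fun x => mem_right0 (N.comap (i10 _ _ x)) (h1000 x) (fun g hg => h1011 g hg x)
      (fun g hg => h1101 g hg x) (fun g hg => h1110 g hg x)) v

end Gen4

section Assoc

variable (β : ℂ) (X Y Z : SF)

theorem ev_one : ev (par (A := Grass)).toLinearMap 1 = 1 := ev_of_even (map_one _)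
theorem ev_a1 : ev (par (A := Grass)).toLinearMap Grass.a1 = 0 := ev_of_odd Grass.par_a1
theorem ev_a2 : ev (par (A := Grass)).toLinearMap Grass.a2 = 0 := ev_of_odd Grass.par_a2
theorem ev_a3 : ev (par (A := Grass)).toLinearMap Grass.a3 = Grass.a3 := ev_of_even Grass.par_a3
theorem od_one : od (par (A := Grass)).toLinearMap 1 = 0 := od_of_even (map_one _)
theorem od_a1 : od (par (A := Grass)).toLinearMap Grass.a1 = Grass.a1 := od_of_odd Grass.par_a1
theorem od_a2 : od (par (A := Grass)).toLinearMap Grass.a2 = Grass.a2 := od_of_odd Grass.par_a2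
theorem od_a3 : od (par (A := Grass)).toLinearMap Grass.a3 = 0 := od_of_even Grass.par_a3

variable {X Y Z}

theorem al1_111_one (x y z) : al1 β X Y Z (i10 X (tens Y Z) x (i11 Y Z 1 y z))
    = β ^ 2 • i01 (tens X Y) Z (i11 X Y Grass.a3 x y) z := by
  rw [al1_111, ev_one, od_one, Grass.phi_one]
  simp only [map_smul, map_zero, LinearMap.smul_apply, LinearMap.zero_apply, add_zero]

theorem al1_111_a1 (x y z) : al1 β X Y Z (i10 X (tens Y Z) x (i11 Y Z Grass.a1 y z))
    = β ^ 2 • i01 (tens X Y) Z (i11 X Y Grass.a1 (X.2.ω x) y) z := by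
  rw [al1_111, ev_a1, od_a1, Grass.phi_a1]
  simp only [map_smul, map_zero, LinearMap.smul_apply, LinearMap.zero_apply, zero_add]

theorem al1_111_a2 (x y z) : al1 β X Y Z (i10 X (tens Y Z) x (i11 Y Z Grass.a2 y z))
    = β ^ 2 • i01 (tens X Y) Z (i11 X Y Grass.a2 (X.2.ω x) y) z := by
  rw [al1_111, ev_a2, od_a2, Grass.phi_a2]
  simp only [map_smul, map_zero, LinearMap.smul_apply, LinearMap.zero_apply, zero_add]

theorem al1_111_a3 (x y z) : al1 β X Y Z (i10 X (tens Y Z) x (i11 Y Z Grass.a3 y z))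
    = -(β ^ 2 • i01 (tens X Y) Z (i11 X Y 1 x y) z) := by
  rw [al1_111, ev_a3, od_a3, Grass.phi_a3]
  simp only [map_smul, map_neg, map_zero, LinearMap.smul_apply, LinearMap.neg_apply,
    LinearMap.zero_apply, add_zero]

variable (X Y Z)

theorem al0_ω (v) : al0 X Y Z ((tens X (tens Y Z)).1.ω v) = (tens (tens X Y) Z).1.ω (al0 X Y Z v) := by
  refine mem_right0 (LinearMap.eqLocus (al0 X Y Z ∘ₗ (tens X (tens Y Z)).1.ω)
    ((tens (tens X Y) Z).1.ω ∘ₗ al0 X Y Z)) ?_ ?_ ?_ ?_ v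
  · intro x y z
    simp only [LinearMap.mem_eqLocus, LinearMap.comp_apply, ω_i00, al0_000]
  all_goals
    rintro g (_ | _ | _ | _) x y z <;>
    simp only [LinearMap.mem_eqLocus, LinearMap.comp_apply, ω_i00, ω_i01, ω_i10, ω_i11, al0_011_one,
      al0_011_a1, al0_011_a2, al0_011_a3, al0_101, al0_110_one, al0_110_a1, al0_110_a2, al0_110_a3,
      map_one, map_neg, map_add, map_sub, LinearMap.neg_apply, Grass.par_a1, Grass.par_a2,
      Grass.par_a3, ω_ρ_a1, ω_ρ_a2, map_mul, mul_neg, neg_mul, SVect.ω_ω, neg_neg] <;> try abel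

theorem al1_ω (v) :
    al1 β X Y Z ((tens X (tens Y Z)).2.ω v) = (tens (tens X Y) Z).2.ω (al1 β X Y Z v) := by
  refine mem_right1 (LinearMap.eqLocus (al1 β X Y Z ∘ₗ (tens X (tens Y Z)).2.ω)
    ((tens (tens X Y) Z).2.ω ∘ₗ al1 β X Y Z)) ?_ ?_ ?_ ?_ v
  iterate 3
    intro x y z
    simp only [LinearMap.mem_eqLocus, LinearMap.comp_apply, ω_i00, ω_i01, ω_i10, al1_001, al1_010,
      al1_100, map_add, map_sub, map_neg, ω_ρ_a1, ω_ρ_a2, LinearMap.neg_apply, SVect.ω_ω, neg_neg]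
  rintro g (_ | _ | _ | _) x y z <;>
  simp only [LinearMap.mem_eqLocus, LinearMap.comp_apply, ω_i01, ω_i10, ω_i11,
    al1_111_one, al1_111_a1, al1_111_a2, al1_111_a3, map_one, map_neg, map_smul,
    LinearMap.neg_apply, Grass.par_a1, Grass.par_a2, Grass.par_a3, SVect.ω_ω, smul_neg]

/-- Sectors 011 and 110 contain the usual Hopf algebra isomorphism between the diagonal action on a
tensor product with `G` and the action on `G` alone; this is what the coproduct and, in 011, the
antipode achieve. In sector 101 the operators `g ↦ a_j * par g` commute with left multiplication by
`a₁`: the sign from `par` compensates the anticommutation. -/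
theorem al0_ρ_a1 (v) : al0 X Y Z ((tens X (tens Y Z)).1.ρ Grass.a1 v)
    = (tens (tens X Y) Z).1.ρ Grass.a1 (al0 X Y Z v) := by
  refine mem_right0 (LinearMap.eqLocus (al0 X Y Z ∘ₗ (tens X (tens Y Z)).1.ρ Grass.a1)
    ((tens (tens X Y) Z).1.ρ Grass.a1 ∘ₗ al0 X Y Z)) ?_ ?_ ?_ ?_ v
  · intro x y z
    simp only [LinearMap.mem_eqLocus, LinearMap.comp_apply, ω_i00, al0_000, ρ_a1_i00, map_add,
      LinearMap.add_apply]
    abel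
  all_goals
    rintro g (_ | _ | _ | _) x y z <;>
    simp only [LinearMap.mem_eqLocus, LinearMap.comp_apply, ω_i11, al0_011_one, al0_011_a1,
      al0_011_a2, al0_011_a3, al0_101, al0_110_one, al0_110_a1, al0_110_a2, al0_110_a3, map_one,
      map_neg, map_add, map_sub, map_zero, LinearMap.neg_apply, LinearMap.zero_apply, ρ_a1_i00,
      ρ_i11, Grass.par_a1, Grass.par_a2, Grass.par_a3, ω_ρ_a1, mul_neg, mul_one, mul_zero,
      Grass.a1_a1, Grass.a1_a2, Grass.a1_a3, Grass.a2_a1, Grass.a2_a2, Grass.a2_a3, ρ_a1_a1,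
      ρ_a2_a1, SVect.ω_ω, neg_neg] <;> try abel

theorem al0_ρ_a2 (v) : al0 X Y Z ((tens X (tens Y Z)).1.ρ Grass.a2 v)
    = (tens (tens X Y) Z).1.ρ Grass.a2 (al0 X Y Z v) := by
  refine mem_right0 (LinearMap.eqLocus (al0 X Y Z ∘ₗ (tens X (tens Y Z)).1.ρ Grass.a2)
    ((tens (tens X Y) Z).1.ρ Grass.a2 ∘ₗ al0 X Y Z)) ?_ ?_ ?_ ?_ v
  · intro x y z
    simp only [LinearMap.mem_eqLocus, LinearMap.comp_apply, ω_i00, al0_000, ρ_a2_i00, map_add,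
      LinearMap.add_apply]
    abel
  all_goals
    rintro g (_ | _ | _ | _) x y z <;>
    simp only [LinearMap.mem_eqLocus, LinearMap.comp_apply, ω_i11, al0_011_one, al0_011_a1,
      al0_011_a2, al0_011_a3, al0_101, al0_110_one, al0_110_a1, al0_110_a2, al0_110_a3, map_one,
      map_neg, map_add, map_sub, map_zero, LinearMap.neg_apply, LinearMap.zero_apply, ρ_a2_i00,
      ρ_i11, Grass.par_a1, Grass.par_a2, Grass.par_a3, ω_ρ_a2, mul_neg, mul_one, mul_zero,
      Grass.a1_a1, Grass.a1_a2, Grass.a1_a3, Grass.a2_a1, Grass.a2_a2, Grass.a2_a3, ρ_a2_a2,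
      ρ_a2_a1, SVect.ω_ω, neg_neg] <;> try abel

end Assoc

end SF

end

/-! ### The associator of `SF` as a morphism; naturality and pentagon -/

section

open SuperAlgebra STensor

/-- A linear map which commutes with `a₁` and `a₂` commutes with the Grassmann algebra. -/
theorem Grass.lin_ρ {U V : SRep Grass} (f : U.carrier →ₗ[ℂ] V.carrier)
    (h1 : ∀ x, f (U.ρ Grass.a1 x) = V.ρ Grass.a1 (f x))
    (h2 : ∀ x, f (U.ρ Grass.a2 x) = V.ρ Grass.a2 (f x)) (a : Grass) (x : U.carrier) :
    f (U.ρ a x) = V.ρ a (f x) := by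
  rw [Grass.eq_sum a]
  simp only [map_add, map_smul, LinearMap.add_apply, LinearMap.smul_apply, ρ_one, ρ_a3, h1, h2]

namespace SF

variable (β : ℂ)

/-- The associator `X * (Y * Z) → (X * Y) * Z` as a morphism. -/
def alHom (X Y Z : SF) : tens X (tens Y Z) ⟶ tens (tens X Y) Z :=
  Prod.mkHom ⟨al0 X Y Z, al0_ω X Y Z, Grass.lin_ρ _ (al0_ρ_a1 X Y Z) (al0_ρ_a2 X Y Z)⟩
    ⟨al1 β X Y Z, al1_ω β X Y Z⟩

theorem alHom_0 (X Y Z : SF) (v) : (alHom β X Y Z).1.lin v = al0 X Y Z v := rfl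
theorem alHom_1 (X Y Z : SF) (v) : (alHom β X Y Z).2.lin v = al1 β X Y Z v := rfl
theorem id_0 (X : SF) (v : X.1.carrier) : SRep.Hom.lin (𝟙 X : X ⟶ X).1 v = v := rfl
theorem id_1 (X : SF) (v : X.2.carrier) : SVect.Hom.lin (𝟙 X : X ⟶ X).2 v = v := rfl

section Ext

variable {X Y : SF}

theorem hom_ext {f g : X ⟶ Y} (h0 : ∀ v, f.1.lin v = g.1.lin v) (h1 : ∀ v, f.2.lin v = g.2.lin v) :
    f = g :=
  Prod.ext (SRep.Hom.ext (LinearMap.ext h0)) (SVect.Hom.ext (LinearMap.ext h1))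

theorem comp_0 {Z : SF} (f : X ⟶ Y) (g : Y ⟶ Z) (v : X.1.carrier) :
    (f ≫ g).1.lin v = g.1.lin (f.1.lin v) := rfl
theorem comp_1 {Z : SF} (f : X ⟶ Y) (g : Y ⟶ Z) (v : X.2.carrier) :
    (f ≫ g).2.lin v = g.2.lin (f.2.lin v) := rfl

end Ext

/-- On `X`, `Y`, `Z` the associator acts only through `ρ` and `ω`, with which morphisms commute. -/
theorem alHom_naturality {X X' Y Y' Z Z' : SF} (f : X ⟶ X') (g : Y ⟶ Y') (h : Z ⟶ Z') :
    tensHom f (tensHom g h) ≫ alHom β X' Y' Z' = alHom β X Y Z ≫ tensHom (tensHom f g) h := by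
  refine hom_ext (fun v => ?_) (fun v => ?_)
  · rw [comp_0, comp_0]
    refine mem_right0 (LinearMap.eqLocus ((alHom β X' Y' Z').1.lin ∘ₗ (tensHom f (tensHom g h)).1.lin)
      ((tensHom (tensHom f g) h).1.lin ∘ₗ (alHom β X Y Z).1.lin)) ?_ ?_ ?_ ?_ v
    · intro x y z
      simp only [LinearMap.mem_eqLocus, LinearMap.comp_apply, alHom_0, tensHom_i00, al0_000]
    all_goals
      rintro g (_ | _ | _ | _) x y z <;>
      simp only [LinearMap.mem_eqLocus, LinearMap.comp_apply, alHom_0, tensHom_i00, tensHom_i01,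
        tensHom_i10, tensHom_i11, al0_011_one, al0_011_a1, al0_011_a2, al0_011_a3, al0_101,
        al0_110_one, al0_110_a1, al0_110_a2, al0_110_a3, map_add, map_sub, SRep.Hom.lin_ρ,
        SRep.Hom.lin_ω, SVect.Hom.lin_ω]
  · rw [comp_1, comp_1]
    refine mem_right1 (LinearMap.eqLocus ((alHom β X' Y' Z').2.lin ∘ₗ (tensHom f (tensHom g h)).2.lin)
      ((tensHom (tensHom f g) h).2.lin ∘ₗ (alHom β X Y Z).2.lin)) ?_ ?_ ?_ ?_ v
    iterate 3
      intro x y z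
      simp only [LinearMap.mem_eqLocus, LinearMap.comp_apply, alHom_1, tensHom_i00, tensHom_i01,
        tensHom_i10, al1_001, al1_010, al1_100, map_add, map_sub, SRep.Hom.lin_ρ, SRep.Hom.lin_ω,
        SVect.Hom.lin_ω]
    rintro g (_ | _ | _ | _) x y z <;>
    simp only [LinearMap.mem_eqLocus, LinearMap.comp_apply, alHom_1, tensHom_i01, tensHom_i10,
      tensHom_i11, al1_111_one, al1_111_a1, al1_111_a2, al1_111_a3, map_neg, map_smul,
      SVect.Hom.lin_ω]

/-- This is the form in which the hypothesis on `β` enters the pentagon, namely when `φ` is applied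
twice in sector 1111. -/
theorem sq_smul_sq_smul {β : ℂ} (hβ : β ^ 4 = -1) {M : Type} [AddCommGroup M] [Module ℂ M] (v : M) :
    β ^ 2 • β ^ 2 • v = -v := by
  rw [smul_smul, ← pow_add, hβ, neg_one_smul]

-- In sector 1111 the left side composes the associators of types 110 and 011, made of the coproduct
-- and antipode only, while the right side composes `φ`, `exp(C)` and `φ`. The pentagon thus
-- expresses that `φ` is a kind of Fourier transform with kernel `exp(C)`, normalised by `β ^ 4 =
-- -1`.
set_option maxHeartbeats 1000000 in
theorem al_pentagon0 (hβ : β ^ 4 = -1) (X Y Z W : SF) (v : (tens X (tens Y (tens Z W))).1.carrier) :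
    al0 (tens X Y) Z W (al0 X Y (tens Z W) v)
      = (tensHom (alHom β X Y Z) (𝟙 W)).1.lin (al0 X (tens Y Z) W
          ((tensHom (𝟙 X) (alHom β Y Z W)).1.lin v)) := by
  refine mem_right4_0 (LinearMap.eqLocus (al0 (tens X Y) Z W ∘ₗ al0 X Y (tens Z W))
    ((tensHom (alHom β X Y Z) (𝟙 W)).1.lin ∘ₗ al0 X (tens Y Z) W ∘ₗ
      (tensHom (𝟙 X) (alHom β Y Z W)).1.lin)) ?_ ?_ ?_ ?_ ?_ ?_ ?_ ?_ v
  · intro x y z w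
    simp only [LinearMap.mem_eqLocus, LinearMap.comp_apply, al0_000, tensHom_i00, id_0, alHom_0]
  -- The six sectors with exactly two entries in `SF₁`; the map `φ` does not occur in them.
  iterate 6
    rintro g (_ | _ | _ | _) x y z w <;>
    simp only [LinearMap.mem_eqLocus, LinearMap.comp_apply, ω_i00, ω_i01, ω_i10, al0_000,
      al0_011_one, al0_011_a1, al0_011_a2, al0_011_a3, al0_101, al0_110_one, al0_110_a1, al0_110_a2,
      al0_110_a3, al1_001, al1_010, al1_100, tensHom_i00, tensHom_i11, id_0, id_1, alHom_0, alHom_1,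
      map_one, map_neg, map_add, map_sub, map_zero, LinearMap.neg_apply, LinearMap.sub_apply,
      LinearMap.zero_apply, LinearMap.add_apply, ρ_a1_i00, ρ_a2_i00, Grass.par_a1, Grass.par_a2,
      Grass.par_a3, ω_ρ_a1, ω_ρ_a2, mul_neg, mul_one, mul_zero, Grass.a1_a1, Grass.a1_a2,
      Grass.a1_a3, Grass.a2_a1, Grass.a2_a2, Grass.a2_a3, ρ_a1_a1, ρ_a2_a2, ρ_a2_a1, SVect.ω_ω,
      neg_neg] <;> try abel
  -- Sector 1111 carries two Grassmann slots, which gives sixteen pairs of monomials.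
  · rintro g (_ | _ | _ | _) h (_ | _ | _ | _) x y z w <;>
    simp only [LinearMap.mem_eqLocus, LinearMap.comp_apply, ω_i11, al0_011_one, al0_011_a1,
      al0_011_a2, al0_011_a3, al0_101, al0_110_one, al0_110_a1, al0_110_a2, al0_110_a3, al1_111_one,
      al1_111_a1, al1_111_a2, al1_111_a3, tensHom_i11, id_1, alHom_1, map_one, map_neg, map_add,
      map_sub, map_zero, map_smul, LinearMap.neg_apply, smul_add, smul_sub, smul_neg, smul_zero,
      LinearMap.zero_apply, LinearMap.smul_apply, ρ_i11, Grass.par_a1, Grass.par_a2, Grass.par_a3,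
      mul_neg, mul_one, mul_zero, Grass.a1_a1, Grass.a1_a2, Grass.a1_a3, Grass.a2_a1, Grass.a2_a2,
      Grass.a2_a3, SVect.ω_ω, neg_neg, sq_smul_sq_smul hβ] <;> try abel

/-- With three entries in `SF₁` each side contains `φ` exactly once, and with one entry not at all.
The powers of `β` therefore match for every `β`. -/
theorem al_pentagon1 (X Y Z W : SF) (v : (tens X (tens Y (tens Z W))).2.carrier) :
    al1 β (tens X Y) Z W (al1 β X Y (tens Z W) v)
      = (tensHom (alHom β X Y Z) (𝟙 W)).2.lin (al1 β X (tens Y Z) W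
          ((tensHom (𝟙 X) (alHom β Y Z W)).2.lin v)) := by
  refine mem_right4_1 (LinearMap.eqLocus (al1 β (tens X Y) Z W ∘ₗ al1 β X Y (tens Z W))
    ((tensHom (alHom β X Y Z) (𝟙 W)).2.lin ∘ₗ al1 β X (tens Y Z) W ∘ₗ
      (tensHom (𝟙 X) (alHom β Y Z W)).2.lin)) ?_ ?_ ?_ ?_ ?_ ?_ ?_ ?_ v
  case refine_4 | refine_6 | refine_7 | refine_8 =>
    rintro g (_ | _ | _ | _) x y z w <;>
    simp only [LinearMap.mem_eqLocus, LinearMap.comp_apply, ω_i01, ω_i10, ω_i11, al0_011_one,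
      al0_011_a1, al0_011_a2, al0_011_a3, al0_101, al0_110_one, al0_110_a1, al0_110_a2, al0_110_a3,
      al1_001, al1_010, al1_100, al1_111_one, al1_111_a1, al1_111_a2, al1_111_a3, tensHom_i01,
      tensHom_i10, map_smul, smul_add, smul_sub, smul_neg, smul_zero, LinearMap.smul_apply, id_0,
      id_1, alHom_0, alHom_1, map_one, map_neg, map_add, map_sub, map_zero, LinearMap.neg_apply,
      LinearMap.sub_apply, LinearMap.zero_apply, LinearMap.add_apply, ρ_i11, Grass.par_a1,
      Grass.par_a2, Grass.par_a3, ω_ρ_a1, ω_ρ_a2, mul_neg, mul_one, mul_zero, Grass.a1_a1,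
      Grass.a1_a2, Grass.a1_a3, Grass.a2_a1, Grass.a2_a2, Grass.a2_a3, ρ_a1_a1, ρ_a2_a2, ρ_a2_a1,
      SVect.ω_ω, neg_neg] <;> try abel
  all_goals
    intro x y z w
    simp only [LinearMap.mem_eqLocus, LinearMap.comp_apply, ω_i00, ω_i01, ω_i10, al0_000, al1_001,
      al1_010, al1_100, tensHom_i01, tensHom_i10, id_0, id_1, alHom_0, alHom_1, map_neg, map_add,
      map_sub, map_zero, LinearMap.neg_apply, LinearMap.sub_apply, LinearMap.zero_apply,
      LinearMap.add_apply, ρ_a1_i00, ρ_a2_i00, ω_ρ_a1, ω_ρ_a2, ρ_a1_a1, ρ_a2_a2, ρ_a2_a1, SVect.ω_ω,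
      neg_neg]
    try abel

/-! ### Invertibility of the associator of `SF` -/

section Surjective

variable (X Y Z : SF)

/-- Up to parity involutions, the associator is unitriangular for the Grassmann degree. In sectors
011 and 110 the corrections have lower degree, so generators are recovered from `1` upwards; in
sector 101 they have higher degree, so one starts at `a₁a₂` and descends. -/
theorem al0_surjective : Function.Surjective (al0 X Y Z) := by
  rw [← LinearMap.range_eq_top, Submodule.eq_top_iff']
  have m : ∀ v, al0 X Y Z v ∈ LinearMap.range (al0 X Y Z) := fun v => ⟨v, rfl⟩
  refine mem_left0 _ ?_ ?_ ?_ ?_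
  · intro x y z
    rw [← al0_000]
    exact m _
  · have h0 : ∀ x y z, i11 (tens X Y) Z 1 (i01 X Y x y) z ∈ LinearMap.range (al0 X Y Z) :=
      fun x y z => ⟨_, al0_011_one x y z⟩
    have h1 : ∀ x y z, i11 (tens X Y) Z Grass.a1 (i01 X Y x y) z ∈ LinearMap.range (al0 X Y Z) :=
      fun x y z => by
        -- The braiding past `a₁` applies `ω` to the first entry, so `ω x` is inserted to obtain
        -- `x`; adding the degree zero term removes the correction.
        have h := add_mem (m (i00 X (tens Y Z) (X.1.ω x) (i11 Y Z Grass.a1 y z)))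
          (h0 (X.1.ρ Grass.a1 x) y z)
        rw [al0_011_a1, X.1.ω_ω] at h
        simpa using h
    have h2 : ∀ x y z, i11 (tens X Y) Z Grass.a2 (i01 X Y x y) z ∈ LinearMap.range (al0 X Y Z) :=
      fun x y z => by
        have h := add_mem (m (i00 X (tens Y Z) (X.1.ω x) (i11 Y Z Grass.a2 y z)))
          (h0 (X.1.ρ Grass.a2 x) y z)
        rw [al0_011_a2, X.1.ω_ω] at h
        simpa using h
    rintro g (_ | _ | _ | _) x y z
    · exact h0 x y z
    · exact h1 x y z
    · exact h2 x y z
    · have h := al0_011_a3 x y z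
      have h' : i11 (tens X Y) Z Grass.a3 (i01 X Y x y) z
          = al0 X Y Z (i00 X (tens Y Z) x (i11 Y Z Grass.a3 y z))
            + i11 (tens X Y) Z Grass.a1 (i01 X Y (X.1.ρ Grass.a2 x) y) z
            - i11 (tens X Y) Z Grass.a2 (i01 X Y (X.1.ρ Grass.a1 x) y) z
            - i11 (tens X Y) Z 1 (i01 X Y (X.1.ρ Grass.a1 (X.1.ρ Grass.a2 x)) y) z := by
        rw [h]; abel
      rw [h']
      exact sub_mem (sub_mem (add_mem (m _) (h1 _ _ _)) (h2 _ _ _)) (h0 _ _ _)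
  -- Left multiplication by a generator kills `a₁a₂`, so in top degree there is no correction.
  · have h3 : ∀ x y z, i11 (tens X Y) Z Grass.a3 (i10 X Y x y) z ∈ LinearMap.range (al0 X Y Z) :=
      fun x y z => ⟨i11 X (tens Y Z) Grass.a3 x (i01 Y Z y z), by
        rw [al0_101]
        simp [Grass.par_a3]⟩
    have h1 : ∀ x y z, i11 (tens X Y) Z Grass.a1 (i10 X Y x y) z ∈ LinearMap.range (al0 X Y Z) :=
      fun x y z => by
        have h := al0_101 (X := X) (Y := Y) (Z := Z) Grass.a1 x y z
        simp only [Grass.par_a1, mul_neg, Grass.a1_a1, Grass.a2_a1, Grass.a1_a3, neg_neg, neg_zero,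
          map_zero, LinearMap.zero_apply, sub_zero] at h
        have := sub_mem (m (i11 X (tens Y Z) Grass.a1 x (i01 Y Z y z)))
          (h3 (X.2.ω x) (Y.1.ρ Grass.a1 y) z)
        rw [h] at this
        simpa using this
    have h2 : ∀ x y z, i11 (tens X Y) Z Grass.a2 (i10 X Y x y) z ∈ LinearMap.range (al0 X Y Z) :=
      fun x y z => by
        have h := al0_101 (X := X) (Y := Y) (Z := Z) Grass.a2 x y z
        simp only [Grass.par_a2, mul_neg, Grass.a1_a2, Grass.a2_a2, neg_zero, map_zero,
          LinearMap.zero_apply, sub_zero, add_zero, mul_zero, map_neg, sub_neg_eq_add,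
          LinearMap.neg_apply] at h
        have := sub_mem (m (i11 X (tens Y Z) Grass.a2 x (i01 Y Z y z)))
          (h3 (X.2.ω x) (Y.1.ρ Grass.a2 y) z)
        rw [h] at this
        simpa using this
    rintro g (_ | _ | _ | _) x y z
    · have h := al0_101 (X := X) (Y := Y) (Z := Z) 1 x y z
      simp only [map_one, mul_one, Grass.a1_a2] at h
      have h' : i11 (tens X Y) Z 1 (i10 X Y x y) z
          = al0 X Y Z (i11 X (tens Y Z) 1 x (i01 Y Z y z))
            - i11 (tens X Y) Z Grass.a2 (i10 X Y (X.2.ω x) (Y.1.ρ Grass.a1 y)) z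
            + i11 (tens X Y) Z Grass.a1 (i10 X Y (X.2.ω x) (Y.1.ρ Grass.a2 y)) z
            + i11 (tens X Y) Z Grass.a3 (i10 X Y x (Y.1.ρ Grass.a1 (Y.1.ρ Grass.a2 y))) z := by
        rw [h]; abel
      rw [h']
      exact add_mem (add_mem (sub_mem (m _) (h2 _ _ _)) (h1 _ _ _)) (h3 _ _ _)
    · exact h1 x y z
    · exact h2 x y z
    · exact h3 x y z
  · have h0 : ∀ x y z, i00 (tens X Y) Z (i11 X Y 1 x y) z ∈ LinearMap.range (al0 X Y Z) :=
      fun x y z => ⟨_, al0_110_one x y z⟩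
    have h1 : ∀ x y z, i00 (tens X Y) Z (i11 X Y Grass.a1 x y) z ∈ LinearMap.range (al0 X Y Z) :=
      fun x y z => by
        have h := sub_mem (m (i11 X (tens Y Z) Grass.a1 x (i10 Y Z y z)))
          (h0 (X.2.ω x) (Y.2.ω y) (Z.1.ρ Grass.a1 z))
        rw [al0_110_a1] at h
        simpa using h
    have h2 : ∀ x y z, i00 (tens X Y) Z (i11 X Y Grass.a2 x y) z ∈ LinearMap.range (al0 X Y Z) :=
      fun x y z => by
        have h := sub_mem (m (i11 X (tens Y Z) Grass.a2 x (i10 Y Z y z)))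
          (h0 (X.2.ω x) (Y.2.ω y) (Z.1.ρ Grass.a2 z))
        rw [al0_110_a2] at h
        simpa using h
    rintro g (_ | _ | _ | _) x y z
    · exact h0 x y z
    · exact h1 x y z
    · exact h2 x y z
    · have h := al0_110_a3 x y z
      have h' : i00 (tens X Y) Z (i11 X Y Grass.a3 x y) z
          = al0 X Y Z (i11 X (tens Y Z) Grass.a3 x (i10 Y Z y z))
            - i00 (tens X Y) Z (i11 X Y Grass.a1 (X.2.ω x) (Y.2.ω y)) (Z.1.ρ Grass.a2 z)
            + i00 (tens X Y) Z (i11 X Y Grass.a2 (X.2.ω x) (Y.2.ω y)) (Z.1.ρ Grass.a1 z)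
            - i00 (tens X Y) Z (i11 X Y 1 x y) (Z.1.ρ Grass.a1 (Z.1.ρ Grass.a2 z)) := by
        rw [h]; abel
      rw [h']
      exact sub_mem (add_mem (sub_mem (m _) (h1 _ _ _)) (h2 _ _ _)) (h0 _ _ _)

theorem al1_surjective {β : ℂ} (hβ : β ^ 4 = -1) : Function.Surjective (al1 β X Y Z) := by
  have hβ2 : β ^ 2 ≠ 0 := by
    intro h
    rw [show β ^ 4 = β ^ 2 * β ^ 2 by ring, h] at hβ
    norm_num at hβ
  rw [← LinearMap.range_eq_top, Submodule.eq_top_iff']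
  have m : ∀ v, al1 β X Y Z v ∈ LinearMap.range (al1 β X Y Z) := fun v => ⟨v, rfl⟩
  refine mem_left1 _ ?_ ?_ ?_ ?_
  · intro x y z
    rw [← al1_001]
    exact m _
  · intro x y z
    -- The preimage is obtained by applying `exp(-C⁽¹³⁾)`: the linear terms change sign, the
    -- quadratic one does not.
    refine ⟨i01 X (tens Y Z) x (i10 Y Z y z)
      - i01 X (tens Y Z) (X.1.ρ Grass.a2 (X.1.ω x)) (i10 Y Z (Y.2.ω y) (Z.1.ρ Grass.a1 z))
      + i01 X (tens Y Z) (X.1.ρ Grass.a1 (X.1.ω x)) (i10 Y Z (Y.2.ω y) (Z.1.ρ Grass.a2 z))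
      - i01 X (tens Y Z) (X.1.ρ Grass.a1 (X.1.ρ Grass.a2 x))
          (i10 Y Z y (Z.1.ρ Grass.a1 (Z.1.ρ Grass.a2 z))), ?_⟩
    simp only [map_add, map_sub, al1_010, map_neg, map_zero, LinearMap.neg_apply, ω_ρ_a1, ω_ρ_a2,
      LinearMap.zero_apply, ρ_a1_a1, ρ_a2_a2, ρ_a2_a1, SVect.ω_ω, neg_neg]
    abel
  · intro x y z
    rw [← al1_100 β]
    exact m _
  -- Up to sign and the nonzero scalar `β ^ 2`, the map `φ` exchanges `1` and `a₁a₂` and fixes `a₁`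
  -- and `a₂`.
  · have key : ∀ v, β ^ 2 • v ∈ LinearMap.range (al1 β X Y Z) → v ∈ LinearMap.range (al1 β X Y Z) :=
      fun v hv => ((LinearMap.range (al1 β X Y Z)).smul_mem_iff hβ2).mp hv
    rintro g (_ | _ | _ | _) x y z <;> apply key
    · have h := neg_mem (m (i10 X (tens Y Z) x (i11 Y Z Grass.a3 y z)))
      rwa [al1_111_a3, neg_neg] at h
    · have h := m (i10 X (tens Y Z) (X.2.ω x) (i11 Y Z Grass.a1 y z))
      rwa [al1_111_a1, SVect.ω_ω] at h
    · have h := m (i10 X (tens Y Z) (X.2.ω x) (i11 Y Z Grass.a2 y z))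
      rwa [al1_111_a2, SVect.ω_ω] at h
    · have h := m (i10 X (tens Y Z) x (i11 Y Z 1 y z))
      rwa [al1_111_one] at h

theorem finrank_tens0 : Module.finrank ℂ (tens X Y).1.carrier
    = Module.finrank ℂ X.1.carrier * Module.finrank ℂ Y.1.carrier
      + 4 * (Module.finrank ℂ X.2.carrier * Module.finrank ℂ Y.2.carrier) := by
  have h : Module.finrank ℂ Grass = 4 := QuaternionAlgebra.finrank_eq_four _ _ _
  have h' : Module.finrank ℂ (tens X Y).1.carrier = Module.finrank ℂ
    ((X.1.carrier ⊗[ℂ] Y.1.carrier) × (Grass ⊗[ℂ] (X.2.carrier ⊗[ℂ] Y.2.carrier))) := rfl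
  rw [h', Module.finrank_prod, Module.finrank_tensorProduct, Module.finrank_tensorProduct,
    Module.finrank_tensorProduct, h]

theorem finrank_tens1 : Module.finrank ℂ (tens X Y).2.carrier
    = Module.finrank ℂ X.1.carrier * Module.finrank ℂ Y.2.carrier
      + Module.finrank ℂ X.2.carrier * Module.finrank ℂ Y.1.carrier := by
  have h' : Module.finrank ℂ (tens X Y).2.carrier = Module.finrank ℂ
    ((X.1.carrier ⊗[ℂ] Y.2.carrier) × (X.2.carrier ⊗[ℂ] Y.1.carrier)) := rfl
  rw [h', Module.finrank_prod, Module.finrank_tensorProduct, Module.finrank_tensorProduct]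

/-- Both bracketings have the same dimension, so surjectivity is enough. -/
theorem al0_bijective : Function.Bijective (al0 X Y Z) := by
  refine ⟨(LinearMap.injective_iff_surjective_of_finrank_eq_finrank ?_).mpr (al0_surjective X Y Z),
    al0_surjective X Y Z⟩
  simp only [finrank_tens0, finrank_tens1]
  ring

theorem al1_bijective {β : ℂ} (hβ : β ^ 4 = -1) : Function.Bijective (al1 β X Y Z) := by
  refine ⟨(LinearMap.injective_iff_surjective_of_finrank_eq_finrank ?_).mpr
    (al1_surjective X Y Z hβ), al1_surjective X Y Z hβ⟩
  simp only [finrank_tens0, finrank_tens1]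
  ring

end Surjective

variable {β} (hβ : β ^ 4 = -1)

/-- The associator of `SF`. -/
def alIso (X Y Z : SF) : tens (tens X Y) Z ≅ tens X (tens Y Z) :=
  (Iso.prod
    (SRep.isoOfLin (LinearEquiv.ofBijective (al0 X Y Z) (al0_bijective X Y Z)) (al0_ω X Y Z)
      (alHom β X Y Z).1.lin_ρ)
    (SVect.isoOfLin (LinearEquiv.ofBijective (al1 β X Y Z) (al1_bijective X Y Z hβ))
      (al1_ω β X Y Z))).symm

/-- The associator of a monoidal category structure runs from `(X * Y) * Z` to `X * (Y * Z)`,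
against the direction of `α^{SF}`. The given maps are therefore its inverse, and the axioms are
first proved for `alHom` and then inverted. -/
theorem alIso_inv (X Y Z : SF) : (alIso hβ X Y Z).inv = alHom β X Y Z := rfl

end SF

end

/-! ### Units and the monoidal axioms of `SF` -/

section

open SuperAlgebra STensor

namespace SF

theorem ext_0 {X Y : SF} {M : Type} [AddCommGroup M] [Module ℂ M]
    {f g : (tens X Y).1.carrier →ₗ[ℂ] M} (h00 : ∀ x y, f (i00 X Y x y) = g (i00 X Y x y))
    (h11 : ∀ a x y, f (i11 X Y a x y) = g (i11 X Y a x y)) (v) : f v = g v :=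
  mem_tens0 (LinearMap.eqLocus f g) h00 (fun a _ => h11 a) v

theorem ext_1 {X Y : SF} {M : Type} [AddCommGroup M] [Module ℂ M]
    {f g : (tens X Y).2.carrier →ₗ[ℂ] M} (h01 : ∀ x y, f (i01 X Y x y) = g (i01 X Y x y))
    (h10 : ∀ x y, f (i10 X Y x y) = g (i10 X Y x y)) (v) : f v = g v :=
  mem_tens1 (LinearMap.eqLocus f g) h01 h10 v

theorem tensHom_id (X Y : SF) : tensHom (𝟙 X) (𝟙 Y) = 𝟙 (tens X Y) := by
  refine hom_ext (ext_0 ?_ ?_) (ext_1 ?_ ?_) <;> intros <;>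
  simp only [tensHom_i00, tensHom_i01, tensHom_i10, tensHom_i11, id_0, id_1]

theorem tensHom_comp {X X' X'' Y Y' Y'' : SF} (f : X ⟶ X') (g : Y ⟶ Y') (f' : X' ⟶ X'')
    (g' : Y' ⟶ Y'') : tensHom f g ≫ tensHom f' g' = tensHom (f ≫ f') (g ≫ g') := by
  refine hom_ext (ext_0 ?_ ?_) (ext_1 ?_ ?_) <;> intros <;>
  simp only [tensHom_i00, tensHom_i01, tensHom_i10, tensHom_i11, comp_0, comp_1]

/-- The tensor unit of `SF`, not unfolded by `simp`. -/
def unt : SF := unit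

/-- The scalar given by an element of the tensor unit. -/
def uc (c : unt.1.carrier) : ℂ := c

/-- The left unit isomorphism. -/
def lu (X : SF) : tens unt X ⟶ X := (leftUnitor X).hom

/-- The right unit isomorphism. -/
def ru (X : SF) : tens X unt ⟶ X := (rightUnitor X).hom

variable (X : SF)

theorem lu_i00 (c x) : (lu X).1.lin (i00 unt X c x) = uc c • x := rfl
theorem lu_i11 (a c x) : (lu X).1.lin (i11 unt X a c x) = 0 := map_zero (TensorProduct.lid ℂ _)
theorem lu_i01 (c x) : (lu X).2.lin (i01 unt X c x) = uc c • x := rfl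
theorem lu_i10 (c x) : (lu X).2.lin (i10 unt X c x) = 0 := map_zero (TensorProduct.lid ℂ _)
theorem ru_i00 (c x) : (ru X).1.lin (i00 X unt x c) = uc c • x := rfl
theorem ru_i11 (a c x) : (ru X).1.lin (i11 X unt a x c) = 0 := map_zero (TensorProduct.rid ℂ _)
theorem ru_i01 (c x) : (ru X).2.lin (i01 X unt x c) = 0 := map_zero (TensorProduct.rid ℂ _)
theorem ru_i10 (c x) : (ru X).2.lin (i10 X unt x c) = uc c • x := rfl

theorem unit_1 (c : unt.2.carrier) : c = 0 := rfl
theorem unit_a1 (c : unt.1.carrier) : unt.1.ρ Grass.a1 c = 0 := by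
  change Grass.counit Grass.a1 * uc c = 0
  rw [Grass.counit, Grass.lift_a1, zero_mul]
theorem unit_a2 (c : unt.1.carrier) : unt.1.ρ Grass.a2 c = 0 := by
  change Grass.counit Grass.a2 * uc c = 0
  rw [Grass.counit, Grass.lift_a2, zero_mul]
theorem unit_ω (c : unt.1.carrier) : unt.1.ω c = c := rfl

theorem lu_naturality {X Y : SF} (f : X ⟶ Y) : tensHom (𝟙 unt) f ≫ lu Y = lu X ≫ f := by
  refine hom_ext (fun v => ?_) (fun v => ?_)
  · rw [comp_0, comp_0]
    refine ext_0 (f := (lu Y).1.lin ∘ₗ (tensHom (𝟙 unt) f).1.lin) (g := f.1.lin ∘ₗ (lu X).1.lin)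
      ?_ ?_ v <;> intros <;>
    simp only [LinearMap.comp_apply, tensHom_i00, tensHom_i11, lu_i00, lu_i11, id_0, map_smul,
      map_zero]
  · rw [comp_1, comp_1]
    refine ext_1 (f := (lu Y).2.lin ∘ₗ (tensHom (𝟙 unt) f).2.lin) (g := f.2.lin ∘ₗ (lu X).2.lin)
      ?_ ?_ v <;> intros <;>
    simp only [LinearMap.comp_apply, tensHom_i01, tensHom_i10, lu_i01, lu_i10, id_0, map_smul,
      map_zero]

theorem ru_naturality {X Y : SF} (f : X ⟶ Y) : tensHom f (𝟙 unt) ≫ ru Y = ru X ≫ f := by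
  refine hom_ext (fun v => ?_) (fun v => ?_)
  · rw [comp_0, comp_0]
    refine ext_0 (f := (ru Y).1.lin ∘ₗ (tensHom f (𝟙 unt)).1.lin) (g := f.1.lin ∘ₗ (ru X).1.lin)
      ?_ ?_ v <;> intros <;>
    simp only [LinearMap.comp_apply, tensHom_i00, tensHom_i11, ru_i00, ru_i11, id_0, map_smul,
      map_zero]
  · rw [comp_1, comp_1]
    refine ext_1 (f := (ru Y).2.lin ∘ₗ (tensHom f (𝟙 unt)).2.lin) (g := f.2.lin ∘ₗ (ru X).2.lin)
      ?_ ?_ v <;> intros <;>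
    simp only [LinearMap.comp_apply, tensHom_i01, tensHom_i10, ru_i01, ru_i10, id_0, map_smul,
      map_zero]

/-- The middle entry is the unit: its component in `SF₁` is zero, which empties four of the sectors,
and `a₁`, `a₂` act on it by zero, which kills the corrections in sector 101. -/
theorem al_triangle (β : ℂ) (X Y : SF) :
    alHom β X unt Y ≫ tensHom (ru X) (𝟙 Y) = tensHom (𝟙 X) (lu Y) := by
  refine hom_ext (fun v => ?_) (fun v => ?_)
  · rw [comp_0]
    refine mem_right0 (LinearMap.eqLocus
      ((tensHom (ru X) (𝟙 Y)).1.lin ∘ₗ (alHom β X unt Y).1.lin) (tensHom (𝟙 X) (lu Y)).1.lin)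
      ?_ ?_ ?_ ?_ v
    · intro x y z
      simp only [LinearMap.mem_eqLocus, LinearMap.comp_apply, alHom_0, al0_000, tensHom_i00, ru_i00,
        lu_i00, id_0, map_smul, LinearMap.smul_apply]
    · intro g _ x y z
      simp only [LinearMap.mem_eqLocus, unit_1 y, map_zero, LinearMap.zero_apply]
    · intro g _ x y z
      simp only [LinearMap.mem_eqLocus, LinearMap.comp_apply, alHom_0, al0_101, tensHom_i11, ru_i10,
        lu_i01, id_1, map_smul, LinearMap.smul_apply, unit_a1, unit_a2, map_zero,
        LinearMap.zero_apply, add_zero, sub_zero]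
    · intro g _ x y z
      simp only [LinearMap.mem_eqLocus, unit_1 y, map_zero, LinearMap.zero_apply]
  · rw [comp_1]
    refine mem_right1 (LinearMap.eqLocus
      ((tensHom (ru X) (𝟙 Y)).2.lin ∘ₗ (alHom β X unt Y).2.lin) (tensHom (𝟙 X) (lu Y)).2.lin)
      ?_ ?_ ?_ ?_ v
    · intro x y z
      simp only [LinearMap.mem_eqLocus, LinearMap.comp_apply, alHom_1, al1_001, tensHom_i01, ru_i00,
        lu_i01, id_0, id_1, map_smul, LinearMap.smul_apply]
    · intro x y z
      simp only [LinearMap.mem_eqLocus, unit_1 y, map_zero, LinearMap.zero_apply]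
    · intro x y z
      simp only [LinearMap.mem_eqLocus, LinearMap.comp_apply, alHom_1, al1_100, tensHom_i10, ru_i10,
        lu_i00, id_0, id_1, map_smul, LinearMap.smul_apply]
    · intro g _ x y z
      simp only [LinearMap.mem_eqLocus, unit_1 y, map_zero, LinearMap.zero_apply]

theorem al_pentagon {β : ℂ} (hβ : β ^ 4 = -1) (X Y Z W : SF) :
    alHom β X Y (tens Z W) ≫ alHom β (tens X Y) Z W
      = tensHom (𝟙 X) (alHom β Y Z W) ≫ alHom β X (tens Y Z) W ≫ tensHom (alHom β X Y Z) (𝟙 W) :=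
  hom_ext (al_pentagon0 β hβ X Y Z W) (al_pentagon1 β X Y Z W)

section Iso

variable {β : ℂ} (hβ : β ^ 4 = -1)

theorem alIso_naturality {X X' Y Y' Z Z' : SF} (f : X ⟶ X') (g : Y ⟶ Y') (h : Z ⟶ Z') :
    tensHom (tensHom f g) h ≫ (alIso hβ X' Y' Z').hom
      = (alIso hβ X Y Z).hom ≫ tensHom f (tensHom g h) := by
  rw [← Iso.inv_comp_eq, ← Category.assoc, ← Iso.eq_comp_inv, alIso_inv, alIso_inv,
    alHom_naturality]

theorem alIso_triangle (X Y : SF) :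
    (alIso hβ X unt Y).hom ≫ tensHom (𝟙 X) (lu Y) = tensHom (ru X) (𝟙 Y) := by
  rw [← al_triangle β, ← alIso_inv hβ, Iso.hom_inv_id_assoc]

theorem alIso_pentagon (X Y Z W : SF) :
    tensHom (alIso hβ X Y Z).hom (𝟙 W) ≫ (alIso hβ X (tens Y Z) W).hom ≫
        tensHom (𝟙 X) (alIso hβ Y Z W).hom
      = (alIso hβ (tens X Y) Z W).hom ≫ (alIso hβ X Y (tens Z W)).hom := by
  have h := al_pentagon hβ X Y Z W
  simp only [← alIso_inv hβ] at h
  have h1 : tensHom (alIso hβ X Y Z).inv (𝟙 W) ≫ tensHom (alIso hβ X Y Z).hom (𝟙 W) = 𝟙 _ := by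
    rw [tensHom_comp, Iso.inv_hom_id, Category.comp_id, tensHom_id]
  have h2 : tensHom (𝟙 X) (alIso hβ Y Z W).inv ≫ tensHom (𝟙 X) (alIso hβ Y Z W).hom = 𝟙 _ := by
    rw [tensHom_comp, Iso.inv_hom_id, Category.comp_id, tensHom_id]
  -- Precomposing with the inverse of the right-hand side lets the pentagon for the inverses be
  -- substituted, after which all factors cancel.
  rw [← cancel_epi ((alIso hβ X Y (tens Z W)).inv ≫ (alIso hβ (tens X Y) Z W).inv)]
  rw [h]
  simp only [Category.assoc]
  rw [reassoc_of% h1, Iso.inv_hom_id_assoc, h2, ← reassoc_of% h]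
  simp only [Iso.inv_hom_id_assoc, Iso.inv_hom_id]

end Iso

/-- `SF` is a monoidal category. -/
theorem isMonoidal {β : ℂ} (hβ : β ^ 4 = -1) : IsMonoidal (monStruct (alIso hβ)) :=
  ⟨{ monStruct (alIso hβ) with
      tensorHom_def := fun f g => by
        refine Eq.trans ?_ (tensHom_comp f (𝟙 _) (𝟙 _) g).symm
        rw [Category.comp_id, Category.id_comp]; rfl
      id_tensorHom_id := tensHom_id
      tensorHom_comp_tensorHom := fun f g f' g' => tensHom_comp f g f' g'
      whiskerLeft_id := tensHom_id
      id_whiskerRight := tensHom_id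
      associator_naturality := alIso_naturality hβ
      leftUnitor_naturality := lu_naturality
      rightUnitor_naturality := ru_naturality
      pentagon := alIso_pentagon hβ
      triangle := alIso_triangle hβ }, rfl⟩

end SF

end

section

open SuperAlgebra STensor

/-! ### The module `B` -/

namespace SAlg

theorem xm_b : xm * b = 0 := by rw [b, ← mul_assoc, ← mul_assoc, xm_xm, zero_mul, zero_mul]

theorem e1_b : e1 * b = b := by
  rw [b, ← mul_assoc, ← mul_assoc, ← xm_e1, mul_assoc xm, ← xp_e1, mul_assoc, mul_assoc, e1_e1,
    ← mul_assoc]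

theorem xm_xp_b : xm * (xp * b) = b := by
  rw [← mul_assoc, show xm * xp = e1 - xp * xm by rw [← anti']; abel, sub_mul, mul_assoc,
    xm_b, mul_zero, sub_zero, e1_b]

/-- The element `b` of `B`. -/
def bB : B := Rb 1

/-- The element `x⁺ b` of `B`. -/
def cB : B := Rb xp

theorem bB_coe : (bB : SAlg) = b := one_mul b
theorem cB_coe : (cB : SAlg) = xp * b := rfl

/-- Right multiplication by `b` is the orbit map of the generator of `B`. This allows all of `Δ`
outside sector 00 to be rewritten in terms of actions on vectors. -/
theorem Rb_eq (s : SAlg) : Rb s = BRep.ρ s bB := Subtype.ext (by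
  change s * b = s * (bB : SAlg); rw [bB_coe])

theorem ρ_xp_bB : BRep.ρ xp bB = cB := (Rb_eq xp).symm

theorem ρ_xm_bB : BRep.ρ xm bB = 0 := Subtype.ext (by
  change xm * (bB : SAlg) = 0; rw [bB_coe, xm_b])

theorem ρ_e1_bB : BRep.ρ e1 bB = bB := Subtype.ext (by
  change e1 * (bB : SAlg) = bB; rw [bB_coe, e1_b])

theorem ρ_xp_cB : BRep.ρ xp cB = 0 := Subtype.ext (by
  change xp * (xp * b) = 0; rw [← mul_assoc, xp_xp, zero_mul])

theorem ρ_xm_cB : BRep.ρ xm cB = bB := Subtype.ext (by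
  change xm * (xp * b) = bB; rw [xm_xp_b, bB_coe])

theorem ρ_e1_cB : BRep.ρ e1 cB = cB := Subtype.ext (by
  change e1 * (xp * b) = xp * b; rw [← mul_assoc, ← xp_e1, mul_assoc, e1_b])

theorem ω_bB : BRep.ω bB = bB := Subtype.ext (by
  change par (bB : SAlg) = bB; rw [bB_coe, par_b])

theorem ω_cB : BRep.ω cB = -cB := Subtype.ext (by
  change par (xp * b) = -(xp * b); rw [map_mul, par_b, par_xp, neg_mul])

theorem exists_B (s : B) : ∃ c d : ℂ, s = c • bB + d • cB := by
  obtain ⟨c, d, h⟩ := Submodule.mem_span_pair.mp (B_le s.2)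
  refine ⟨c, d, Subtype.ext ?_⟩
  rw [← h]
  change _ = c • (bB : SAlg) + d • (xp * b)
  rw [bB_coe]

theorem mem_B (N : Submodule ℂ B) (h0 : bB ∈ N) (h1 : cB ∈ N) (s : B) : s ∈ N := by
  obtain ⟨c, d, rfl⟩ := exists_B s
  exact N.add_mem (N.smul_mem _ h0) (N.smul_mem _ h1)

/-- The two-dimensional irreducible representation of `S₁`. -/
def matRep : SAlg →ₐ[ℂ] Matrix (Fin 2) (Fin 2) ℂ :=
  lift !![0, 0; 1, 0] !![0, 1; 0, 0] (-1) (by simp) (by simp)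
    (by ext i j; fin_cases i <;> fin_cases j <;> simp; all_goals norm_num)
    (by ext i j; fin_cases i <;> fin_cases j <;> simp)
    (by ext i j; fin_cases i <;> fin_cases j <;> simp) (by simp)

/-- The coordinates of elements of `B` with respect to `b` and `x⁺ b`. -/
def coordB : B →ₗ[ℂ] ℂ × ℂ where
  toFun s := (matRep s.1 0 0, matRep s.1 1 0)
  map_add' s t := by simp
  map_smul' c s := by simp

theorem matRep_e1 : matRep e1 = 1 := by
  rw [e1, map_smul, map_sub, map_one, matRep, lift_L]
  module

theorem matRep_b : matRep b = !![1, 0; 0, 0] := by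
  rw [b, map_mul, map_mul, matRep_e1, mul_one, matRep, lift_xp, lift_xm]
  ext i j
  fin_cases i <;> fin_cases j <;> simp

theorem coordB_bB : coordB bB = (1, 0) := by
  change (matRep (bB : SAlg) 0 0, matRep (bB : SAlg) 1 0) = _
  rw [bB_coe, matRep_b]; simp

theorem coordB_cB : coordB cB = (0, 1) := by
  change (matRep (xp * b) 0 0, matRep (xp * b) 1 0) = _
  rw [map_mul, matRep_b, matRep, lift_xp]; simp

/-- That `b` and `x⁺b` span `B` follows from the relations. Their independence cannot be read off a
presentation and is detected in `matRep`, where an element of `B` is determined by its first column.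
-/
theorem coordB_bijective : Function.Bijective coordB := by
  constructor
  · rw [← LinearMap.ker_eq_bot, LinearMap.ker_eq_bot']
    intro s hs
    obtain ⟨c, d, rfl⟩ := exists_B s
    rw [map_add, map_smul, map_smul, coordB_bB, coordB_cB] at hs
    simp only [Prod.smul_mk, smul_eq_mul, mul_one, mul_zero, Prod.mk_add_mk, add_zero, zero_add,
      Prod.mk_eq_zero] at hs
    rw [hs.1, hs.2, zero_smul, zero_smul, add_zero]
  · rintro ⟨c, d⟩
    refine ⟨c • bB + d • cB, ?_⟩
    rw [map_add, map_smul, map_smul, coordB_bB, coordB_cB]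
    simp

theorem finrank_B : Module.finrank ℂ B = 2 := by
  rw [(LinearEquiv.ofBijective coordB coordB_bijective).finrank_eq]
  simp

theorem toGrass_xp : toGrass xp = Grass.a1 := lift_xp ..
theorem toGrass_xm : toGrass xm = Grass.a2 := lift_xm ..
theorem toGrass_e1 : toGrass e1 = 0 := by
  rw [e1, map_smul, map_sub, map_one, toGrass, lift_L, sub_self, smul_zero]

/-- Induction on the generators of `S`. -/
theorem gen_induction {p : SAlg → Prop} (hp : p xp) (hm : p xm) (hL : p L)
    (hs : ∀ c : ℂ, p (algebraMap ℂ SAlg c)) (hadd : ∀ s t, p s → p t → p (s + t))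
    (hmul : ∀ s t, p s → p t → p (s * t)) (s : SAlg) : p s := by
  obtain ⟨f, rfl⟩ := mk_surjective s
  induction f using FreeAlgebra.induction with
  | grade0 r => rw [AlgHom.commutes]; exact hs r
  | grade1 g => cases g <;> assumption
  | mul f g hf hg => rw [map_mul]; exact hmul _ _ hf hg
  | add f g hf hg => rw [map_add]; exact hadd _ _ hf hg

/-- A linear map which commutes with the generators commutes with `S`. -/
theorem lin_ρ {U V : SRep SAlg} (f : U.carrier →ₗ[ℂ] V.carrier)
    (hp : ∀ x, f (U.ρ xp x) = V.ρ xp (f x)) (hm : ∀ x, f (U.ρ xm x) = V.ρ xm (f x))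
    (hL : ∀ x, f (U.ρ L x) = V.ρ L (f x)) (a : SAlg) (x : U.carrier) :
    f (U.ρ a x) = V.ρ a (f x) := by
  induction a using gen_induction generalizing x with
  | hp => exact hp x
  | hm => exact hm x
  | hL => exact hL x
  | hs c => rw [AlgHom.commutes, AlgHom.commutes]; exact map_smul f c x
  | hadd s t hs ht => rw [map_add, map_add, LinearMap.add_apply, LinearMap.add_apply, map_add, hs, ht]
  | hmul s t hs ht =>
    rw [map_mul, map_mul, Module.End.mul_apply, Module.End.mul_apply, hs, ht]

end SAlg

open SAlg

/-! ### Pure elements of `D` -/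

section DObj

variable (X : SF)

/-- The elements of sector 0 of `D X`. -/
def dl : X.1.carrier →ₗ[ℂ] (D.obj X).carrier := LinearMap.inl ℂ _ _

/-- The element `s ⊗ x` of `D X`, for `s` in `B` and `x` in sector 1. -/
def dr : B →ₗ[ℂ] X.2.carrier →ₗ[ℂ] (D.obj X).carrier :=
  (TensorProduct.mk ℂ B X.2.carrier).compr₂ (LinearMap.inr ℂ _ _)

variable {X}

theorem mem_D (N : Submodule ℂ (D.obj X).carrier) (hl : ∀ x, dl X x ∈ N)
    (hb : ∀ x, dr X bB x ∈ N) (hc : ∀ x, dr X cB x ∈ N) (v) : v ∈ N := by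
  refine prod_mem' (A := X.1.carrier) (B := B ⊗[ℂ] X.2.carrier) N hl (fun v => ?_) v
  refine tensor_mem (N.comap (LinearMap.inr ℂ X.1.carrier _)) (fun s x => ?_) v
  exact mem_B (N.comap ((dr X).flip x)) (hb x) (hc x) s

variable (X)

theorem ω_dl (x) : (D.obj X).ω (dl X x) = dl X (X.1.ω x) := prodMap_left X.1.ω (map BRep.ω X.2.ω) x
theorem ω_dr (s x) : (D.obj X).ω (dr X s x) = dr X (BRep.ω s) (X.2.ω x) :=
  prodMap_right X.1.ω (map BRep.ω X.2.ω) (s ⊗ₜ x)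
theorem ρ_dl (a x) : (D.obj X).ρ a (dl X x) = dl X (X.1.ρ (toGrass a) x) :=
  prodMap_left (X.1.ρ (toGrass a)) (LinearMap.rTensor X.2.carrier (BRep.ρ a)) x
theorem ρ_dr (a s x) : (D.obj X).ρ a (dr X s x) = dr X (BRep.ρ a s) x :=
  prodMap_right (X.1.ρ (toGrass a)) (LinearMap.rTensor X.2.carrier (BRep.ρ a)) (s ⊗ₜ x)

theorem ρ_xp_dl (x) : (D.obj X).ρ xp (dl X x) = dl X (X.1.ρ Grass.a1 x) := by
  rw [ρ_dl, toGrass_xp]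
theorem ρ_xm_dl (x) : (D.obj X).ρ xm (dl X x) = dl X (X.1.ρ Grass.a2 x) := by
  rw [ρ_dl, toGrass_xm]
theorem ρ_e1_dl (x) : (D.obj X).ρ e1 (dl X x) = 0 := by
  rw [ρ_dl, toGrass_e1, map_zero, LinearMap.zero_apply, map_zero]

variable {X} {Y : SF} (f : X ⟶ Y)

theorem D_map_dl (x) : (D.map f).lin (dl X x) = dl Y (f.1.lin x) :=
  prodMap_left f.1.lin (SRep.tensorSVectMap BRep f.2).lin x
theorem D_map_dr (s x) : (D.map f).lin (dr X s x) = dr Y s (f.2.lin x) :=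
  prodMap_right f.1.lin (SRep.tensorSVectMap BRep f.2).lin (s ⊗ₜ x)

theorem finrank_D : Module.finrank ℂ (D.obj X).carrier
    = Module.finrank ℂ X.1.carrier + 2 * Module.finrank ℂ X.2.carrier := by
  have h : Module.finrank ℂ (D.obj X).carrier
    = Module.finrank ℂ (X.1.carrier × (B ⊗[ℂ] X.2.carrier)) := rfl
  rw [h, Module.finrank_prod, Module.finrank_tensorProduct, finrank_B]

end DObj

/-! ### Pure elements of tensor products of representations of `S` -/

namespace RepS

variable (U V : RepS)

/-- The tensor product of `Rep S`, not unfolded by `simp`. -/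
def tens : RepS := tensor U V

/-- Pure tensors. -/
def tm : U.carrier →ₗ[ℂ] V.carrier →ₗ[ℂ] (tens U V).carrier := TensorProduct.mk ℂ _ _

variable {U V}

theorem mem_tens (N : Submodule ℂ (tens U V).carrier) (h : ∀ u v, tm U V u v ∈ N) (w) : w ∈ N :=
  tensor_mem N h w

variable (u : U.carrier) (v : V.carrier)

theorem ω_tm : (tens U V).ω (tm U V u v) = tm U V (U.ω u) (V.ω v) := rfl

theorem ρ_tm (a : SAlg) : (tens U V).ρ a (tm U V u v) = sact U.ω U.ρ V.ρ (cop a) (u ⊗ₜ v) := rfl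

theorem ρ_e0 : U.ρ e0 u = u - U.ρ e1 u := by
  rw [e0_eq, map_sub, map_one]; rfl

/-- Replacing `e0` by `1 - e1` turns the factor `e₀ - i e₁` of the coproduct into `1 - (1 + i) e₁`,
so that rules for `x^±` and `e1` suffice. The involution on `u` is the sign for moving the odd
second leg past `u`. -/
theorem ρ_xp_tm : (tens U V).ρ xp (tm U V u v) = tm U V (U.ρ xp u) v
      + tm U V (U.ω u) (V.ρ xp v) - (1 + Complex.I) • tm U V (U.ρ e1 (U.ω u)) (V.ρ xp v)
      + Complex.I • tm U V (U.ρ e1 (U.ω u)) (V.ρ e1 (V.ρ xp v - V.ρ xm v)) := by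
  rw [ρ_tm, cop, lift_xp, copX, map_add, map_add, map_smul, LinearMap.add_apply,
    LinearMap.add_apply, LinearMap.smul_apply, sact_even _ _ _ _ (map_one _),
    sact_odd _ _ _ _ par_xp, sact_odd _ _ _ _ par_w, map_mul, map_sub, map_sub, map_smul, map_one,
    LinearMap.sub_apply, LinearMap.smul_apply, ρ_e0]
  change tm U V (U.ρ xp u) v + tm U V _ _ + Complex.I • tm U V (U.ρ e1 (U.ω u))
    (V.ρ e1 (V.ρ xp v - V.ρ xm v)) = _
  simp only [map_sub, map_smul, LinearMap.sub_apply, LinearMap.smul_apply]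
  module

theorem ρ_xm_tm : (tens U V).ρ xm (tm U V u v) = tm U V (U.ρ xm u) v
      + tm U V (U.ω u) (V.ρ xm v) - (1 + Complex.I) • tm U V (U.ρ e1 (U.ω u)) (V.ρ xm v)
      - Complex.I • tm U V (U.ρ e1 (U.ω u)) (V.ρ e1 (V.ρ xp v - V.ρ xm v)) := by
  rw [ρ_tm, cop, lift_xm, copX, map_add, map_add, map_smul, LinearMap.add_apply,
    LinearMap.add_apply, LinearMap.smul_apply, sact_even _ _ _ _ (map_one _),
    sact_odd _ _ _ _ par_xm, sact_odd _ _ _ _ par_w, map_mul, map_sub, map_sub, map_smul, map_one,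
    LinearMap.sub_apply, LinearMap.smul_apply, ρ_e0]
  change tm U V (U.ρ xm u) v + tm U V _ _ + (-Complex.I) • tm U V (U.ρ e1 (U.ω u))
    (V.ρ e1 (V.ρ xp v - V.ρ xm v)) = _
  simp only [map_sub, map_smul, LinearMap.sub_apply, LinearMap.smul_apply]
  module

theorem ρ_L_tm : (tens U V).ρ L (tm U V u v) = tm U V (U.ρ L u) (V.ρ L v) := by
  rw [ρ_tm, cop, lift_L, sact_even _ _ _ _ par_L]
  rfl

theorem ρ_L : U.ρ L u = u - (2 : ℂ) • U.ρ e1 u := by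
  rw [L_eq, map_sub, LinearMap.sub_apply, ρ_e0]
  module

/-- The element `L` is grouplike and `e₁ = (1 - L) / 2`. -/
theorem ρ_e1_tm : (tens U V).ρ e1 (tm U V u v) = tm U V (U.ρ e1 u) v + tm U V u (V.ρ e1 v)
    - (2 : ℂ) • tm U V (U.ρ e1 u) (V.ρ e1 v) := by
  have h : ∀ (W : RepS) (w : W.carrier), W.ρ e1 w = (1 / 2 : ℂ) • (w - W.ρ L w) := fun W w => by
    rw [ρ_L]; module
  rw [h, ρ_L_tm, ρ_L, ρ_L]
  simp only [map_sub, map_smul, LinearMap.sub_apply, LinearMap.smul_apply]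
  module

/-- The tensor product of morphisms, as a morphism between the products `tens`. -/
def tensHom {U' V' : RepS} (f : U ⟶ U') (g : V ⟶ V') : tens U V ⟶ tens U' V' :=
  SRep.tensorMap cop cop_par f g

theorem tensHom_tm {U' V' : RepS} (f : U ⟶ U') (g : V ⟶ V') (u v) :
    (tensHom f g).lin (tm U V u v) = tm U' V' (f.lin u) (g.lin v) := rfl

theorem finrank_tens : Module.finrank ℂ (tens U V).carrier
    = Module.finrank ℂ U.carrier * Module.finrank ℂ V.carrier :=
  Module.finrank_tensorProduct

end RepS

end

section

open SuperAlgebra STensor SAlg RepS SF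

/-! ### The maps `Δ_{X,Y}` on pure elements -/

/-- Shuffling a tensor of `S ⊗ S` past an element and acting is the action of `S ⊗ S`. -/
theorem map_shuffle {X Y : Type} [AddCommGroup X] [Module ℂ X] [AddCommGroup Y] [Module ℂ Y]
    {U V : RepS} {ω : X →ₗ[ℂ] X} {P : SAlg ⊗[ℂ] X →ₗ[ℂ] U.carrier}
    {Q : SAlg ⊗[ℂ] Y →ₗ[ℂ] V.carrier} {p : X → U.carrier} {q : Y → V.carrier}
    (hP : ∀ s x, P (s ⊗ₜ x) = U.ρ s (p x)) (hQ : ∀ s y, Q (s ⊗ₜ y) = V.ρ s (q y))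
    (hp : ∀ x, p (ω x) = U.ω (p x)) (t : STensor SAlg SAlg) (x : X) (y : Y) :
    map P Q (shuffle (par (A := SAlg)).toLinearMap ω (equiv SAlg SAlg t ⊗ₜ (x ⊗ₜ y)))
      = sact U.ω U.ρ V.ρ t (p x ⊗ₜ q y) := by
  induction t using STensor.induction with
  | h_add s t hs ht =>
    rw [map_add, TensorProduct.add_tmul, map_add, map_add, hs, ht, map_add, LinearMap.add_apply]
  | h_even a b hb =>
    rw [sact_even _ _ _ _ hb, pt, LinearEquiv.apply_symm_apply, shuffle_even _ _ _ _ _ _ hb,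
      map_tmul, hP, hQ]
  | h_odd a b hb =>
    rw [sact_odd _ _ _ _ hb, pt, LinearEquiv.apply_symm_apply, shuffle_odd _ _ _ _ _ _ hb,
      map_tmul, hP, hQ, hp]

theorem ω_Rb (s : SAlg) : BRep.ω (Rb s) = Rb (par s) := by
  rw [Rb_eq, BRep.ω_ρ, ω_bB, Rb_eq]

/-- Since `b` is even, right multiplication by `b` preserves parity. The sign of the shuffle,
computed after multiplying by `b`, is therefore the sign with which `S ⊗ S` acts on the vector built
from the two copies of `b`. -/
theorem shuffle_Rb {X Y : SVect} (t : STensor SAlg SAlg) (x : X.carrier) (y : Y.carrier) :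
    shuffle BRep.ω X.ω (map Rb Rb (equiv SAlg SAlg t) ⊗ₜ (x ⊗ₜ y))
      = sact (BRep.tensorSVect X).ω (BRep.tensorSVect X).ρ (BRep.tensorSVect Y).ρ t
        ((bB ⊗ₜ x) ⊗ₜ (bB ⊗ₜ y)) := by
  induction t using STensor.induction with
  | h_add s t hs ht =>
    rw [map_add, map_add, TensorProduct.add_tmul, map_add, hs, ht, map_add, LinearMap.add_apply]
  | h_even a b hb =>
    rw [sact_even _ _ _ _ hb, pt, LinearEquiv.apply_symm_apply, map_tmul,
      shuffle_even _ _ _ _ _ _ (by rw [ω_Rb, hb]), Rb_eq, Rb_eq]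
    rfl
  | h_odd a b hb =>
    rw [sact_odd _ _ _ _ hb, pt, LinearEquiv.apply_symm_apply, map_tmul,
      shuffle_odd _ _ _ _ _ _ (by rw [ω_Rb, hb, map_neg]), Rb_eq, Rb_eq]
    change _ = (BRep.ρ a (BRep.ω bB) ⊗ₜ[ℂ] X.ω x) ⊗ₜ (BRep.ρ b bB ⊗ₜ[ℂ] y)
    rw [ω_bB]

section Sum

variable {A00 A11 A01 A10 B N00 N01 N10 N11 M : Type} [AddCommMonoid A00] [Module ℂ A00]
  [AddCommMonoid A11] [Module ℂ A11] [AddCommMonoid A01] [Module ℂ A01] [AddCommMonoid A10]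
  [Module ℂ A10] [AddCommMonoid B] [Module ℂ B] [AddCommMonoid N00] [Module ℂ N00]
  [AddCommMonoid N01] [Module ℂ N01] [AddCommMonoid N10] [Module ℂ N10] [AddCommMonoid N11]
  [Module ℂ N11] [AddCommMonoid M] [Module ℂ M]
  (k00 : N00 →ₗ[ℂ] M) (k01 : N01 →ₗ[ℂ] M) (k10 : N10 →ₗ[ℂ] M) (k11 : N11 →ₗ[ℂ] M)
  (f00 : A00 →ₗ[ℂ] N00) (f01 : B ⊗[ℂ] A01 →ₗ[ℂ] N01) (f10 : B ⊗[ℂ] A10 →ₗ[ℂ] N10)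
  (f11 : A11 →ₗ[ℂ] N11)

/-- A linear map on `(A₀₀ ⊕ A₁₁) ⊕ B ⊗ (A₀₁ ⊕ A₁₀)` given by its components. -/
def sumMap : (A00 × A11) × (B ⊗[ℂ] (A01 × A10)) →ₗ[ℂ] M :=
  k00 ∘ₗ f00 ∘ₗ LinearMap.fst ℂ _ _ ∘ₗ LinearMap.fst ℂ _ _
    + k01 ∘ₗ f01 ∘ₗ LinearMap.lTensor _ (LinearMap.fst ℂ _ _) ∘ₗ LinearMap.snd ℂ _ _
    + k10 ∘ₗ f10 ∘ₗ LinearMap.lTensor _ (LinearMap.snd ℂ _ _) ∘ₗ LinearMap.snd ℂ _ _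
    + k11 ∘ₗ f11 ∘ₗ LinearMap.snd ℂ _ _ ∘ₗ LinearMap.fst ℂ _ _

theorem sumMap_00 (a) : sumMap k00 k01 k10 k11 f00 f01 f10 f11 ((a, 0), 0) = k00 (f00 a) := by
  simp [sumMap]
theorem sumMap_11 (a) : sumMap k00 k01 k10 k11 f00 f01 f10 f11 ((0, a), 0) = k11 (f11 a) := by
  simp [sumMap]
theorem sumMap_01 (s a) :
    sumMap k00 k01 k10 k11 f00 f01 f10 f11 (0, s ⊗ₜ (a, 0)) = k01 (f01 (s ⊗ₜ a)) := by
  simp [sumMap]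
theorem sumMap_10 (s a) :
    sumMap k00 k01 k10 k11 f00 f01 f10 f11 (0, s ⊗ₜ (0, a)) = k10 (f10 (s ⊗ₜ a)) := by
  simp [sumMap]

end Sum

section Delta

variable (X Y : SF)

/-- The map `Δ_{X,Y}` between the products `tens`. -/
def delta : (D.obj (SF.tens X Y)).carrier →ₗ[ℂ] (RepS.tens (D.obj X) (D.obj Y)).carrier :=
  deltaLin X Y

theorem delta_eq : delta X Y = sumMap (A00 := X.1.carrier ⊗[ℂ] Y.1.carrier)
    (A11 := Grass ⊗[ℂ] (X.2.carrier ⊗[ℂ] Y.2.carrier)) (A01 := X.1.carrier ⊗[ℂ] Y.2.carrier)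
    (A10 := X.2.carrier ⊗[ℂ] Y.1.carrier) (B := B) (N00 := X.1.carrier ⊗[ℂ] Y.1.carrier)
    (N01 := X.1.carrier ⊗[ℂ] (B ⊗[ℂ] Y.2.carrier)) (N10 := (B ⊗[ℂ] X.2.carrier) ⊗[ℂ] Y.1.carrier)
    (N11 := (B ⊗[ℂ] X.2.carrier) ⊗[ℂ] (B ⊗[ℂ] Y.2.carrier))
    (M := (X.1.carrier × (B ⊗[ℂ] X.2.carrier)) ⊗[ℂ] (Y.1.carrier × (B ⊗[ℂ] Y.2.carrier)))
    (map (LinearMap.inl ℂ X.1.carrier (B ⊗[ℂ] X.2.carrier))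
      (LinearMap.inl ℂ Y.1.carrier (B ⊗[ℂ] Y.2.carrier)))
    (map (LinearMap.inl ℂ X.1.carrier (B ⊗[ℂ] X.2.carrier))
      (LinearMap.inr ℂ Y.1.carrier (B ⊗[ℂ] Y.2.carrier)))
    (map (LinearMap.inr ℂ X.1.carrier (B ⊗[ℂ] X.2.carrier))
      (LinearMap.inl ℂ Y.1.carrier (B ⊗[ℂ] Y.2.carrier)))
    (map (LinearMap.inr ℂ X.1.carrier (B ⊗[ℂ] X.2.carrier))
      (LinearMap.inr ℂ Y.1.carrier (B ⊗[ℂ] Y.2.carrier)))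
    (delta00 X Y) (delta01 X Y) (delta10 X Y) (delta11 X Y) := rfl

theorem delta_00 (v : X.1.carrier ⊗[ℂ] Y.1.carrier) :
    @Eq (RepS.tens (D.obj X) (D.obj Y)).carrier
      (delta X Y ((v, 0), 0))
      ((map (LinearMap.inl ℂ X.1.carrier (B ⊗[ℂ] X.2.carrier))
      (LinearMap.inl ℂ Y.1.carrier (B ⊗[ℂ] Y.2.carrier)) :
        _ ⊗[ℂ] _ →ₗ[ℂ] _ ⊗[ℂ] _) (delta00 X Y v)) := by
  rw [delta_eq]; exact sumMap_00 (M := (X.1.carrier × (B ⊗[ℂ] X.2.carrier)) ⊗[ℂ]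
    (Y.1.carrier × (B ⊗[ℂ] Y.2.carrier))) ..

theorem delta_11 (v : Grass ⊗[ℂ] (X.2.carrier ⊗[ℂ] Y.2.carrier)) :
    @Eq (RepS.tens (D.obj X) (D.obj Y)).carrier
      (delta X Y ((0, v), 0))
      ((map (LinearMap.inr ℂ X.1.carrier (B ⊗[ℂ] X.2.carrier))
      (LinearMap.inr ℂ Y.1.carrier (B ⊗[ℂ] Y.2.carrier)) :
        _ ⊗[ℂ] _ →ₗ[ℂ] _ ⊗[ℂ] _) (delta11 X Y v)) := by
  rw [delta_eq]; exact sumMap_11 (M := (X.1.carrier × (B ⊗[ℂ] X.2.carrier)) ⊗[ℂ]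
    (Y.1.carrier × (B ⊗[ℂ] Y.2.carrier))) ..

theorem delta_01 (s : B) (v : X.1.carrier ⊗[ℂ] Y.2.carrier) :
    @Eq (RepS.tens (D.obj X) (D.obj Y)).carrier
      (delta X Y (0, s ⊗ₜ (v, 0)))
      ((map (LinearMap.inl ℂ X.1.carrier (B ⊗[ℂ] X.2.carrier))
      (LinearMap.inr ℂ Y.1.carrier (B ⊗[ℂ] Y.2.carrier)) :
        _ ⊗[ℂ] _ →ₗ[ℂ] _ ⊗[ℂ] _) (delta01 X Y (s ⊗ₜ v))) := by
  rw [delta_eq]; exact sumMap_01 (M := (X.1.carrier × (B ⊗[ℂ] X.2.carrier)) ⊗[ℂ]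
    (Y.1.carrier × (B ⊗[ℂ] Y.2.carrier))) ..

theorem delta_10 (s : B) (v : X.2.carrier ⊗[ℂ] Y.1.carrier) :
    @Eq (RepS.tens (D.obj X) (D.obj Y)).carrier
      (delta X Y (0, s ⊗ₜ (0, v)))
      ((map (LinearMap.inr ℂ X.1.carrier (B ⊗[ℂ] X.2.carrier))
      (LinearMap.inl ℂ Y.1.carrier (B ⊗[ℂ] Y.2.carrier)) :
        _ ⊗[ℂ] _ →ₗ[ℂ] _ ⊗[ℂ] _) (delta10 X Y (s ⊗ₜ v))) := by
  rw [delta_eq]; exact sumMap_10 (M := (X.1.carrier × (B ⊗[ℂ] X.2.carrier)) ⊗[ℂ]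
    (Y.1.carrier × (B ⊗[ℂ] Y.2.carrier))) ..

variable {X Y}

/-- The map `P ⊗ Q` applied to a product of two elements, one for each factor. -/
theorem map_map_tmul {A A' A'' B B' B'' : Type} [AddCommMonoid A] [Module ℂ A] [AddCommMonoid A']
    [Module ℂ A'] [AddCommMonoid A''] [Module ℂ A''] [AddCommMonoid B] [Module ℂ B]
    [AddCommMonoid B'] [Module ℂ B'] [AddCommMonoid B''] [Module ℂ B''] (f : A' →ₗ[ℂ] A'')
    (g : B' →ₗ[ℂ] B'') (f' : A →ₗ[ℂ] A') (g' : B →ₗ[ℂ] B') (t : A ⊗[ℂ] B) :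
    map f g (map f' g' t) = map (f ∘ₗ f') (g ∘ₗ g') t := by
  rw [TensorProduct.map_comp]; rfl

theorem delta00_tmul (x : X.1.carrier) (y : Y.1.carrier) : delta00 X Y (x ⊗ₜ y)
    = x ⊗ₜ y + X.1.ρ (toGrass xm) (X.1.ω x) ⊗ₜ Y.1.ρ (toGrass xp) y := by
  rw [delta00, LinearMap.comp_apply, LinearMap.comp_apply, TensorProduct.mk_apply, del0,
    TensorProduct.add_tmul, map_add, shuffle_even _ _ _ _ _ _ (map_one (par (A := SAlg))),
    shuffle_odd _ _ _ _ _ _ (by exact par_xp), map_add, map_tmul, map_tmul]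
  simp [SRep.actMap]

theorem delta_dl_i00 (x y) : delta X Y (dl _ (i00 X Y x y)) = tm _ _ (dl X x) (dl Y y)
    + tm _ _ (dl X (X.1.ρ Grass.a2 (X.1.ω x))) (dl Y (Y.1.ρ Grass.a1 y)) := by
  refine (delta_00 X Y (x ⊗ₜ y)).trans ?_
  rw [delta00_tmul, map_add, map_tmul, map_tmul, toGrass_xp, toGrass_xm]
  rfl

/-- Right multiplication of the two legs of the coproduct of `s` by `δ₁` and `b` amounts to acting
with `s` on `δ₁x` tensored with `b ⊗ y`. In this form the dependence on `s` is visibly `S`-linear;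
the same is done for sectors 10 and 11. -/
theorem delta_dr_i01 (s x y) : delta X Y (dr _ s (i01 X Y x y))
    = (RepS.tens (D.obj X) (D.obj Y)).ρ s
      (tm _ _ (dl X (x + X.1.ρ Grass.a1 (X.1.ρ Grass.a2 x))) (dr Y bB y)) := by
  refine (delta_01 X Y s (x ⊗ₜ y)).trans ?_
  refine (map_map_tmul _ _ _ _ (shuffle (par (A := SAlg)).toLinearMap _
    (copLin (s : SAlg) ⊗ₜ (x ⊗ₜ y)))).trans ?_
  have hx : x + X.1.ρ Grass.a1 (X.1.ρ Grass.a2 x) = X.1.ρ (toGrass del1) x := by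
    rw [del1, map_add, map_add, map_one, map_one, map_mul, map_mul, toGrass_xp, toGrass_xm]; rfl
  have hd : par del1 = del1 := by
    rw [del1, map_add, map_one, map_mul, par_xp, par_xm, neg_mul_neg]
  rw [hx]
  refine map_shuffle (U := D.obj X) (V := D.obj Y)
    (p := fun x => dl X (X.1.ρ (toGrass del1) x)) (q := fun y => dr Y bB y) ?_ ?_ ?_ (cop s) x y
  · intro s x
    rw [ρ_dl, ← Module.End.mul_apply, ← map_mul, ← map_mul]
    rfl
  · intro s y
    rw [ρ_dr, ← Rb_eq]
    rfl
  · intro x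
    rw [ω_dl, X.1.ω_ρ, ← toGrass_par, hd]

theorem delta_dr_i10 (s x y) : delta X Y (dr _ s (i10 X Y x y))
    = (RepS.tens (D.obj X) (D.obj Y)).ρ s (tm _ _ (dr X bB x) (dl Y y)) := by
  refine (delta_10 X Y s (x ⊗ₜ y)).trans ?_
  refine (map_map_tmul _ _ _ _ (shuffle (par (A := SAlg)).toLinearMap _
    (copLin (s : SAlg) ⊗ₜ (x ⊗ₜ y)))).trans ?_
  refine map_shuffle (U := D.obj X) (V := D.obj Y)
    (p := fun x => dr X bB x) (q := fun y => dl Y y) ?_ ?_ ?_ (cop s) x y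
  · intro s x
    rw [ρ_dr, ← Rb_eq]
    rfl
  · intro s y
    rw [ρ_dl]
    rfl
  · intro x
    rw [ω_dr, ω_bB]

theorem sact_map {U U' V V' : RepS} (f : U.carrier →ₗ[ℂ] U'.carrier)
    (g : V.carrier →ₗ[ℂ] V'.carrier) (hω : ∀ x, f (U.ω x) = U'.ω (f x))
    (hf : ∀ s x, f (U.ρ s x) = U'.ρ s (f x)) (hg : ∀ s x, g (V.ρ s x) = V'.ρ s (g x))
    (t : STensor SAlg SAlg) (x y) :
    map f g (sact U.ω U.ρ V.ρ t (x ⊗ₜ y)) = sact U'.ω U'.ρ V'.ρ t (f x ⊗ₜ g y) := by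
  induction t using STensor.induction with
  | h_add s t hs ht =>
    rw [map_add, map_add, LinearMap.add_apply, LinearMap.add_apply, map_add, hs, ht]
  | h_even a b hb => rw [sact_even _ _ _ _ hb, sact_even _ _ _ _ hb, map_tmul, hf, hg]
  | h_odd a b hb => rw [sact_odd _ _ _ _ hb, sact_odd _ _ _ _ hb, map_tmul, hf, hg, hω]

theorem delta_dl_i11 (g x y) : delta X Y (dl _ (i11 X Y g x y))
    = (RepS.tens (D.obj X) (D.obj Y)).ρ (grassToS g) (tm _ _ (dr X bB x) (dr Y bB y)) := by
  refine (delta_11 X Y (g ⊗ₜ (x ⊗ₜ y))).trans ?_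
  rw [delta11, LinearMap.comp_apply, LinearMap.rTensor_tmul, LinearMap.comp_apply,
    LinearMap.comp_apply]
  refine (congrArg _ (shuffle_Rb (cop (grassToS g)) x y)).trans ?_
  exact sact_map (U := BRep.tensorSVect X.2) (V := BRep.tensorSVect Y.2) (U' := D.obj X)
    (V' := D.obj Y) (LinearMap.inr ℂ _ _) (LinearMap.inr ℂ _ _)
    (fun v => (prodMap_right X.1.ω (map BRep.ω X.2.ω) v).symm)
    (fun s v => (prodMap_right (X.1.ρ (toGrass s)) (LinearMap.rTensor X.2.carrier (BRep.ρ s)) v).symm)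
    (fun s v => (prodMap_right (Y.1.ρ (toGrass s)) (LinearMap.rTensor Y.2.carrier (BRep.ρ s)) v).symm) _ _ _

end Delta

end

/-! ### Explicit values of `Δ` on generators -/

section

open SuperAlgebra STensor SAlg RepS SF

theorem I_smul_I_smul {M : Type} [AddCommGroup M] [Module ℂ M] (v : M) :
    Complex.I • Complex.I • v = -v := by
  rw [smul_smul, Complex.I_mul_I, neg_one_smul]

theorem SAlg.xm_xp_e0 : xm * (xp * e0) = -(xp * (xm * e0)) := by
  rw [← mul_assoc, ← mul_assoc, eq_neg_iff_add_eq_zero, ← add_mul, add_comm, anti', e1_e0]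

theorem SAlg.L_e0 : L * e0 = e0 := by rw [L_eq, sub_mul, e0_e0, e1_e0, sub_zero]

/-- The identification of `G` with `S₀` respects the left action of `S`. Thus in sector 11 the
values of `Δ` on `a₁`, `a₂`, `a₁a₂` follow from the value on `1` by acting with `x^±`. -/
theorem SAlg.grassToS_mul (a : SAlg) (g : Grass) :
    grassToS (toGrass a * g) = a * grassToS g := by
  induction a using gen_induction generalizing g with
  | hp =>
    simp only [toGrass_xp, grassToS, LinearMap.coe_mk, AddHom.coe_mk, Grass.a1, mul_add,
      mul_smul_comm, ← mul_assoc, xp_xp, zero_mul, smul_zero]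
    simp [mul_assoc]
  | hm =>
    have h : xm * xp * e0 = -(xp * xm * e0) := by rw [mul_assoc, mul_assoc, xm_xp_e0]
    have h' : xm * xp * xm * e0 = 0 := by
      rw [mul_assoc, xm_e0, ← mul_assoc, h, neg_mul, mul_assoc, ← xm_e0, ← mul_assoc, mul_assoc xp,
        xm_xm, mul_zero, zero_mul, neg_zero]
    simp only [toGrass_xm, grassToS, LinearMap.coe_mk, AddHom.coe_mk, Grass.a2, mul_add,
      mul_smul_comm, ← mul_assoc, xm_xm, zero_mul, smul_zero, h, h']
    simp
  | hL =>
    have h : toGrass L = 1 := lift_L ..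
    have hL : ∀ x, x * L = L * x → L * (x * e0) = x * e0 := fun x hx => by
      rw [← mul_assoc, ← hx, mul_assoc, L_e0]
    rw [h, one_mul]
    simp only [grassToS, LinearMap.coe_mk, AddHom.coe_mk, mul_add, mul_smul_comm, L_e0,
      hL _ xp_L, hL _ xm_L, hL (xp * xm) (by rw [mul_assoc, xm_L, ← mul_assoc, xp_L, mul_assoc])]
  | hs c =>
    rw [AlgHom.commutes, ← Algebra.smul_def, ← Algebra.smul_def, map_smul]
  | hadd s t hs ht => rw [map_add, add_mul, map_add, hs, ht, add_mul]
  | hmul s t hs ht => rw [map_mul toGrass, mul_assoc, hs, ht, mul_assoc]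

theorem SAlg.grassToS_one : grassToS 1 = e0 := by simp [grassToS]

section Values

variable {X Y : SF}

theorem ρ_e1_dr (s x) : (D.obj X).ρ e1 (dr X s x) = dr X s x := by
  rw [ρ_dr]
  refine mem_B (LinearMap.eqLocus ((dr X).flip x ∘ₗ BRep.ρ e1) ((dr X).flip x)) ?_ ?_ s
  · exact congrArg ((dr X).flip x) ρ_e1_bB
  · exact congrArg ((dr X).flip x) ρ_e1_cB

theorem ρ_xp_db (x) : (D.obj X).ρ xp (dr X bB x) = dr X cB x := by rw [ρ_dr, ρ_xp_bB]
theorem ρ_xm_db (x) : (D.obj X).ρ xm (dr X bB x) = 0 := by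
  rw [ρ_dr, ρ_xm_bB, map_zero, LinearMap.zero_apply]
theorem ρ_xp_dc (x) : (D.obj X).ρ xp (dr X cB x) = 0 := by
  rw [ρ_dr, ρ_xp_cB, map_zero, LinearMap.zero_apply]
theorem ρ_xm_dc (x) : (D.obj X).ρ xm (dr X cB x) = dr X bB x := by rw [ρ_dr, ρ_xm_cB]
theorem ω_db (x) : (D.obj X).ω (dr X bB x) = dr X bB (X.2.ω x) := by rw [ω_dr, ω_bB]
theorem ω_dc (x) : (D.obj X).ω (dr X cB x) = -dr X cB (X.2.ω x) := by
  rw [ω_dr, ω_cB, map_neg, LinearMap.neg_apply]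

theorem ρ_bB {U : RepS} (u : U.carrier) : U.ρ bB u = U.ρ xm (U.ρ xp (U.ρ e1 u)) := by
  rw [bB_coe, b, map_mul, map_mul]; rfl

theorem ρ_cB {U : RepS} (u : U.carrier) : U.ρ cB u = U.ρ xp (U.ρ bB u) := by
  rw [cB_coe, map_mul, bB_coe]; rfl

/-- Acting with `x⁻x⁺` on the first leg produces `-a₁a₂x`, and the summand `x⁺x⁻` of `δ₁` is exactly
what cancels it. -/
theorem delta_db_i01 (x y) : delta X Y (dr _ bB (i01 X Y x y)) = tm _ _ (dl X x) (dr Y bB y)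
    + tm _ _ (dl X (X.1.ρ Grass.a2 (X.1.ω x))) (dr Y cB y) := by
  rw [delta_dr_i01, ρ_bB]
  simp only [ρ_e1_tm, ρ_xp_tm, ρ_xm_tm, ρ_e1_dl, ρ_e1_dr, ρ_xp_dl, ρ_xm_dl, ρ_xp_db, ρ_xp_dc,
    ρ_xm_db, ρ_xm_dc, ω_dl, map_add, map_sub, map_neg, map_zero, map_smul, LinearMap.add_apply,
    LinearMap.neg_apply, LinearMap.zero_apply, ρ_a1_a1, ρ_a2_a2, ρ_a2_a1, ω_ρ_a1, ω_ρ_a2, SVect.ω_ω]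
  module

/-- Since `cB` is `x⁺` applied to `bB`, this is `x⁺` applied to the previous value. -/
theorem delta_dc_i01 (x y) : delta X Y (dr _ cB (i01 X Y x y))
    = tm _ _ (dl X (X.1.ρ Grass.a1 x)) (dr Y bB y) + tm _ _ (dl X (X.1.ω x)) (dr Y cB y)
      + tm _ _ (dl X (X.1.ρ Grass.a1 (X.1.ρ Grass.a2 (X.1.ω x)))) (dr Y cB y) := by
  rw [delta_dr_i01, ρ_cB, ← delta_dr_i01, delta_db_i01]
  simp only [ρ_xp_tm, ρ_e1_dl, ρ_e1_dr, ρ_xp_dl, ρ_xp_db, ρ_xp_dc, ρ_xm_db, ρ_xm_dc, ω_dl, map_add,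
    map_sub, map_neg, map_zero, LinearMap.neg_apply, LinearMap.zero_apply, ω_ρ_a2, SVect.ω_ω]
  module

theorem delta_db_i10 (x y) : delta X Y (dr _ bB (i10 X Y x y)) = tm _ _ (dr X bB x) (dl Y y)
    + tm _ _ (dr X bB x) (dl Y (Y.1.ρ Grass.a1 (Y.1.ρ Grass.a2 y)))
    + Complex.I • tm _ _ (dr X cB (X.2.ω x)) (dl Y (Y.1.ρ Grass.a2 y)) := by
  rw [delta_dr_i10, ρ_bB]
  simp only [ρ_e1_tm, ρ_xp_tm, ρ_xm_tm, ρ_e1_dl, ρ_e1_dr, ρ_xp_dl, ρ_xm_dl, ρ_xp_db, ρ_xm_db,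
    ρ_xm_dc, ω_db, ω_dc, map_add, map_sub, map_neg, map_zero, map_smul, LinearMap.neg_apply,
    LinearMap.zero_apply, ρ_a1_a1, ρ_a2_a1, SVect.ω_ω, add_smul, smul_add, smul_sub, smul_neg,
    I_smul_I_smul]
  module

theorem delta_dc_i10 (x y) : delta X Y (dr _ cB (i10 X Y x y)) = tm _ _ (dr X cB x) (dl Y y)
    - Complex.I • tm _ _ (dr X bB (X.2.ω x)) (dl Y (Y.1.ρ Grass.a1 y)) := by
  rw [delta_dr_i10, ρ_cB, ← delta_dr_i10, delta_db_i10]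
  simp only [ρ_xp_tm, ρ_e1_dl, ρ_e1_dr, ρ_xp_dl, ρ_xm_dl, ρ_xp_db, ρ_xp_dc, ω_db, ω_dc, map_add,
    map_sub, map_neg, map_zero, map_smul, LinearMap.neg_apply, LinearMap.zero_apply, ρ_a1_a1,
    ρ_a2_a2, ρ_a2_a1, SVect.ω_ω, add_smul, smul_add, smul_sub, smul_neg, I_smul_I_smul]
  module

/-- The unit of `G` corresponds to `e0`, and `e1` annihilates a product of two vectors of sector 1,
its three contributions being `1 + 1 - 2`. -/
theorem delta_i11_one (x y) : delta X Y (dl _ (i11 X Y 1 x y))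
    = tm _ _ (dr X bB x) (dr Y bB y) := by
  rw [delta_dl_i11, grassToS_one, ρ_e0]
  simp only [ρ_e1_tm, ρ_e1_dr]
  module

theorem delta_i11_mul (a : SAlg) (g x y) : delta X Y (dl _ (i11 X Y (toGrass a * g) x y))
    = (RepS.tens (D.obj X) (D.obj Y)).ρ a (delta X Y (dl _ (i11 X Y g x y))) := by
  rw [delta_dl_i11, delta_dl_i11, grassToS_mul, map_mul]; rfl

theorem delta_i11_a1 (x y) : delta X Y (dl _ (i11 X Y Grass.a1 x y))
    = tm _ _ (dr X cB x) (dr Y bB y) := by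
  have h := delta_i11_mul xp 1 x y
  rw [toGrass_xp, mul_one, delta_i11_one] at h
  rw [h]
  simp only [ρ_xp_tm, ρ_e1_dr, ρ_xp_db, ρ_xm_db, ω_db, map_sub, map_zero]
  module

theorem delta_i11_a2 (x y) : delta X Y (dl _ (i11 X Y Grass.a2 x y))
    = -Complex.I • tm _ _ (dr X bB (X.2.ω x)) (dr Y cB y) := by
  have h := delta_i11_mul xm 1 x y
  rw [toGrass_xm, mul_one, delta_i11_one] at h
  rw [h]
  simp only [ρ_xm_tm, ρ_e1_dr, ρ_xp_db, ρ_xm_db, ω_db, map_sub, map_zero, LinearMap.zero_apply]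
  module

theorem delta_i11_a3 (x y) : delta X Y (dl _ (i11 X Y Grass.a3 x y))
    = -(Complex.I • tm _ _ (dr X cB (X.2.ω x)) (dr Y cB y)) - tm _ _ (dr X bB x) (dr Y bB y) := by
  have h := delta_i11_mul xp Grass.a2 x y
  rw [toGrass_xp, Grass.a1_a2, delta_i11_a2] at h
  rw [h]
  simp only [ρ_xp_tm, ρ_e1_dr, ρ_xp_db, ρ_xp_dc, ρ_xm_dc, ω_db, map_sub, map_neg, map_zero,
    map_smul, SVect.ω_ω, add_smul, smul_add, smul_sub, I_smul_I_smul, neg_smul]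
  module

end Values

end

/-! ### `Δ` is a natural isomorphism of representations -/

section

open SuperAlgebra STensor SAlg RepS SF

/-- Elements of `D (X * Y)` are sums of pure ones. -/
theorem mem_D_tens {X Y : SF} (N : Submodule ℂ (D.obj (SF.tens X Y)).carrier)
    (h00 : ∀ x y, dl _ (i00 X Y x y) ∈ N)
    (h11 : ∀ g, Grass.Mono g → ∀ x y, dl _ (i11 X Y g x y) ∈ N)
    (hb01 : ∀ x y, dr _ bB (i01 X Y x y) ∈ N) (hb10 : ∀ x y, dr _ bB (i10 X Y x y) ∈ N)
    (hc01 : ∀ x y, dr _ cB (i01 X Y x y) ∈ N) (hc10 : ∀ x y, dr _ cB (i10 X Y x y) ∈ N) (v) :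
    v ∈ N :=
  mem_D N (mem_tens0 (N.comap (dl _)) h00 h11) (mem_tens1 (N.comap (dr _ bB)) hb01 hb10)
    (mem_tens1 (N.comap (dr _ cB)) hc01 hc10) v

/-- Elements of `D X ⊗ V` are sums of pure ones. -/
theorem mem_tm_D {X : SF} {V : RepS} (N : Submodule ℂ (RepS.tens (D.obj X) V).carrier)
    (hl : ∀ x v, tm _ _ (dl X x) v ∈ N) (hb : ∀ x v, tm _ _ (dr X bB x) v ∈ N)
    (hc : ∀ x v, tm _ _ (dr X cB x) v ∈ N) (v) : v ∈ N :=
  mem_tens N (fun u v => mem_D (N.comap ((tm _ _).flip v)) (fun x => hl x v) (fun x => hb x v)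
    (fun x => hc x v) u) v

/-- Elements of `D X ⊗ D Y` are sums of pure ones. -/
theorem mem_tm_DD {X Y : SF} (N : Submodule ℂ (RepS.tens (D.obj X) (D.obj Y)).carrier)
    (h00 : ∀ x y, tm _ _ (dl X x) (dl Y y) ∈ N) (h0b : ∀ x y, tm _ _ (dl X x) (dr Y bB y) ∈ N)
    (h0c : ∀ x y, tm _ _ (dl X x) (dr Y cB y) ∈ N) (hb0 : ∀ x y, tm _ _ (dr X bB x) (dl Y y) ∈ N)
    (hbb : ∀ x y, tm _ _ (dr X bB x) (dr Y bB y) ∈ N)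
    (hbc : ∀ x y, tm _ _ (dr X bB x) (dr Y cB y) ∈ N)
    (hc0 : ∀ x y, tm _ _ (dr X cB x) (dl Y y) ∈ N)
    (hcb : ∀ x y, tm _ _ (dr X cB x) (dr Y bB y) ∈ N)
    (hcc : ∀ x y, tm _ _ (dr X cB x) (dr Y cB y) ∈ N) (v) : v ∈ N :=
  mem_tm_D N (fun x => mem_D (N.comap (tm _ _ _)) (h00 x) (h0b x) (h0c x))
    (fun x => mem_D (N.comap (tm _ _ _)) (hb0 x) (hbb x) (hbc x))
    (fun x => mem_D (N.comap (tm _ _ _)) (hc0 x) (hcb x) (hcc x)) v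

theorem ρ_ρ_B {U : RepS} (a : SAlg) (s : B) (u : U.carrier) :
    U.ρ (BRep.ρ a s : B) u = U.ρ a (U.ρ s u) := by
  rw [← Module.End.mul_apply, ← map_mul]; rfl

section Delta

variable (X Y : SF)

theorem delta_ρ_i11 (a : SAlg) (g x y) : delta X Y ((D.obj _).ρ a (dl _ (i11 X Y g x y)))
    = (RepS.tens (D.obj X) (D.obj Y)).ρ a (delta X Y (dl _ (i11 X Y g x y))) := by
  rw [ρ_dl, ρ_i11, delta_i11_mul]

theorem delta_ρ_i01 (a : SAlg) (s x y) : delta X Y ((D.obj _).ρ a (dr _ s (i01 X Y x y)))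
    = (RepS.tens (D.obj X) (D.obj Y)).ρ a (delta X Y (dr _ s (i01 X Y x y))) := by
  rw [ρ_dr, delta_dr_i01, delta_dr_i01, ρ_ρ_B]

theorem delta_ρ_i10 (a : SAlg) (s x y) : delta X Y ((D.obj _).ρ a (dr _ s (i10 X Y x y)))
    = (RepS.tens (D.obj X) (D.obj Y)).ρ a (delta X Y (dr _ s (i10 X Y x y))) := by
  rw [ρ_dr, delta_dr_i10, delta_dr_i10, ρ_ρ_B]

-- In sectors 01, 10 and 11 `Δ` lets `S` act on a fixed vector, so it commutes with `S` for
-- structural reasons. Only sector 00 has to be examined, and there only for the generators of `S`.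
variable {X Y} in
theorem delta_ρ_of {a : SAlg} (h : ∀ x y, delta X Y ((D.obj _).ρ a (dl _ (i00 X Y x y)))
    = (RepS.tens (D.obj X) (D.obj Y)).ρ a (delta X Y (dl _ (i00 X Y x y)))) (v) :
    delta X Y ((D.obj _).ρ a v) = (RepS.tens (D.obj X) (D.obj Y)).ρ a (delta X Y v) := by
  refine mem_D_tens (LinearMap.eqLocus (delta X Y ∘ₗ (D.obj _).ρ a)
    ((RepS.tens (D.obj X) (D.obj Y)).ρ a ∘ₗ delta X Y)) ?_ ?_ ?_ ?_ ?_ ?_ v <;>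
  simp only [LinearMap.mem_eqLocus, LinearMap.comp_apply]
  · exact h
  · exact fun g _ => delta_ρ_i11 X Y a g
  · exact delta_ρ_i01 X Y a _
  · exact delta_ρ_i10 X Y a _
  · exact delta_ρ_i01 X Y a _
  · exact delta_ρ_i10 X Y a _

theorem delta_ρ (a : SAlg) (v) :
    delta X Y ((D.obj _).ρ a v) = (RepS.tens (D.obj X) (D.obj Y)).ρ a (delta X Y v) := by
  refine SAlg.lin_ρ (U := D.obj (SF.tens X Y)) (V := RepS.tens (D.obj X) (D.obj Y)) (delta X Y)
    (delta_ρ_of fun x y => ?_) (delta_ρ_of fun x y => ?_) (delta_ρ_of fun x y => ?_) a v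
  · rw [ρ_xp_dl, ρ_a1_i00]
    simp only [delta_dl_i00, map_add, ρ_xp_tm, ρ_xp_dl, ρ_e1_dl, ω_dl, map_zero,
      LinearMap.zero_apply, ω_ρ_a1, ω_ρ_a2, map_neg, LinearMap.neg_apply, ρ_a1_a1, ρ_a2_a1,
      SVect.ω_ω]
    module
  · rw [ρ_xm_dl, ρ_a2_i00]
    simp only [delta_dl_i00, map_add, ρ_xm_tm, ρ_xm_dl, ρ_e1_dl, ω_dl, map_zero,
      LinearMap.zero_apply, ω_ρ_a2, map_neg, LinearMap.neg_apply, ρ_a2_a2, ρ_a2_a1, SVect.ω_ω]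
    module
  · rw [RepS.ρ_L, ρ_e1_dl]
    simp only [delta_dl_i00, map_add, RepS.ρ_L, ρ_e1_tm, ρ_e1_dl, map_zero,
      LinearMap.zero_apply, map_sub, map_smul]
    module

theorem delta_ω (v) :
    delta X Y ((D.obj _).ω v) = (RepS.tens (D.obj X) (D.obj Y)).ω (delta X Y v) := by
  refine mem_D_tens (LinearMap.eqLocus (delta X Y ∘ₗ (D.obj _).ω)
    ((RepS.tens (D.obj X) (D.obj Y)).ω ∘ₗ delta X Y)) ?_ ?_ ?_ ?_ ?_ ?_ v
  rotate_left
  · rintro g (_ | _ | _ | _) x y <;>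
    simp only [LinearMap.mem_eqLocus, LinearMap.comp_apply, ω_dl, ω_i11, delta_i11_one,
      delta_i11_a1, delta_i11_a2, delta_i11_a3, ω_tm, ω_db, ω_dc, map_neg, map_sub, map_smul,
      LinearMap.neg_apply, map_one, Grass.par_a1, Grass.par_a2, Grass.par_a3, neg_neg, smul_neg]
  all_goals
    intro x y
    simp only [LinearMap.mem_eqLocus, LinearMap.comp_apply, ω_dl, ω_db, ω_dc, ω_i00, ω_i01, ω_i10,
      delta_dl_i00, delta_db_i01, delta_dc_i01, delta_db_i10, delta_dc_i10, ω_tm, map_neg, map_sub,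
      map_add, map_smul, LinearMap.neg_apply, ω_ρ_a1, ω_ρ_a2, SVect.ω_ω, neg_neg, smul_neg]
    try module

theorem delta_surjective : Function.Surjective (delta X Y) := by
  rw [← LinearMap.range_eq_top, Submodule.eq_top_iff']
  have m : ∀ v, delta X Y v ∈ LinearMap.range (delta X Y) := fun v => ⟨v, rfl⟩
  have hbb : ∀ x y, tm _ _ (dr X bB x) (dr Y bB y) ∈ LinearMap.range (delta X Y) := fun x y =>
    ⟨dl _ (i11 X Y 1 x y), delta_i11_one x y⟩
  have hb0 : ∀ x y, tm _ _ (dr X bB x) (dl Y y) ∈ LinearMap.range (delta X Y) := fun x y => by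
    -- Because `i² = -1`, the single `cB`-term removes both corrections in the value at `bB`: the
    -- one in `cB ⊗ a₂y` and the one in `bB ⊗ a₁a₂y`.
    refine ⟨dr _ bB (i10 X Y x y)
      - Complex.I • dr _ cB (i10 X Y (X.2.ω x) (Y.1.ρ Grass.a2 y)), ?_⟩
    simp only [map_sub, map_smul, delta_db_i10, delta_dc_i10, SVect.ω_ω, smul_sub, I_smul_I_smul]
    module
  refine mem_tm_DD _ ?_ ?_ ?_ ?_ ?_ ?_ ?_ ?_ ?_
  · intro x y
    -- The operator `x⁻ ⊗ x⁺` in `δ₀` squares to zero here, so the inverse of `δ₀` is `1 ⊗ 1 - x⁻ ⊗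
    -- x⁺`.
    refine ⟨dl _ (i00 X Y x y) - dl _ (i00 X Y (X.1.ρ Grass.a2 (X.1.ω x)) (Y.1.ρ Grass.a1 y)), ?_⟩
    simp only [map_sub, delta_dl_i00, ρ_a1_a1, map_zero]
    module
  · intro x y
    -- The value at `cB` on `a₂x` cancels the `cB`-part of the value at `bB`, at the price of a term
    -- `a₁a₂x`, which is subtracted in advance.
    refine ⟨dr _ bB (i01 X Y (x - X.1.ρ Grass.a1 (X.1.ρ Grass.a2 x)) y)
      + dr _ cB (i01 X Y (X.1.ρ Grass.a2 x) y), ?_⟩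
    simp only [map_add, map_sub, LinearMap.sub_apply, delta_db_i01, delta_dc_i01, ω_ρ_a1, ω_ρ_a2,
      map_neg, ρ_a2_a2, ρ_a2_a1, map_zero, neg_zero, LinearMap.zero_apply, LinearMap.neg_apply,
      neg_neg]
    module
  · intro x y
    have h : tm _ _ (dl X x) (dr Y cB y) = delta X Y (dr _ cB (i01 X Y
        (X.1.ω x - X.1.ρ Grass.a1 (X.1.ρ Grass.a2 (X.1.ω x))) y)
        - dr _ bB (i01 X Y (X.1.ρ Grass.a1 (X.1.ω x)) y)
        - dr _ cB (i01 X Y (X.1.ρ Grass.a2 (X.1.ρ Grass.a1 (X.1.ω x))) y)) := by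
      simp only [map_sub, LinearMap.sub_apply, delta_db_i01, delta_dc_i01, ω_ρ_a1, ω_ρ_a2, map_neg,
        ρ_a1_a1, ρ_a2_a2, ρ_a2_a1, map_zero, neg_zero, LinearMap.zero_apply, LinearMap.neg_apply,
        neg_neg, SVect.ω_ω]
      module
    rw [h]
    exact m _
  · exact hb0
  · exact hbb
  · intro x y
    refine ⟨Complex.I • dl _ (i11 X Y Grass.a2 (X.2.ω x) y), ?_⟩
    rw [map_smul, delta_i11_a2, SVect.ω_ω, neg_smul, smul_neg, I_smul_I_smul, neg_neg]
  · intro x y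
    have h := add_mem (m (dr _ cB (i10 X Y x y)))
      (Submodule.smul_mem _ Complex.I (hb0 (X.2.ω x) (Y.1.ρ Grass.a1 y)))
    rwa [delta_dc_i10, sub_add_cancel] at h
  · intro x y
    exact ⟨dl _ (i11 X Y Grass.a1 x y), delta_i11_a1 x y⟩
  · intro x y
    -- Adding the image of `1` removes the `bB ⊗ bB` part of the image of `a₁a₂`.
    refine ⟨Complex.I • (dl _ (i11 X Y Grass.a3 (X.2.ω x) y) + dl _ (i11 X Y 1 (X.2.ω x) y)), ?_⟩
    rw [map_smul, map_add, delta_i11_a3, delta_i11_one, SVect.ω_ω, sub_add_cancel, smul_neg,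
      I_smul_I_smul, neg_neg]

/-- Surjectivity suffices by the dimension count `(m₀n₀ + 4m₁n₁) + 2(m₀n₁ + m₁n₀) = (m₀ + 2m₁)(n₀ +
2n₁)`, where `m` and `n` are the dimensions of the components of `X` and `Y`. -/
theorem delta_bijective : Function.Bijective (delta X Y) := by
  refine ⟨(LinearMap.injective_iff_surjective_of_finrank_eq_finrank ?_).mpr
    (delta_surjective X Y), delta_surjective X Y⟩
  rw [finrank_D, RepS.finrank_tens, finrank_D, finrank_D, SF.finrank_tens0, SF.finrank_tens1]
  ring

/-- The isomorphisms `Δ_{X,Y}`. -/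
def deltaIso : D.obj (SF.tens X Y) ≅ RepS.tens (D.obj X) (D.obj Y) :=
  SRep.isoOfLin (LinearEquiv.ofBijective (delta X Y) (delta_bijective X Y)) (delta_ω X Y)
    (delta_ρ X Y)

theorem deltaIso_hom_lin : (deltaIso X Y).hom.lin = delta X Y := rfl

variable {X Y}

/-- The values of `Δ` on generators involve `X` and `Y` only through `ρ` and `ω`, with which
morphisms commute. -/
theorem delta_naturality {X' Y' : SF} (f : X ⟶ X') (g : Y ⟶ Y') (v) :
    delta X' Y' ((D.map (SF.tensHom f g)).lin v)
      = (RepS.tensHom (D.map f) (D.map g)).lin (delta X Y v) := by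
  refine mem_D_tens (LinearMap.eqLocus (delta X' Y' ∘ₗ (D.map (SF.tensHom f g)).lin)
    ((RepS.tensHom (D.map f) (D.map g)).lin ∘ₗ delta X Y)) ?_ ?_ ?_ ?_ ?_ ?_ v
  rotate_left
  · rintro g (_ | _ | _ | _) x y <;>
    simp only [LinearMap.mem_eqLocus, LinearMap.comp_apply, D_map_dl, D_map_dr, tensHom_i11,
      delta_i11_one, delta_i11_a1, delta_i11_a2, delta_i11_a3, tensHom_tm, SVect.Hom.lin_ω,
      map_neg, map_sub, map_smul]
  all_goals
    intro x y
    simp only [LinearMap.mem_eqLocus, LinearMap.comp_apply, D_map_dl, D_map_dr, tensHom_i00,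
      tensHom_i01, tensHom_i10, delta_dl_i00, delta_db_i01, delta_dc_i01, delta_db_i10,
      delta_dc_i10, tensHom_tm, SVect.Hom.lin_ω, SRep.Hom.lin_ω, SRep.Hom.lin_ρ, map_sub, map_add,
      map_smul]

end Delta

end

section

open SuperAlgebra STensor SAlg RepS SF

/-! ### The action of `S ⊗ S ⊗ S` -/

namespace RepS

section As

variable (t : SAlg.S3) (U V W : RepS)

/-- The action of `t` as a map `U ⊗ (V ⊗ W) → (U ⊗ V) ⊗ W`. -/
def as : (tens U (tens V W)).carrier →ₗ[ℂ] (tens (tens U V) W).carrier := assocBy t U V W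

/-- The map `id ⊗ f`. -/
def lT {V V' : RepS} (f : V.carrier →ₗ[ℂ] V'.carrier) :
    (tens U V).carrier →ₗ[ℂ] (tens U V').carrier := LinearMap.lTensor U.carrier f

/-- The map `f ⊗ id`. -/
def rT {U U' : RepS} (f : U.carrier →ₗ[ℂ] U'.carrier) (V : RepS) :
    (tens U V).carrier →ₗ[ℂ] (tens U' V).carrier := LinearMap.rTensor V.carrier f

theorem lT_tm {V V' : RepS} (f : V.carrier →ₗ[ℂ] V'.carrier) (u v) :
    lT U f (tm U V u v) = tm U V' u (f v) := rfl

theorem rT_tm {U U' : RepS} (f : U.carrier →ₗ[ℂ] U'.carrier) (V : RepS) (u v) :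
    rT f V (tm U V u v) = tm U' V (f u) v := rfl

variable {U V W}

theorem as_def (u v w) : as t U V W (tm _ _ u (tm _ _ v w))
    = ((U.ext V).ext W).ρ t ((u ⊗ₜ v) ⊗ₜ w) := rfl

theorem as_add (s t : SAlg.S3) : as (s + t) U V W = as s U V W + as t U V W := by
  rw [as, assocBy, map_add]; rfl

theorem as_sub (s t : SAlg.S3) : as (s - t) U V W = as s U V W - as t U V W := by
  rw [as, assocBy, map_sub]; rfl

theorem as_smul (c : ℂ) (t : SAlg.S3) : as (c • t) U V W = c • as t U V W := by
  rw [as, assocBy, map_smul]; rfl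

theorem as_one (u v w) : as 1 U V W (tm _ _ u (tm _ _ v w)) = tm _ _ (tm _ _ u v) w := by
  rw [as_def, map_one]; rfl

/-- Moving `y` past `u`, and `z` past `u` and `v`, gives the sign `(-1)^{|y||u| + |z|(|u| + |v|)}`.
It depends on `y` and `z` only through their parities, so in each of the four cases it is expressed
by involutions on `u` and `v`; if both are odd, the two signs on `u` cancel. -/
theorem as_ee (x : SAlg) {y z : SAlg} (hy : par y = y) (hz : par z = z) (u v w) :
    as (t3 x y z) U V W (tm _ _ u (tm _ _ v w))
      = tm _ _ (tm _ _ (U.ρ x u) (V.ρ y v)) (W.ρ z w) := by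
  refine (sact_even _ _ _ _ hz _ _).trans ?_
  exact congrArg (fun a => a ⊗ₜ[ℂ] W.ρ z w) (sact_even U.ω U.ρ V.ρ _ hy u v)

theorem as_oe (x : SAlg) {y z : SAlg} (hy : par y = -y) (hz : par z = z) (u v w) :
    as (t3 x y z) U V W (tm _ _ u (tm _ _ v w))
      = tm _ _ (tm _ _ (U.ρ x (U.ω u)) (V.ρ y v)) (W.ρ z w) := by
  refine (sact_even _ _ _ _ hz _ _).trans ?_
  exact congrArg (fun a => a ⊗ₜ[ℂ] W.ρ z w) (sact_odd U.ω U.ρ V.ρ _ hy u v)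

theorem as_eo (x : SAlg) {y z : SAlg} (hy : par y = y) (hz : par z = -z) (u v w) :
    as (t3 x y z) U V W (tm _ _ u (tm _ _ v w))
      = tm _ _ (tm _ _ (U.ρ x (U.ω u)) (V.ρ y (V.ω v))) (W.ρ z w) := by
  refine (sact_odd _ _ _ _ hz _ _).trans ?_
  exact congrArg (fun a => a ⊗ₜ[ℂ] W.ρ z w) (sact_even U.ω U.ρ V.ρ _ hy (U.ω u) (V.ω v))

theorem as_oo (x : SAlg) {y z : SAlg} (hy : par y = -y) (hz : par z = -z) (u v w) :
    as (t3 x y z) U V W (tm _ _ u (tm _ _ v w))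
      = tm _ _ (tm _ _ (U.ρ x u) (V.ρ y (V.ω v))) (W.ρ z w) := by
  refine (sact_odd _ _ _ _ hz _ _).trans ?_
  refine (congrArg (fun a => a ⊗ₜ[ℂ] W.ρ z w) (sact_odd U.ω U.ρ V.ρ _ hy (U.ω u) (V.ω v))).trans ?_
  rw [U.ω_ω]; rfl

theorem par_e (a : Fin 2) : par (e a) = e a := by
  fin_cases a
  · exact par_e0
  · exact par_e1

theorem as_mul_e (t : SAlg.S3) (a b c : Fin 2) (u v w) :
    as (t * t3 (e a) (e b) (e c)) U V W (tm _ _ u (tm _ _ v w))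
      = as t U V W (tm _ _ (U.ρ (e a) u) (tm _ _ (V.ρ (e b) v) (W.ρ (e c) w))) := by
  have h := as_ee (U := U) (V := V) (W := W) (e a) (par_e b) (par_e c) u v w
  rw [as_def] at h ⊢
  rw [map_mul, Module.End.mul_apply, h]
  rfl

end As

end RepS

open RepS

/-! ### The action of `Λ` on pure elements of `D` -/

section Lam

theorem ρ_e0_dl (X : SF) (x) : (D.obj X).ρ (e 0) (dl X x) = dl X x := by
  rw [show e 0 = e0 from rfl, ρ_e0, ρ_e1_dl, sub_zero]
theorem ρ_e1_dl' (X : SF) (x) : (D.obj X).ρ (e 1) (dl X x) = 0 := ρ_e1_dl X x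
theorem ρ_e0_dr (X : SF) (s x) : (D.obj X).ρ (e 0) (dr X s x) = 0 := by
  rw [show e 0 = e0 from rfl, ρ_e0, ρ_e1_dr, sub_self]
theorem ρ_e1_dr' (X : SF) (s x) : (D.obj X).ρ (e 1) (dr X s x) = dr X s x := ρ_e1_dr s x

variable {U V W : RepS} (β : ℂ)

/-- An element of `U` on which `e_a` acts as the identity. -/
def Pure (U : RepS) (a : Fin 2) (u : U.carrier) : Prop :=
  ∀ b, U.ρ (e b) u = if b = a then u else 0

theorem pure_dl (X : SF) (x) : Pure (D.obj X) 0 (dl X x) := by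
  intro b; fin_cases b
  · exact ρ_e0_dl X x
  · exact ρ_e1_dl X x
theorem pure_dr (X : SF) (s x) : Pure (D.obj X) 1 (dr X s x) := by
  intro b; fin_cases b
  · exact ρ_e0_dr X s x
  · exact ρ_e1_dr s x

theorem as_LamSector {a b c : Fin 2} {u v w} (hu : Pure U a u) (hv : Pure V b v) (hw : Pure W c w) :
    as (LamSector β a b c) U V W (tm _ _ u (tm _ _ v w))
      = as (LamCoef β a b c) U V W (tm _ _ u (tm _ _ v w)) := by
  rw [LamSector, as_mul_e, hu, hv, hw, if_pos rfl, if_pos rfl, if_pos rfl]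

theorem as_LamSector_ne {a b c a' b' c' : Fin 2} {u v w} (hu : Pure U a u) (hv : Pure V b v)
    (hw : Pure W c w) (h : ¬(a' = a ∧ b' = b ∧ c' = c)) :
    as (LamSector β a' b' c') U V W (tm _ _ u (tm _ _ v w)) = 0 := by
  rw [LamSector, as_mul_e, hu, hv, hw]
  by_cases ha : a' = a
  · by_cases hb : b' = b
    · have hc : c' ≠ c := fun hc => h ⟨ha, hb, hc⟩
      rw [if_neg hc, map_zero, map_zero, map_zero]
    · rw [if_neg hb, map_zero, LinearMap.zero_apply, map_zero, map_zero]
  · rw [if_neg ha, map_zero, LinearMap.zero_apply, map_zero]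

/-- The idempotents in the other seven components annihilate one of the three vectors, and those in
the component `abc` act as the identity. -/
theorem as_Lam {a b c : Fin 2} {u v w} (hu : Pure U a u) (hv : Pure V b v) (hw : Pure W c w) :
    as (Lam β) U V W (tm _ _ u (tm _ _ v w))
      = as (LamCoef β a b c) U V W (tm _ _ u (tm _ _ v w)) := by
  have h : as (Lam β) U V W (tm _ _ u (tm _ _ v w))
      = ∑ a', ∑ b', ∑ c', as (LamSector β a' b' c') U V W (tm _ _ u (tm _ _ v w)) := by
    simp only [Lam, Fin.sum_univ_two, as_add, LinearMap.add_apply]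
  rw [h, Finset.sum_eq_single a, Finset.sum_eq_single b, Finset.sum_eq_single c,
    as_LamSector β hu hv hw]
  · exact fun c' _ hc => as_LamSector_ne β hu hv hw fun h => hc h.2.2
  · simp
  · exact fun b' _ hb => Finset.sum_eq_zero fun c' _ =>
      as_LamSector_ne β hu hv hw fun h => hb h.2.1
  · simp
  · exact fun a' _ ha => Finset.sum_eq_zero fun b' _ => Finset.sum_eq_zero fun c' _ =>
      as_LamSector_ne β hu hv hw fun h => ha h.1
  · simp

end Lam

end

/-! ### The action of the coefficients `Λ^{abc}` -/

section

open SuperAlgebra STensor SAlg RepS SF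

theorem I_pow_three : Complex.I ^ 3 = -Complex.I := by
  rw [pow_succ, Complex.I_sq, neg_one_mul]

section LamCoef

variable {U V W : RepS} (β : ℂ)

theorem par_xp_xm : par (xp * xm) = xp * xm := by rw [map_mul, par_xp, par_xm, neg_mul_neg]

theorem as_LamCoef_110 (u v w) : as (LamCoef β 1 1 0) U V W (tm _ _ u (tm _ _ v w))
    = tm _ _ (tm _ _ u v) w
      - Complex.I • tm _ _ (tm _ _ u (V.ρ (xp + xm) (V.ω v))) (W.ρ (xp + xm) w) := by
  have h : par (xp + xm) = -(xp + xm) := by rw [map_add, par_xp, par_xm, neg_add]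
  rw [LamCoef, as_sub, as_smul, LinearMap.sub_apply, LinearMap.smul_apply,
    as_ee _ (map_one _) (map_one _), as_oo _ h h]
  simp only [map_one, Module.End.one_apply]

theorem as_LamCoef_101 (u v w) : as (LamCoef β 1 0 1) U V W (tm _ _ u (tm _ _ v w))
    = tm _ _ (tm _ _ u v) w
      + Complex.I • tm _ _ (tm _ _ u (V.ρ (xp + Complex.I • xm) (V.ω v)))
          (W.ρ (xp + Complex.I • xm) w)
      + (1 - Complex.I) • tm _ _ (tm _ _ (U.ρ (xp - xm) (U.ω u)) (V.ρ xp (V.ρ xm (V.ω v))))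
          (W.ρ (Complex.I • xp - xm) w)
      + (1 + Complex.I) • tm _ _ (tm _ _ (U.ρ xm (U.ω u)) (V.ρ xp v)) w
      - (1 - Complex.I) • tm _ _ (tm _ _ (U.ρ xp (U.ω u)) (V.ρ xm v)) w
      + (1 + Complex.I) • tm _ _ (tm _ _ u (V.ρ xp (V.ρ xm v))) w
      - (2 : ℂ) • tm _ _ (tm _ _ (U.ρ xp (U.ρ xm u)) (V.ρ xp (V.ρ xm v))) w := by
  have h : par (xp + Complex.I • xm) = -(xp + Complex.I • xm) := by
    rw [map_add, map_smul, par_xp, par_xm, neg_add, smul_neg]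
  have h' : par (Complex.I • xp - xm) = -(Complex.I • xp - xm) := by
    rw [map_sub, map_smul, par_xp, par_xm, smul_neg]; abel
  rw [LamCoef]
  simp only [as_sub, as_add, as_smul, LinearMap.sub_apply, LinearMap.add_apply,
    LinearMap.smul_apply]
  rw [as_ee _ (map_one _) (map_one _), as_oo _ h h, as_eo _ par_xp_xm h',
    as_oe _ par_xp (map_one _), as_oe _ par_xm (map_one _), as_ee _ par_xp_xm (map_one _),
    as_ee _ par_xp_xm (map_one _)]
  simp only [map_one, Module.End.one_apply, map_mul, Module.End.mul_apply]

theorem as_LamCoef_010 (u v w) : as (LamCoef β 0 1 0) U V W (tm _ _ u (tm _ _ v w)) =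
    tm _ _ (tm _ _ u v) w
      + (1 + Complex.I) • tm _ _ (tm _ _ (U.ρ xm (U.ω u)) (V.ω v)) (W.ρ xp w)
      - (1 - Complex.I) • tm _ _ (tm _ _ (U.ρ xp (U.ω u)) (V.ω v)) (W.ρ xm w)
      - (2 : ℂ) • tm _ _ (tm _ _ (U.ρ xp (U.ρ xm u)) v) (W.ρ xp (W.ρ xm w)) := by
  simp only [LamCoef, as_add, as_sub, as_smul, LinearMap.add_apply, LinearMap.sub_apply,
    LinearMap.smul_apply, as_ee, as_eo, par_xp, par_xm, par_xp_xm, map_one]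
  simp only [map_mul, Module.End.one_apply, Module.End.mul_apply]

theorem as_LamCoef_111 (u v w) : as (LamCoef β 1 1 1) U V W (tm _ _ u (tm _ _ v w)) =
    β ^ 2 • ((Complex.I - 1) • tm _ _ (tm _ _ u v) w
      + (1 - Complex.I) • tm _ _ (tm _ _ u v) (W.ρ xp (W.ρ xm w))
      + (1 + 2 * Complex.I) • tm _ _ (tm _ _ u (V.ρ xm (V.ω v))) (W.ρ xm w)
      + tm _ _ (tm _ _ u (V.ρ xm (V.ω v))) (W.ρ xp w)
      + tm _ _ (tm _ _ u (V.ρ xp (V.ω v))) (W.ρ xm w)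
      + tm _ _ (tm _ _ u (V.ρ xp (V.ω v))) (W.ρ xp w)
      + (1 - Complex.I) • tm _ _ (tm _ _ u (V.ρ xp (V.ρ xm v))) w
      - (2 - 2 * Complex.I) • tm _ _ (tm _ _ u (V.ρ xp (V.ρ xm v))) (W.ρ xp (W.ρ xm w))
      - (1 - Complex.I) • tm _ _ (tm _ _ (U.ρ xm (U.ω u)) (V.ω v)) (W.ρ xm w)
      + (1 + Complex.I) • tm _ _ (tm _ _ (U.ρ xm (U.ω u)) (V.ω v)) (W.ρ xp w)
      - (1 - Complex.I) • tm _ _ (tm _ _ (U.ρ xm (U.ω u)) (V.ρ xm v)) (W.ρ xp (W.ρ xm w))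
      + (1 + Complex.I) • tm _ _ (tm _ _ (U.ρ xm (U.ω u)) (V.ρ xp v)) (W.ρ xp (W.ρ xm w))
      + (1 - Complex.I) • tm _ _ (tm _ _ (U.ρ xm (U.ω u)) (V.ρ xp (V.ρ xm (V.ω v)))) (W.ρ xm w)
      - (1 + Complex.I) • tm _ _ (tm _ _ (U.ρ xm (U.ω u)) (V.ρ xp (V.ρ xm (V.ω v)))) (W.ρ xp w)
      + (1 - Complex.I) • tm _ _ (tm _ _ (U.ρ xp (U.ω u)) (V.ρ xm v)) w
      - (1 - Complex.I) • tm _ _ (tm _ _ (U.ρ xp (U.ω u)) (V.ρ xm v)) (W.ρ xp (W.ρ xm w))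
      - (1 + Complex.I) • tm _ _ (tm _ _ (U.ρ xp (U.ω u)) (V.ρ xp v)) w
      + (1 + Complex.I) • tm _ _ (tm _ _ (U.ρ xp (U.ω u)) (V.ρ xp v)) (W.ρ xp (W.ρ xm w))
      - (1 - Complex.I) • tm _ _ (tm _ _ (U.ρ xp (U.ω u)) (V.ρ xp (V.ρ xm (V.ω v)))) (W.ρ xm w)
      + (1 + Complex.I) • tm _ _ (tm _ _ (U.ρ xp (U.ω u)) (V.ρ xp (V.ρ xm (V.ω v)))) (W.ρ xp w)
      + (2 : ℂ) • tm _ _ (tm _ _ (U.ρ xp (U.ρ xm u)) v) w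
      - (2 : ℂ) • tm _ _ (tm _ _ (U.ρ xp (U.ρ xm u)) v) (W.ρ xp (W.ρ xm w))
      - (2 * Complex.I) • tm _ _ (tm _ _ (U.ρ xp (U.ρ xm u)) (V.ρ xm (V.ω v))) (W.ρ xm w)
      - (2 * Complex.I) • tm _ _ (tm _ _ (U.ρ xp (U.ρ xm u)) (V.ρ xp (V.ω v))) (W.ρ xp w)
      - (2 : ℂ) • tm _ _ (tm _ _ (U.ρ xp (U.ρ xm u)) (V.ρ xp (V.ρ xm v))) w
      + (4 : ℂ) • tm _ _ (tm _ _ (U.ρ xp (U.ρ xm u)) (V.ρ xp (V.ρ xm v))) (W.ρ xp (W.ρ xm w))) := by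
  simp only [LamCoef, as_add, as_sub, as_smul, LinearMap.add_apply, LinearMap.sub_apply,
    LinearMap.smul_apply, as_ee, as_eo, as_oe, as_oo, par_xp, par_xm, par_xp_xm, map_one]
  simp only [map_mul, Module.End.one_apply, Module.End.mul_apply]

end LamCoef

/-! ### The transport diagram in each sector -/

section Transport

variable (β : ℂ) (X Y Z : SF)

/-- The two sides of the transport diagram agree on `v`. -/
def Transport (t : SAlg.S3) (v : (D.obj (SF.tens X (SF.tens Y Z))).carrier) : Prop :=
  as t _ _ _ (lT (D.obj X) (delta Y Z) (delta X (SF.tens Y Z) v))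
    = rT (delta X Y) (D.obj Z) (delta (SF.tens X Y) Z ((D.map (alHom β X Y Z)).lin v))

/-- `t` acts like `Λ^{abc}` on the elements of sector `abc`. -/
def ActsAs (t : SAlg.S3) (a b c : Fin 2) : Prop :=
  ∀ u v w, Pure (D.obj X) a u → Pure (D.obj Y) b v → Pure (D.obj Z) c w →
    as t _ _ _ (tm _ _ u (tm _ _ v w)) = as (LamCoef β a b c) _ _ _ (tm _ _ u (tm _ _ v w))

variable {β X Y Z} {t : SAlg.S3}

/-- Only the action of `t` in the relevant sector is assumed. The computations therefore apply both
to the full `Λ`, for the monoidal structure, and to a single component of it, for the second part of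
the theorem. -/
theorem transport_000 (ht : ActsAs β X Y Z t 0 0 0) (x y z) :
    Transport β X Y Z t (dl _ (i00 _ _ x (i00 _ _ y z))) := by
  have h : ∀ x y z,
      as t _ _ _ (tm _ _ (dl X x) (tm _ _ (dl Y y) (dl Z z)))
      = tm _ _ (tm _ _ (dl X x) (dl Y y)) (dl Z z) :=
    fun  x y z =>
    (ht _ _ _ (pure_dl X x) (pure_dl Y y) (pure_dl Z z)).trans (as_one _ _ _)
  simp only [Transport, delta_dl_i00, D_map_dl, alHom_0, h, al0_000, map_add, map_neg, map_zero,
    lT_tm, rT_tm, ρ_a1_i00, ρ_a2_i00, ω_i00, ρ_a1_a1, ρ_a2_a2, ρ_a2_a1, ω_ρ_a1, ω_ρ_a2,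
    LinearMap.add_apply, LinearMap.zero_apply, SVect.ω_ω, neg_neg, neg_zero] <;>
  module

theorem transport_011 (ht : ActsAs β X Y Z t 0 1 1) {g} (hg : Grass.Mono g) (x y z) :
    Transport β X Y Z t (dl _ (i00 _ _ x (i11 _ _ g y z))) := by
  have h : ∀ (s2 s3 : B) x y z,
      as t _ _ _ (tm _ _ (dl X x) (tm _ _ (dr Y s2 y) (dr Z s3 z)))
      = tm _ _ (tm _ _ (dl X x) (dr Y s2 y)) (dr Z s3 z) :=
    fun s2 s3 x y z =>
    (ht _ _ _ (pure_dl X x) (pure_dr Y s2 y) (pure_dr Z s3 z)).trans (as_one _ _ _)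
  rcases hg with _ | _ | _ | _ <;>
  simp only [Transport, delta_dl_i00, delta_i11_one, delta_i11_a1, delta_i11_a2, delta_i11_a3,
    delta_db_i01, delta_dc_i01, D_map_dl, alHom_0, h, al0_011_one, al0_011_a1, al0_011_a2,
    al0_011_a3, map_add, map_neg, map_sub, map_smul, map_zero, lT_tm, rT_tm, ρ_i11, ω_i01, ρ_a2_a2,
    ρ_a2_a1, ω_ρ_a1, ω_ρ_a2, LinearMap.add_apply, LinearMap.neg_apply, LinearMap.zero_apply,
    SVect.ω_ω, mul_one, Grass.a1_a1, Grass.a1_a2, Grass.a1_a3, neg_neg, neg_zero] <;>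
  module

theorem transport_101 (ht : ActsAs β X Y Z t 1 0 1) {g} (hg : Grass.Mono g) (x y z) :
    Transport β X Y Z t (dl _ (i11 _ _ g x (i01 _ _ y z))) := by
  have h := fun (s1 s3 : B) (x : X.2.carrier) (y : Y.1.carrier) (z : Z.2.carrier) =>
    ht _ _ _ (pure_dr X s1 x) (pure_dl Y y) (pure_dr Z s3 z)
  rcases hg with _ | _ | _ | _ <;>
  simp only [Transport, delta_i11_one, delta_i11_a1, delta_i11_a2, delta_i11_a3, delta_db_i01,
    delta_dc_i01, delta_db_i10, delta_dc_i10, D_map_dl, alHom_0, h, as_LamCoef_101, al0_101,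
    map_add, map_neg, map_sub, map_smul, map_zero, lT_tm, rT_tm, ω_i10, ω_dl, ω_db, ω_dc, ρ_xp_dl,
    ρ_xm_dl, ρ_xp_db, ρ_xm_db, ρ_xp_dc, ρ_xm_dc, ρ_a1_a1, ρ_a2_a2, ρ_a2_a1, ω_ρ_a1, ω_ρ_a2,
    LinearMap.add_apply, LinearMap.sub_apply, LinearMap.smul_apply, LinearMap.neg_apply,
    LinearMap.zero_apply, SVect.ω_ω, map_one, Grass.par_a1, Grass.par_a2, Grass.par_a3, mul_one,
    Grass.a1_a1, Grass.a1_a2, Grass.a2_a1, Grass.a2_a2, Grass.a1_a3, Grass.a2_a3, neg_neg, mul_neg,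
    neg_zero, mul_zero] <;>
  -- Both sides are now combinations of the same pure tensors in normal form, with coefficients
  -- polynomial in `i`; these are compared after reducing the powers of `i`.
  match_scalars <;> ring_nf <;> (try simp only [Complex.I_sq, I_pow_three, Complex.I_pow_four]) <;> (try ring_nf)

theorem transport_110 (ht : ActsAs β X Y Z t 1 1 0) {g} (hg : Grass.Mono g) (x y z) :
    Transport β X Y Z t (dl _ (i11 _ _ g x (i10 _ _ y z))) := by
  have h := fun (s1 s2 : B) (x : X.2.carrier) (y : Y.2.carrier) (z : Z.1.carrier) =>
    ht _ _ _ (pure_dr X s1 x) (pure_dr Y s2 y) (pure_dl Z z)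
  rcases hg with _ | _ | _ | _ <;>
  simp only [Transport, delta_dl_i00, delta_i11_one, delta_i11_a1, delta_i11_a2, delta_i11_a3,
    delta_db_i10, delta_dc_i10, D_map_dl, alHom_0, h, as_LamCoef_110, al0_110_one, al0_110_a1,
    al0_110_a2, al0_110_a3, map_add, map_neg, map_sub, map_smul, map_zero, lT_tm, rT_tm, ρ_i11,
    ω_i11, ω_db, ω_dc, ρ_xp_dl, ρ_xm_dl, ρ_xp_db, ρ_xm_db, ρ_xp_dc, ρ_xm_dc, ρ_a1_a1, ρ_a2_a2,
    ρ_a2_a1, LinearMap.add_apply, LinearMap.sub_apply, LinearMap.smul_apply, LinearMap.neg_apply,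
    LinearMap.zero_apply, SVect.ω_ω, map_one, Grass.par_a1, Grass.par_a2, Grass.par_a3, mul_one,
    Grass.a2_a1, Grass.a2_a2, Grass.a2_a3, neg_neg, neg_zero] <;>
  match_scalars <;> ring_nf <;> (try simp only [Complex.I_sq, I_pow_three]) <;> (try ring_nf)

/-- In the sectors with `a + b + c` odd the source carries a factor `B`, and both basis vectors are
tested. The case of `cB` cannot be deduced from that of `bB` by `S`-linearity, as the linearity of
the action of `Λ` is itself a consequence of this diagram. -/
theorem transport_001_b (ht : ActsAs β X Y Z t 0 0 1) (x y z) :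
    Transport β X Y Z t (dr _ bB (i01 _ _ x (i01 _ _ y z))) := by
  have h : ∀ (s3 : B) x y z,
      as t _ _ _ (tm _ _ (dl X x) (tm _ _ (dl Y y) (dr Z s3 z)))
      = tm _ _ (tm _ _ (dl X x) (dl Y y)) (dr Z s3 z) :=
    fun s3 x y z =>
    (ht _ _ _ (pure_dl X x) (pure_dl Y y) (pure_dr Z s3 z)).trans (as_one _ _ _)
  simp only [Transport, delta_dl_i00, delta_db_i01, delta_dc_i01, D_map_dr, alHom_1, h, al1_001,
    map_add, map_neg, map_zero, lT_tm, rT_tm, ρ_a2_i00, ω_i00, ρ_a2_a2, ω_ρ_a2, LinearMap.add_apply,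
    LinearMap.zero_apply, SVect.ω_ω, neg_zero] <;>
  module

theorem transport_001_c (ht : ActsAs β X Y Z t 0 0 1) (x y z) :
    Transport β X Y Z t (dr _ cB (i01 _ _ x (i01 _ _ y z))) := by
  have h : ∀ (s3 : B) x y z,
      as t _ _ _ (tm _ _ (dl X x) (tm _ _ (dl Y y) (dr Z s3 z)))
      = tm _ _ (tm _ _ (dl X x) (dl Y y)) (dr Z s3 z) :=
    fun s3 x y z =>
    (ht _ _ _ (pure_dl X x) (pure_dl Y y) (pure_dr Z s3 z)).trans (as_one _ _ _)
  simp only [Transport, delta_dl_i00, delta_db_i01, delta_dc_i01, D_map_dr, alHom_1, h, al1_001,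
    map_add, map_neg, map_zero, lT_tm, rT_tm, ρ_a1_i00, ρ_a2_i00, ω_i00, ρ_a1_a1, ρ_a2_a2, ρ_a2_a1,
    ω_ρ_a1, ω_ρ_a2, LinearMap.add_apply, LinearMap.neg_apply, LinearMap.zero_apply, SVect.ω_ω,
    neg_neg, neg_zero] <;>
  module

theorem transport_010_b (ht : ActsAs β X Y Z t 0 1 0) (x y z) :
    Transport β X Y Z t (dr _ bB (i01 _ _ x (i10 _ _ y z))) := by
  have h := fun (s2 : B) (x : X.1.carrier) (y : Y.2.carrier) (z : Z.1.carrier) =>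
    ht _ _ _ (pure_dl X x) (pure_dr Y s2 y) (pure_dl Z z)
  simp only [Transport, delta_db_i01, delta_dc_i01, delta_db_i10, delta_dc_i10, D_map_dr, alHom_1,
    h, as_LamCoef_010, al1_010, map_add, map_neg, map_sub, map_smul, map_zero, lT_tm, rT_tm, ω_i01,
    ω_dl, ω_db, ω_dc, ρ_xp_dl, ρ_xm_dl, ρ_a1_a1, ρ_a2_a2, ρ_a2_a1, ω_ρ_a1, ω_ρ_a2,
    LinearMap.add_apply, LinearMap.neg_apply, LinearMap.zero_apply, SVect.ω_ω, neg_neg,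
    neg_zero] <;>
  match_scalars <;> ring_nf <;> (try simp only [Complex.I_sq]) <;> (try ring_nf)

theorem transport_010_c (ht : ActsAs β X Y Z t 0 1 0) (x y z) :
    Transport β X Y Z t (dr _ cB (i01 _ _ x (i10 _ _ y z))) := by
  have h := fun (s2 : B) (x : X.1.carrier) (y : Y.2.carrier) (z : Z.1.carrier) =>
    ht _ _ _ (pure_dl X x) (pure_dr Y s2 y) (pure_dl Z z)
  simp only [Transport, delta_db_i01, delta_dc_i01, delta_db_i10, delta_dc_i10, D_map_dr, alHom_1,
    h, as_LamCoef_010, al1_010, map_add, map_neg, map_sub, map_smul, map_zero, lT_tm, rT_tm, ω_i01,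
    ω_dl, ω_db, ω_dc, ρ_xp_dl, ρ_xm_dl, ρ_a1_a1, ρ_a2_a2, ρ_a2_a1, ω_ρ_a1, ω_ρ_a2,
    LinearMap.add_apply, LinearMap.neg_apply, LinearMap.zero_apply, SVect.ω_ω, neg_neg,
    neg_zero] <;>
  match_scalars <;> ring_nf <;> (try simp only [Complex.I_sq]) <;> (try ring_nf)

theorem transport_100_b (ht : ActsAs β X Y Z t 1 0 0) (x y z) :
    Transport β X Y Z t (dr _ bB (i10 _ _ x (i00 _ _ y z))) := by
  have h : ∀ (s1 : B) x y z,
      as t _ _ _ (tm _ _ (dr X s1 x) (tm _ _ (dl Y y) (dl Z z)))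
      = tm _ _ (tm _ _ (dr X s1 x) (dl Y y)) (dl Z z) :=
    fun s1 x y z =>
    (ht _ _ _ (pure_dr X s1 x) (pure_dl Y y) (pure_dl Z z)).trans (as_one _ _ _)
  simp only [Transport, delta_dl_i00, delta_db_i10, delta_dc_i10, D_map_dr, alHom_1, h, al1_100,
    map_add, map_neg, map_sub, map_smul, map_zero, lT_tm, rT_tm, ρ_a1_i00, ρ_a2_i00, ω_i10, ρ_a1_a1,
    ρ_a2_a2, ρ_a2_a1, ω_ρ_a1, ω_ρ_a2, LinearMap.add_apply, LinearMap.sub_apply,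
    LinearMap.smul_apply, LinearMap.neg_apply, LinearMap.zero_apply, SVect.ω_ω, neg_neg,
    neg_zero] <;>
  match_scalars <;> ring_nf <;> (try simp only [Complex.I_sq]) <;> (try ring_nf)

theorem transport_100_c (ht : ActsAs β X Y Z t 1 0 0) (x y z) :
    Transport β X Y Z t (dr _ cB (i10 _ _ x (i00 _ _ y z))) := by
  have h : ∀ (s1 : B) x y z,
      as t _ _ _ (tm _ _ (dr X s1 x) (tm _ _ (dl Y y) (dl Z z)))
      = tm _ _ (tm _ _ (dr X s1 x) (dl Y y)) (dl Z z) :=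
    fun s1 x y z =>
    (ht _ _ _ (pure_dr X s1 x) (pure_dl Y y) (pure_dl Z z)).trans (as_one _ _ _)
  simp only [Transport, delta_dl_i00, delta_db_i10, delta_dc_i10, D_map_dr, alHom_1, h, al1_100,
    map_add, map_neg, map_sub, map_smul, map_zero, lT_tm, rT_tm, ρ_a1_i00, ω_i10, ρ_a1_a1, ρ_a2_a1,
    ω_ρ_a1, LinearMap.add_apply, LinearMap.sub_apply, LinearMap.smul_apply, SVect.ω_ω, neg_neg] <;>
  match_scalars <;> ring_nf <;> (try simp only [Complex.I_sq]) <;> (try ring_nf)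

-- Both sides carry the factor `β ^ 2`, on the left from `Λ^{111}` and on the right from `φ`, so no
-- relation for `β` is needed.
set_option maxHeartbeats 1600000 in
theorem transport_111_b (ht : ActsAs β X Y Z t 1 1 1) {g} (hg : Grass.Mono g) (x y z) :
    Transport β X Y Z t (dr _ bB (i10 _ _ x (i11 _ _ g y z))) := by
  have h := fun (s1 s2 s3 : B) (x : X.2.carrier) (y : Y.2.carrier) (z : Z.2.carrier) =>
    ht _ _ _ (pure_dr X s1 x) (pure_dr Y s2 y) (pure_dr Z s3 z)
  rcases hg with _ | _ | _ | _ <;>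
  simp only [Transport, delta_i11_one, delta_i11_a1, delta_i11_a2, delta_i11_a3, delta_db_i01,
    delta_db_i10, D_map_dr, alHom_1, h, as_LamCoef_111, al1_111_one, al1_111_a1, al1_111_a2,
    al1_111_a3, map_add, map_neg, map_sub, map_smul, map_zero, lT_tm, rT_tm, ρ_i11, ω_i11, ω_db,
    ω_dc, ρ_xp_db, ρ_xm_db, ρ_xp_dc, ρ_xm_dc, LinearMap.sub_apply, LinearMap.smul_apply,
    LinearMap.neg_apply, LinearMap.zero_apply, SVect.ω_ω, map_one, Grass.par_a1, Grass.par_a2,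
    Grass.par_a3, mul_one, Grass.a1_a2, Grass.a2_a1, Grass.a2_a2, Grass.a1_a3, Grass.a2_a3, neg_neg,
    neg_zero] <;>
  match_scalars <;> ring_nf <;> (try simp only [Complex.I_sq, I_pow_three]) <;> (try ring_nf)

set_option maxHeartbeats 1600000 in
theorem transport_111_c (ht : ActsAs β X Y Z t 1 1 1) {g} (hg : Grass.Mono g) (x y z) :
    Transport β X Y Z t (dr _ cB (i10 _ _ x (i11 _ _ g y z))) := by
  have h := fun (s1 s2 s3 : B) (x : X.2.carrier) (y : Y.2.carrier) (z : Z.2.carrier) =>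
    ht _ _ _ (pure_dr X s1 x) (pure_dr Y s2 y) (pure_dr Z s3 z)
  rcases hg with _ | _ | _ | _ <;>
  simp only [Transport, delta_i11_one, delta_i11_a1, delta_i11_a2, delta_i11_a3, delta_dc_i01,
    delta_dc_i10, D_map_dr, alHom_1, h, as_LamCoef_111, al1_111_one, al1_111_a1, al1_111_a2,
    al1_111_a3, map_add, map_neg, map_sub, map_smul, map_zero, lT_tm, rT_tm, ρ_i11, ω_i11, ω_db,
    ω_dc, ρ_xp_db, ρ_xm_db, ρ_xp_dc, ρ_xm_dc, LinearMap.sub_apply, LinearMap.smul_apply,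
    LinearMap.neg_apply, LinearMap.zero_apply, SVect.ω_ω, map_one, Grass.par_a1, Grass.par_a2,
    Grass.par_a3, mul_one, Grass.a1_a1, Grass.a1_a2, Grass.a2_a1, Grass.a2_a2, Grass.a1_a3,
    Grass.a2_a3, neg_neg, neg_zero] <;>
  match_scalars <;> ring_nf <;> (try simp only [Complex.I_sq, I_pow_three]) <;> (try ring_nf)

end Transport

end

/-! ### The transport diagram for `Λ` and for its components -/

section

open SuperAlgebra STensor SAlg RepS SF

section Transport

variable {β : ℂ} {X Y Z : SF} {t : SAlg.S3}

/-- The transport diagram commutes if `t` acts like `Λ` in all sectors. -/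
theorem transport_of_actsAs (ht : ∀ a b c, ActsAs β X Y Z t a b c) (v) :
    as t _ _ _ (lT (D.obj X) (delta Y Z) (delta X (SF.tens Y Z) v))
      = rT (delta X Y) (D.obj Z) (delta (SF.tens X Y) Z ((D.map (alHom β X Y Z)).lin v)) := by
  obtain ⟨N, hN⟩ : ∃ N : Submodule ℂ (D.obj (SF.tens X (SF.tens Y Z))).carrier,
      ∀ v, v ∈ N ↔ Transport β X Y Z t v :=
    ⟨LinearMap.eqLocus (as t _ _ _ ∘ₗ lT (D.obj X) (delta Y Z) ∘ₗ delta X (SF.tens Y Z))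
      (rT (delta X Y) (D.obj Z) ∘ₗ delta (SF.tens X Y) Z ∘ₗ (D.map (alHom β X Y Z)).lin),
      fun _ => Iff.rfl⟩
  refine (hN v).mp (mem_D N
    (mem_right0 (N.comap (dl _)) (fun x y z => ?_) (fun g hg x y z => ?_)
      (fun g hg x y z => ?_) (fun g hg x y z => ?_))
    (mem_right1 (N.comap (dr _ bB)) (fun x y z => ?_) (fun x y z => ?_)
      (fun x y z => ?_) (fun g hg x y z => ?_))
    (mem_right1 (N.comap (dr _ cB)) (fun x y z => ?_) (fun x y z => ?_)
      (fun x y z => ?_) (fun g hg x y z => ?_)) v) <;>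
  rw [Submodule.mem_comap, hN]
  · exact transport_000 (ht 0 0 0) x y z
  · exact transport_011 (ht 0 1 1) hg x y z
  · exact transport_101 (ht 1 0 1) hg x y z
  · exact transport_110 (ht 1 1 0) hg x y z
  · exact transport_001_b (ht 0 0 1) x y z
  · exact transport_010_b (ht 0 1 0) x y z
  · exact transport_100_b (ht 1 0 0) x y z
  · exact transport_111_b (ht 1 1 1) hg x y z
  · exact transport_001_c (ht 0 0 1) x y z
  · exact transport_010_c (ht 0 1 0) x y z
  · exact transport_100_c (ht 1 0 0) x y z
  · exact transport_111_c (ht 1 1 1) hg x y z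

theorem transport_Lam (v) :
    as (Lam β) _ _ _ (lT (D.obj X) (delta Y Z) (delta X (SF.tens Y Z) v))
      = rT (delta X Y) (D.obj Z) (delta (SF.tens X Y) Z ((D.map (alHom β X Y Z)).lin v)) :=
  transport_of_actsAs (fun _ _ _ _ _ _ => as_Lam β) v

theorem pure_of_inSector {a : Fin 2} (h : X.InSector a) (u) : Pure (D.obj X) a u := by
  have hN : ∀ (b : Fin 2) (N : Submodule ℂ (D.obj X).carrier),
      (∀ u, Pure (D.obj X) a u → u ∈ N) → u ∈ N := by
    intro b N hN
    fin_cases a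
    · have h' : Subsingleton X.2.carrier := h
      refine mem_D N (fun x => hN _ (pure_dl X x)) (fun x => ?_) (fun x => ?_) u <;>
      rw [Subsingleton.elim x 0, map_zero] <;> exact N.zero_mem
    · have h' : Subsingleton X.1.carrier := h
      refine mem_D N (fun x => ?_) (fun x => hN _ (pure_dr X _ x)) (fun x => hN _ (pure_dr X _ x)) u
      rw [Subsingleton.elim x 0, map_zero]; exact N.zero_mem
  intro b
  by_cases hb : b = a
  · rw [if_pos hb]
    refine hN b (LinearMap.eqLocus ((D.obj X).ρ (e b)) LinearMap.id) (fun u hu => ?_)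
    rw [LinearMap.mem_eqLocus, hu b, if_pos hb]; rfl
  · rw [if_neg hb]
    refine hN b (LinearMap.ker ((D.obj X).ρ (e b))) (fun u hu => ?_)
    rw [LinearMap.mem_ker, hu b, if_neg hb]

theorem pure_ne {U : RepS} {a a' : Fin 2} {u : U.carrier} (h : Pure U a u) (h' : Pure U a' u)
    (hne : a' ≠ a) : u = 0 := by
  rw [← (h' a').trans (if_pos rfl), h a', if_neg hne]

/-- For objects in sectors `a`, `b`, `c`, a vector of any other sector is zero, so the condition is
vacuous except for `abc` itself. -/
theorem actsAs_LamSector {a b c : Fin 2} (hX : X.InSector a) (hY : Y.InSector b)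
    (hZ : Z.InSector c) (a' b' c' : Fin 2) : ActsAs β X Y Z (LamSector β a b c) a' b' c' := by
  intro u v w hu hv hw
  by_cases ha : a' = a
  · by_cases hb : b' = b
    · by_cases hc : c' = c
      · subst ha hb hc
        exact as_LamSector β hu hv hw
      · rw [pure_ne (pure_of_inSector hZ w) hw hc, map_zero, map_zero, map_zero, map_zero]
    · rw [pure_ne (pure_of_inSector hY v) hv hb, map_zero, LinearMap.zero_apply, map_zero, map_zero,
        map_zero]
  · rw [pure_ne (pure_of_inSector hX u) hu ha, map_zero, LinearMap.zero_apply, map_zero, map_zero]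

end Transport

/-! ### `D` is an equivalence -/

section Equivalence

variable {X Y : SF}

/-- The coordinate of `b` in sector 1. -/
def coordD (X : SF) : (D.obj X).carrier →ₗ[ℂ] X.2.carrier :=
  TensorProduct.lift ((LinearMap.lsmul ℂ X.2.carrier : ℂ →ₗ[ℂ] _) ∘ₗ LinearMap.fst ℂ ℂ ℂ ∘ₗ coordB)
    ∘ₗ LinearMap.snd ℂ X.1.carrier (B ⊗[ℂ] X.2.carrier)

/-- The component in sector 0. -/
def fstD (X : SF) : (D.obj X).carrier →ₗ[ℂ] X.1.carrier :=
  LinearMap.fst ℂ X.1.carrier (B ⊗[ℂ] X.2.carrier)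

theorem coordD_db (x) : coordD X (dr X bB x) = x := by
  change (coordB bB).1 • x = x
  rw [coordB_bB, one_smul]
theorem fstD_dl (x) : fstD X (dl X x) = x := rfl
theorem fstD_dr (s x) : fstD X (dr X s x) = 0 := rfl

theorem exists_D (v : (D.obj X).carrier) : ∃ x y z, v = dl X x + dr X bB y + dr X cB z := by
  have h := mem_D (LinearMap.range (dl X) ⊔ LinearMap.range (dr X bB) ⊔ LinearMap.range (dr X cB))
    (fun x => Submodule.mem_sup_left (Submodule.mem_sup_left ⟨x, rfl⟩))
    (fun x => Submodule.mem_sup_left (Submodule.mem_sup_right ⟨x, rfl⟩))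
    (fun x => Submodule.mem_sup_right ⟨x, rfl⟩) v
  obtain ⟨w, hw, _, ⟨z, rfl⟩, rfl⟩ := Submodule.mem_sup.mp h
  obtain ⟨_, ⟨x, rfl⟩, _, ⟨y, rfl⟩, rfl⟩ := Submodule.mem_sup.mp hw
  exact ⟨x, y, z, rfl⟩

/-- Together with `eq_db` this characterises the two components of `X` inside `D X` in terms of the
action alone: the kernel of `e1`, and the vectors fixed by `e1` and killed by `x⁻`. Morphisms of
representations preserve both, which is why `D` is full. -/
theorem eq_dl {v : (D.obj X).carrier} (h : (D.obj X).ρ e1 v = 0) : v = dl X (fstD X v) := by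
  obtain ⟨x, y, z, rfl⟩ := exists_D v
  simp only [map_add, ρ_e1_dl, ρ_e1_dr, zero_add] at h
  simp only [map_add, fstD_dl, fstD_dr, add_zero]
  rw [add_assoc, h, add_zero]

theorem eq_db {v : (D.obj X).carrier} (h : (D.obj X).ρ e1 v = v) (h' : (D.obj X).ρ xm v = 0) :
    v = dr X bB (coordD X v) := by
  obtain ⟨x, y, z, rfl⟩ := exists_D v
  simp only [map_add, ρ_e1_dl, ρ_e1_dr, zero_add] at h
  have hx : dl X x = 0 := by
    have := sub_eq_zero.mpr h
    rw [← neg_eq_zero, ← this]; abel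
  rw [hx] at h' ⊢
  simp only [map_add, ρ_xm_db, ρ_xm_dc, zero_add] at h'
  have hz : z = 0 := by rw [← coordD_db z, h', map_zero]
  rw [hz]
  simp only [coordD_db, map_zero, add_zero, zero_add]

instance : D.Faithful where
  map_injective {X Y} f g h := by
    have hl : ∀ v, (D.map f).lin v = (D.map g).lin v := fun v => by rw [h]
    refine hom_ext (fun x => ?_) (fun x => ?_)
    · rw [← fstD_dl (f.1.lin x), ← D_map_dl, hl, D_map_dl, fstD_dl]
    · rw [← coordD_db (f.2.lin x), ← D_map_dr, hl, D_map_dr, coordD_db]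

theorem lin_dl (f : D.obj X ⟶ D.obj Y) (x) : f.lin (dl X x) = dl Y (fstD Y (f.lin (dl X x))) :=
  eq_dl (by rw [← f.lin_ρ, ρ_e1_dl, map_zero])

theorem lin_db (f : D.obj X ⟶ D.obj Y) (x) :
    f.lin (dr X bB x) = dr Y bB (coordD Y (f.lin (dr X bB x))) :=
  eq_db (by rw [← f.lin_ρ, ρ_e1_dr]) (by rw [← f.lin_ρ, ρ_xm_db, map_zero])

/-- The preimage of a morphism under `D`. -/
def preD (f : D.obj X ⟶ D.obj Y) : X ⟶ Y :=
  Prod.mkHom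
    ⟨fstD Y ∘ₗ f.lin ∘ₗ dl X, fun x => by
        simp only [LinearMap.comp_apply]
        rw [← ω_dl, f.lin_ω, lin_dl, ω_dl, fstD_dl, fstD_dl],
      Grass.lin_ρ _
        (fun x => by
          simp only [LinearMap.comp_apply]
          rw [← ρ_xp_dl, f.lin_ρ, lin_dl, ρ_xp_dl, fstD_dl, fstD_dl])
        (fun x => by
          simp only [LinearMap.comp_apply]
          rw [← ρ_xm_dl, f.lin_ρ, lin_dl, ρ_xm_dl, fstD_dl, fstD_dl])⟩
    ⟨coordD Y ∘ₗ f.lin ∘ₗ dr X bB, fun x => by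
        simp only [LinearMap.comp_apply]
        rw [← ω_db, f.lin_ω, lin_db, ω_db, coordD_db, coordD_db]⟩

theorem preD_0 (f : D.obj X ⟶ D.obj Y) (x) : (preD f).1.lin x = fstD Y (f.lin (dl X x)) := rfl
theorem preD_1 (f : D.obj X ⟶ D.obj Y) (x) : (preD f).2.lin x = coordD Y (f.lin (dr X bB x)) := rfl

instance : D.Full where
  map_surjective {X Y} f := by
    refine ⟨preD f, SRep.Hom.ext (LinearMap.ext fun v => ?_)⟩
    refine mem_D (LinearMap.eqLocus (D.map (preD f)).lin f.lin) (fun x => ?_) (fun x => ?_)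
      (fun x => ?_) v
    · rw [LinearMap.mem_eqLocus, D_map_dl, preD_0, ← lin_dl]
    · rw [LinearMap.mem_eqLocus, D_map_dr, preD_1, ← lin_db]
    -- The vector is `x⁺` applied to the corresponding one with `bB`, so linearity reduces to the
    -- previous case.
    · rw [LinearMap.mem_eqLocus, D_map_dr, preD_1, ← ρ_xp_db, ← lin_db, ← f.lin_ρ, ρ_xp_db]

end Equivalence

end

section

open SuperAlgebra STensor SAlg RepS SF

/-! ### `D` is essentially surjective -/

/-- The parity involution is compatible with an action of the Grassmann algebra if it is so for the
generators. -/
theorem Grass.ω_ρ_of {K : Type} [AddCommGroup K] [Module ℂ K] (ω : K →ₗ[ℂ] K)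
    (ρ : Grass →ₐ[ℂ] Module.End ℂ K) (h1 : ∀ v, ω (ρ Grass.a1 v) = -ρ Grass.a1 (ω v))
    (h2 : ∀ v, ω (ρ Grass.a2 v) = -ρ Grass.a2 (ω v)) (a : Grass) (v : K) :
    ω (ρ a v) = ρ (par a) (ω v) := by
  have h3 : ∀ v, ρ Grass.a3 v = ρ Grass.a1 (ρ Grass.a2 v) := fun v => by
    rw [← Module.End.mul_apply, ← map_mul, Grass.a1_a2]
  rw [Grass.eq_sum a]
  simp only [map_add, map_smul, map_one, par_a1, par_a2, par_a3, map_neg, LinearMap.add_apply,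
    LinearMap.smul_apply, LinearMap.neg_apply, Module.End.one_apply, h1, h2, h3, neg_neg]

section EssSurj

variable (V : RepS)

theorem ρ_mul (a c : SAlg) (v : V.carrier) : V.ρ (a * c) v = V.ρ a (V.ρ c v) := by
  rw [map_mul, Module.End.mul_apply]

theorem ρ_e1_xp (v : V.carrier) : V.ρ e1 (V.ρ xp v) = V.ρ xp (V.ρ e1 v) := by
  rw [← ρ_mul, ← xp_e1, ρ_mul]
theorem ρ_e1_xm (v : V.carrier) : V.ρ e1 (V.ρ xm v) = V.ρ xm (V.ρ e1 v) := by
  rw [← ρ_mul, ← xm_e1, ρ_mul]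
theorem ρ_e1_e1 (v : V.carrier) : V.ρ e1 (V.ρ e1 v) = V.ρ e1 v := by
  rw [← ρ_mul, e1_e1]
theorem ρ_xp_xp (v : V.carrier) : V.ρ xp (V.ρ xp v) = 0 := by
  rw [← ρ_mul, xp_xp, map_zero, LinearMap.zero_apply]
theorem ρ_xm_xm (v : V.carrier) : V.ρ xm (V.ρ xm v) = 0 := by
  rw [← ρ_mul, xm_xm, map_zero, LinearMap.zero_apply]
theorem ρ_xm_xp (v : V.carrier) : V.ρ xm (V.ρ xp v) = V.ρ e1 v - V.ρ xp (V.ρ xm v) := by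
  rw [← anti', map_add, LinearMap.add_apply, ρ_mul, ρ_mul, add_sub_cancel_left]
theorem ω_ρ_xp (v : V.carrier) : V.ω (V.ρ xp v) = -V.ρ xp (V.ω v) := by
  rw [V.ω_ρ, par_xp, map_neg, LinearMap.neg_apply]
theorem ω_ρ_xm (v : V.carrier) : V.ω (V.ρ xm v) = -V.ρ xm (V.ω v) := by
  rw [V.ω_ρ, par_xm, map_neg, LinearMap.neg_apply]
theorem ω_ρ_e1 (v : V.carrier) : V.ω (V.ρ e1 v) = V.ρ e1 (V.ω v) := by
  rw [V.ω_ρ, par_e1]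

/-- The part of `V` on which `e₁` vanishes. -/
def part0 : Submodule ℂ V.carrier := LinearMap.ker (V.ρ e1)

/-- The part of `V` on which `e₁` is the identity and `x⁻` vanishes. -/
def part1 : Submodule ℂ V.carrier :=
  LinearMap.eqLocus (V.ρ e1) LinearMap.id ⊓ LinearMap.ker (V.ρ xm)

variable {V} in
theorem mem_part0 {v : V.carrier} : v ∈ part0 V ↔ V.ρ e1 v = 0 := LinearMap.mem_ker

variable {V} in
theorem mem_part1 {v : V.carrier} : v ∈ part1 V ↔ V.ρ e1 v = v ∧ V.ρ xm v = 0 := Iff.rfl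

theorem xp_part0 : ∀ v ∈ part0 V, V.ρ xp v ∈ part0 V := fun v hv => by
  rw [mem_part0] at hv ⊢
  rw [ρ_e1_xp, hv, map_zero]
theorem xm_part0 : ∀ v ∈ part0 V, V.ρ xm v ∈ part0 V := fun v hv => by
  rw [mem_part0] at hv ⊢
  rw [ρ_e1_xm, hv, map_zero]
theorem ω_part0 : ∀ v ∈ part0 V, V.ω v ∈ part0 V := fun v hv => by
  rw [mem_part0] at hv ⊢
  rw [← ω_ρ_e1, hv, map_zero]
theorem ω_part1 : ∀ v ∈ part1 V, V.ω v ∈ part1 V := fun v hv => by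
  rw [mem_part1] at hv ⊢
  refine ⟨by rw [← ω_ρ_e1, hv.1], ?_⟩
  rw [← neg_eq_zero, ← ω_ρ_xm, hv.2, map_zero]

/-- The action of the Grassmann algebra on the part of `V` on which `e₁` vanishes. -/
def grassAct : Grass →ₐ[ℂ] Module.End ℂ (part0 V) :=
  Grass.lift ((V.ρ xp).restrict (xp_part0 V)) ((V.ρ xm).restrict (xm_part0 V))
    (LinearMap.ext fun v => Subtype.ext (ρ_xp_xp V v))
    (LinearMap.ext fun v => Subtype.ext (ρ_xm_xm V v))
    (LinearMap.ext fun v => Subtype.ext ((ρ_xm_xp V v).trans (by rw [mem_part0.mp v.2, zero_sub]; rfl)))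

theorem grassAct_a1 (v : part0 V) : (grassAct V Grass.a1 v : V.carrier) = V.ρ xp v := by
  rw [grassAct, Grass.lift_a1]; rfl
theorem grassAct_a2 (v : part0 V) : (grassAct V Grass.a2 v : V.carrier) = V.ρ xm v := by
  rw [grassAct, Grass.lift_a2]; rfl

/-- The object of `SF` which `D` sends to `V`, up to isomorphism. -/
def parts : SF :=
  ({ carrier := part0 V
     ω := V.ω.restrict (ω_part0 V)
     ω_ω := fun v => Subtype.ext (V.ω_ω v)
     ρ := grassAct V
     ω_ρ := Grass.ω_ρ_of _ _
       (fun v => Subtype.ext (by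
        change V.ω (grassAct V Grass.a1 v : V.carrier) = -(grassAct V Grass.a1 _ : V.carrier)
        rw [grassAct_a1, grassAct_a1, ω_ρ_xp]; rfl))
       (fun v => Subtype.ext (by
        change V.ω (grassAct V Grass.a2 v : V.carrier) = -(grassAct V Grass.a2 _ : V.carrier)
        rw [grassAct_a2, grassAct_a2, ω_ρ_xm]; rfl)) },
   { carrier := part1 V
     ω := V.ω.restrict (ω_part1 V)
     ω_ω := fun v => Subtype.ext (V.ω_ω v) })

/-- The inclusion of the part of `V` on which `e₁` vanishes. -/
def inc0 : (parts V).1.carrier →ₗ[ℂ] V.carrier := (part0 V).subtype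

/-- The inclusion of the part of `V` on which `e₁` is the identity and `x⁻` vanishes. -/
def inc1 : (parts V).2.carrier →ₗ[ℂ] V.carrier := (part1 V).subtype

/-- The map `D (V₀, V₁) → V`. -/
def ofParts : (D.obj (parts V)).carrier →ₗ[ℂ] V.carrier :=
  LinearMap.coprod (inc0 V)
    (TensorProduct.lift (LinearMap.flip (LinearMap.flip (V.ρ.toLinearMap ∘ₗ B.subtype) ∘ₗ inc1 V)))

theorem ofParts_dl (x) : ofParts V (dl _ x) = inc0 V x := by
  refine (LinearMap.coprod_apply ..).trans ?_
  rw [show (dl (parts V) x).2 = 0 from rfl, map_zero, add_zero]; rfl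

theorem ofParts_dr (s x) : ofParts V (dr _ s x) = V.ρ s (inc1 V x) := by
  refine (LinearMap.coprod_apply ..).trans ?_
  rw [show (dr (parts V) s x).1 = 0 from rfl, map_zero, zero_add]; rfl

theorem e1_inc0 (x) : V.ρ e1 (inc0 V x) = 0 := mem_part0.mp x.2
theorem e1_inc1 (x) : V.ρ e1 (inc1 V x) = inc1 V x := (mem_part1.mp x.2).1
theorem xm_inc1 (x) : V.ρ xm (inc1 V x) = 0 := (mem_part1.mp x.2).2

/-- Where `e₁` is the identity and `x⁻` vanishes, `x⁻x⁺ = e₁ - x⁺x⁻` acts as the identity. -/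
theorem bB_inc1 (x) : V.ρ bB (inc1 V x) = inc1 V x := by
  rw [ρ_bB, e1_inc1, ρ_xm_xp, e1_inc1, xm_inc1, map_zero, sub_zero]

theorem ofParts_db (x) : ofParts V (dr _ bB x) = inc1 V x := by rw [ofParts_dr, bB_inc1]
theorem ofParts_dc (x) : ofParts V (dr _ cB x) = V.ρ xp (inc1 V x) := by
  rw [ofParts_dr, ρ_cB, bB_inc1]

theorem ofParts_ρ (a : SAlg) (v) : ofParts V ((D.obj _).ρ a v) = V.ρ a (ofParts V v) := by
  have hr : ∀ (a : SAlg) s x, ofParts V ((D.obj _).ρ a (dr _ s x)) = V.ρ a (ofParts V (dr _ s x)) :=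
    fun a s x => by rw [ρ_dr, ofParts_dr, ofParts_dr, ρ_ρ_B]
  have hl : ∀ (a : SAlg), (∀ x, ofParts V (dl _ ((parts V).1.ρ (toGrass a) x)) = V.ρ a (inc0 V x)) →
      ∀ v, ofParts V ((D.obj _).ρ a v) = V.ρ a (ofParts V v) := fun a h v => by
    refine mem_D (LinearMap.eqLocus (ofParts V ∘ₗ (D.obj _).ρ a) (V.ρ a ∘ₗ ofParts V))
      (fun x => ?_) (fun x => ?_) (fun x => ?_) v <;>
    simp only [LinearMap.mem_eqLocus, LinearMap.comp_apply]
    · rw [ρ_dl, h, ofParts_dl]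
    · exact hr a _ x
    · exact hr a _ x
  refine SAlg.lin_ρ (U := D.obj (parts V)) (V := V) (ofParts V) (hl _ fun x => ?_) (hl _ fun x => ?_)
    (hl _ fun x => ?_) a v
  · rw [ofParts_dl, toGrass_xp]; exact grassAct_a1 V x
  · rw [ofParts_dl, toGrass_xm]; exact grassAct_a2 V x
  · rw [ofParts_dl, show toGrass L = 1 from lift_L .., map_one, RepS.ρ_L, e1_inc0, smul_zero, sub_zero]
    rfl

theorem ofParts_ω (v) : ofParts V ((D.obj _).ω v) = V.ω (ofParts V v) := by
  refine mem_D (LinearMap.eqLocus (ofParts V ∘ₗ (D.obj _).ω) (V.ω ∘ₗ ofParts V))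
    (fun x => ?_) (fun x => ?_) (fun x => ?_) v <;>
  simp only [LinearMap.mem_eqLocus, LinearMap.comp_apply]
  · rw [ω_dl, ofParts_dl, ofParts_dl]; rfl
  · rw [ω_db, ofParts_db, ofParts_db]; rfl
  · rw [ω_dc, map_neg, ofParts_dc, ofParts_dc, ω_ρ_xp]; rfl

/-- On the image of `e₁` the Clifford relation reads `1 = x⁻x⁺ + x⁺x⁻`, which splits it into `ker
x⁻` and `x⁺ (ker x⁻)`, with `x⁺` injective on the former. The complement, the kernel of `e₁`, is the
component in `SF₀`. -/
theorem ofParts_bijective : Function.Bijective (ofParts V) := by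
  constructor
  · rw [← LinearMap.ker_eq_bot, LinearMap.ker_eq_bot']
    intro v hv
    obtain ⟨x, y, z, rfl⟩ := exists_D v
    simp only [map_add, ofParts_dl, ofParts_db, ofParts_dc] at hv
    -- Applying `e1` removes the component in `SF₀`, and then `x⁻` isolates the coefficient `z` of
    -- `cB`.
    have h1 := congrArg (V.ρ e1) hv
    simp only [map_add, e1_inc0, e1_inc1, ρ_e1_xp, map_zero, zero_add] at h1
    have h2 := congrArg (V.ρ xm) h1
    simp only [map_add, xm_inc1, ρ_xm_xp, e1_inc1, map_zero, zero_add, sub_zero] at h2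
    rw [h2, map_zero, add_zero] at h1
    rw [h1, h2, map_zero, add_zero, add_zero] at hv
    have hx : x = 0 := Subtype.ext hv
    have hy : y = 0 := Subtype.ext h1
    have hz : z = 0 := Subtype.ext h2
    rw [hx, hy, hz, map_zero, map_zero, map_zero, add_zero, add_zero]
  · intro v
    -- The preimage comes from the decomposition `v = (v - e₁v) + x⁻x⁺e₁v + x⁺x⁻e₁v`.
    have h0 : v - V.ρ e1 v ∈ part0 V := by
      rw [mem_part0, map_sub, ρ_e1_e1, sub_self]
    have h1 : V.ρ xm (V.ρ xp (V.ρ e1 v)) ∈ part1 V := by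
      rw [mem_part1, ρ_e1_xm, ρ_e1_xp, ρ_e1_e1, ρ_xm_xm]
      exact ⟨rfl, rfl⟩
    have h2 : V.ρ xm (V.ρ e1 v) ∈ part1 V := by
      rw [mem_part1, ρ_e1_xm, ρ_e1_e1, ρ_xm_xm]
      exact ⟨rfl, rfl⟩
    obtain ⟨x, hx⟩ : ∃ x, inc0 V x = v - V.ρ e1 v := ⟨⟨_, h0⟩, rfl⟩
    obtain ⟨y, hy⟩ : ∃ y, inc1 V y = V.ρ xm (V.ρ xp (V.ρ e1 v)) := ⟨⟨_, h1⟩, rfl⟩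
    obtain ⟨z, hz⟩ : ∃ z, inc1 V z = V.ρ xm (V.ρ e1 v) := ⟨⟨_, h2⟩, rfl⟩
    refine ⟨dl _ x + dr _ bB y + dr _ cB z, ?_⟩
    rw [map_add, map_add, ofParts_dl, ofParts_db, ofParts_dc, hx, hy, hz, ρ_xm_xp, ρ_e1_e1]
    abel

/-- `V` is isomorphic to an object in the image of `D`. -/
def partsIso : D.obj (parts V) ≅ V :=
  SRep.isoOfLin (LinearEquiv.ofBijective (ofParts V) (ofParts_bijective V)) (ofParts_ω V)
    (ofParts_ρ V)

instance : D.EssSurj where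
  mem_essImage V := ⟨parts V, ⟨partsIso V⟩⟩

theorem D_isEquivalence : D.IsEquivalence := {}

end EssSurj

end

section

open SuperAlgebra STensor SAlg RepS SF

/-! ### `Rep S` is a monoidal category -/

namespace RepS

theorem hom_ext {U V : RepS} {f g : U ⟶ V} (h : ∀ v, f.lin v = g.lin v) : f = g :=
  SRep.Hom.ext (LinearMap.ext h)

theorem comp_lin {U V W : RepS} (f : U ⟶ V) (g : V ⟶ W) (v) : (f ≫ g).lin v = g.lin (f.lin v) :=
  rfl

theorem tens_ext {U V : RepS} {M : Type} [AddCommGroup M] [Module ℂ M]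
    {f g : (tens U V).carrier →ₗ[ℂ] M} (h : ∀ u v, f (tm U V u v) = g (tm U V u v)) (w) :
    f w = g w :=
  mem_tens (LinearMap.eqLocus f g) h w

theorem tens_ext₃ {U V W : RepS} {M : Type} [AddCommGroup M] [Module ℂ M]
    {f g : (tens U (tens V W)).carrier →ₗ[ℂ] M}
    (h : ∀ u v w, f (tm _ _ u (tm V W v w)) = g (tm _ _ u (tm V W v w))) (w) : f w = g w :=
  tens_ext (fun u => tens_ext (f := f ∘ₗ tm _ _ u) (g := g ∘ₗ tm _ _ u) (h u)) w

theorem tensHom_id (U V : RepS) : tensHom (𝟙 U) (𝟙 V) = 𝟙 (tens U V) :=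
  hom_ext (tens_ext fun _ _ => rfl)

theorem tensHom_comp {U U' U'' V V' V'' : RepS} (f : U ⟶ U') (g : V ⟶ V') (f' : U' ⟶ U'')
    (g' : V' ⟶ V'') : tensHom f g ≫ tensHom f' g' = tensHom (f ≫ f') (g ≫ g') :=
  hom_ext (tens_ext (f := (tensHom f g ≫ tensHom f' g').lin) fun _ _ => rfl)

theorem tensHom_left_lin {U V V' : RepS} (f : V ⟶ V') :
    (tensHom (𝟙 U) f).lin = lT U f.lin := rfl

theorem tensHom_right_lin {U U' V : RepS} (f : U ⟶ U') :
    (tensHom f (𝟙 V)).lin = rT f.lin V := rfl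

/-- The tensor product of isomorphisms. -/
def tensIso {U U' V V' : RepS} (f : U ≅ U') (g : V ≅ V') : tens U V ≅ tens U' V' where
  hom := tensHom f.hom g.hom
  inv := tensHom f.inv g.inv
  hom_inv_id := by rw [tensHom_comp, f.hom_inv_id, g.hom_inv_id, tensHom_id]
  inv_hom_id := by rw [tensHom_comp, f.inv_hom_id, g.inv_hom_id, tensHom_id]

theorem inv_hom_lin {U V : RepS} (f : U ≅ V) (v) : f.hom.lin (f.inv.lin v) = v := by
  rw [← comp_lin, f.inv_hom_id]; rfl

/-- This holds for every `t`: morphisms commute with the action on each factor and, preserving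
parity, with the signs. It is compatibility with the action of `S` on the tensor products that
singles out particular elements `t`. -/
theorem as_naturality (t : SAlg.S3) {U U' V V' W W' : RepS} (f : U ⟶ U') (g : V ⟶ V')
    (h : W ⟶ W') (v) : as t U' V' W' ((tensHom f (tensHom g h)).lin v)
      = (tensHom (tensHom f g) h).lin (as t U V W v) := by
  refine tens_ext₃ (f := as t U' V' W' ∘ₗ (tensHom f (tensHom g h)).lin)
    (g := (tensHom (tensHom f g) h).lin ∘ₗ as t U V W) (fun u v w => ?_) v
  let F : U.ext V ⟶ U'.ext V' := ⟨map f.lin g.lin,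
    fun x => (SVect.tensorMap f.toSVect g.toSVect).lin_ω x, SRep.ext_lin_ρ f g⟩
  exact (SRep.ext_lin_ρ F h t ((u ⊗ₜ v) ⊗ₜ w)).symm

/-! ### The associator of `Rep S`, obtained from `SF`, and its pentagon -/

section Associator

variable {β : ℂ} (hβ : β ^ 4 = -1)

/-- The associator on the image of `D`, transported from `SF`. -/
def assocD (X Y Z : SF) : tens (D.obj X) (tens (D.obj Y) (D.obj Z))
    ≅ tens (tens (D.obj X) (D.obj Y)) (D.obj Z) :=
  (tensIso (Iso.refl _) (deltaIso Y Z)).symm ≪≫ (deltaIso X (SF.tens Y Z)).symm ≪≫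
    D.mapIso (alIso hβ X Y Z).symm ≪≫ deltaIso (SF.tens X Y) Z ≪≫
    tensIso (deltaIso X Y) (Iso.refl _)

/-- This is the transport diagram read backwards along `Δ`. Since the left-hand side is a composite
of isomorphisms of representations, the action of `Λ` on the image of `D` is `S`-linear and
invertible. -/
theorem assocD_hom_lin (X Y Z : SF) (v) :
    (assocD hβ X Y Z).hom.lin v = as (Lam β) _ _ _ v := by
  have h := transport_Lam (β := β)
    ((deltaIso X (SF.tens Y Z)).inv.lin ((tensIso (Iso.refl _) (deltaIso Y Z)).inv.lin v))
  have h1 := inv_hom_lin (deltaIso X (SF.tens Y Z))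
    ((tensIso (Iso.refl _) (deltaIso Y Z)).inv.lin v)
  rw [deltaIso_hom_lin] at h1
  have h2 := inv_hom_lin (tensIso (Iso.refl (D.obj X)) (deltaIso Y Z)) v
  rw [h1] at h
  exact (h.symm.trans (congrArg (as (Lam β) _ _ _) h2))

/-- The associator of `Rep S`. -/
def assocS (U V W : RepS) : tens U (tens V W) ≅ tens (tens U V) W :=
  (tensIso (partsIso U) (tensIso (partsIso V) (partsIso W))).symm ≪≫ assocD hβ _ _ _ ≪≫
    tensIso (tensIso (partsIso U) (partsIso V)) (partsIso W)

/-- Naturality of the action of `Λ` lets the chosen isomorphisms with objects in the image of `D`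
cancel. -/
theorem assocS_hom_lin (U V W : RepS) (v) : (assocS hβ U V W).hom.lin v = as (Lam β) U V W v := by
  have h := as_naturality (Lam β) (partsIso U).hom (partsIso V).hom (partsIso W).hom
    ((tensIso (partsIso U) (tensIso (partsIso V) (partsIso W))).inv.lin v)
  rw [← assocD_hom_lin hβ] at h
  exact h.symm.trans (congrArg (as (Lam β) _ _ _)
    (inv_hom_lin (tensIso (partsIso U) (tensIso (partsIso V) (partsIso W))) v))

theorem assocS_naturality {U U' V V' W W' : RepS} (f : U ⟶ U') (g : V ⟶ V') (h : W ⟶ W') :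
    tensHom f (tensHom g h) ≫ (assocS hβ U' V' W').hom
      = (assocS hβ U V W).hom ≫ tensHom (tensHom f g) h :=
  hom_ext fun v => by
    rw [comp_lin, comp_lin, assocS_hom_lin, assocS_hom_lin, as_naturality]

/-- The maps `Δ` are compatible with the associators. -/
theorem delta_assoc (X Y Z : SF) :
    (deltaIso X (SF.tens Y Z)).hom ≫ tensHom (𝟙 _) (deltaIso Y Z).hom ≫ (assocS hβ _ _ _).hom
      = D.map (alHom β X Y Z) ≫ (deltaIso (SF.tens X Y) Z).hom ≫
        tensHom (deltaIso X Y).hom (𝟙 _) :=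
  hom_ext fun v => by
    simp only [comp_lin, assocS_hom_lin, tensHom_left_lin, tensHom_right_lin, deltaIso_hom_lin]
    exact transport_Lam v

theorem deltaIso_naturality {X X' Y Y' : SF} (f : X ⟶ X') (g : Y ⟶ Y') :
    D.map (SF.tensHom f g) ≫ (deltaIso X' Y').hom
      = (deltaIso X Y).hom ≫ tensHom (D.map f) (D.map g) :=
  hom_ext (delta_naturality f g)

theorem tensHom_left_comp {U V V' V'' : RepS} (f : V ⟶ V') (g : V' ⟶ V'') :
    tensHom (𝟙 U) (f ≫ g) = tensHom (𝟙 U) f ≫ tensHom (𝟙 U) g := by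
  rw [tensHom_comp, Category.comp_id]

theorem tensHom_right_comp {U V V' V'' : RepS} (f : V ⟶ V') (g : V' ⟶ V'') :
    tensHom (f ≫ g) (𝟙 U) = tensHom f (𝟙 U) ≫ tensHom g (𝟙 U) := by
  rw [tensHom_comp, Category.comp_id]

/-- The pentagon on the image of `D`. -/
theorem pentagon_D (X Y Z W : SF) :
    (assocS hβ (D.obj X) (D.obj Y) (tens (D.obj Z) (D.obj W))).hom ≫
        (assocS hβ (tens (D.obj X) (D.obj Y)) (D.obj Z) (D.obj W)).hom
      = tensHom (𝟙 _) (assocS hβ (D.obj Y) (D.obj Z) (D.obj W)).hom ≫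
        (assocS hβ (D.obj X) (tens (D.obj Y) (D.obj Z)) (D.obj W)).hom ≫
        tensHom (assocS hβ (D.obj X) (D.obj Y) (D.obj Z)).hom (𝟙 _) := by
  have e1 : IsIso ((deltaIso X (SF.tens Y (SF.tens Z W))).hom ≫
      tensHom (𝟙 (D.obj X)) (deltaIso Y (SF.tens Z W)).hom ≫
      tensHom (𝟙 (D.obj X)) (tensHom (𝟙 (D.obj Y)) (deltaIso Z W).hom)) := by
    have h1 : IsIso (tensHom (𝟙 (D.obj X)) (deltaIso Y (SF.tens Z W)).hom) :=
      (tensIso (Iso.refl (D.obj X)) (deltaIso Y (SF.tens Z W))).isIso_hom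
    have h2 : IsIso (tensHom (𝟙 (D.obj X)) (tensHom (𝟙 (D.obj Y)) (deltaIso Z W).hom)) :=
      (tensIso (Iso.refl (D.obj X)) (tensIso (Iso.refl (D.obj Y)) (deltaIso Z W))).isIso_hom
    infer_instance
  -- Precomposition with the iterated `Δ` starting from `D (X * (Y * (Z * W)))` is harmless. It lets
  -- every associator of `Rep S` be pushed through the maps `Δ` and replaced by the image under `D`
  -- of an associator of `SF`.
  rw [← cancel_epi ((deltaIso X (SF.tens Y (SF.tens Z W))).hom ≫
      tensHom (𝟙 (D.obj X)) (deltaIso Y (SF.tens Z W)).hom ≫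
      tensHom (𝟙 (D.obj X)) (tensHom (𝟙 (D.obj Y)) (deltaIso Z W).hom))]
  have n1 := assocS_naturality hβ (𝟙 (D.obj X)) (𝟙 (D.obj Y)) (deltaIso Z W).hom
  have n2 := assocS_naturality hβ (deltaIso X Y).hom (𝟙 (D.obj Z)) (𝟙 (D.obj W))
  have n3 := assocS_naturality hβ (𝟙 (D.obj X)) (deltaIso Y Z).hom (𝟙 (D.obj W))
  have p := congrArg D.map (al_pentagon hβ X Y Z W)
  have a1 := delta_assoc hβ X Y (SF.tens Z W)
  have a2 := delta_assoc hβ (SF.tens X Y) Z W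
  have a3 := congrArg (tensHom (𝟙 (D.obj X))) (delta_assoc hβ Y Z W)
  have a4 := delta_assoc hβ X (SF.tens Y Z) W
  have a5 := congrArg (fun f => tensHom f (𝟙 (D.obj W))) (delta_assoc hβ X Y Z)
  have d1 := deltaIso_naturality (𝟙 X) (alHom β Y Z W)
  have d2 := deltaIso_naturality (alHom β X Y Z) (𝟙 W)
  -- On the left-hand side the `Δ` of the first two factors must be exchanged with that of the last
  -- two.
  have c : tensHom (deltaIso X Y).hom (𝟙 _) ≫ tensHom (𝟙 _) (deltaIso Z W).hom
      = tensHom (𝟙 _) (deltaIso Z W).hom ≫ tensHom (deltaIso X Y).hom (𝟙 _) := by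
    rw [tensHom_comp, tensHom_comp, Category.id_comp, Category.comp_id, Category.id_comp,
      Category.comp_id]
  simp only [tensHom_id, D.map_id, D.map_comp, tensHom_left_comp,
    tensHom_right_comp] at n1 n2 n3 p a1 a2 a3 a4 a5 d1 d2
  simp only [Category.assoc]
  -- Both sides become the image under `D` of a composite in `SF` followed by the same maps `Δ`; `p`
  -- then identifies the two composites.
  rw [reassoc_of% n1, reassoc_of% a1, reassoc_of% c, n2, reassoc_of% a2,
    reassoc_of% a3, ← reassoc_of% d1, reassoc_of% n3, reassoc_of% a4, a5, ← reassoc_of% d2,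
    reassoc_of% p]

/-- By essential surjectivity each object may be replaced by one in the image of `D`; naturality of
the associator carries `pentagon_D` along these isomorphisms. -/
theorem pentagonS (U V W T : RepS) :
    (assocS hβ U V (tens W T)).hom ≫ (assocS hβ (tens U V) W T).hom
      = tensHom (𝟙 U) (assocS hβ V W T).hom ≫ (assocS hβ U (tens V W) T).hom ≫
        tensHom (assocS hβ U V W).hom (𝟙 T) := by
  have e : IsIso (tensHom (partsIso U).hom (tensHom (partsIso V).hom
      (tensHom (partsIso W).hom (partsIso T).hom))) :=
    (tensIso (partsIso U) (tensIso (partsIso V) (tensIso (partsIso W) (partsIso T)))).isIso_hom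
  rw [← cancel_epi (tensHom (partsIso U).hom (tensHom (partsIso V).hom
      (tensHom (partsIso W).hom (partsIso T).hom)))]
  have h : tensHom (partsIso U).hom (tensHom (partsIso V).hom
      (tensHom (partsIso W).hom (partsIso T).hom)) ≫ tensHom (𝟙 U) (assocS hβ V W T).hom
      = tensHom (𝟙 _) (assocS hβ _ _ _).hom ≫ tensHom (partsIso U).hom
        (tensHom (tensHom (partsIso V).hom (partsIso W).hom) (partsIso T).hom) := by
    rw [tensHom_comp, tensHom_comp, Category.comp_id, Category.id_comp, assocS_naturality]
  have h' : tensHom (tensHom (partsIso U).hom (tensHom (partsIso V).hom (partsIso W).hom))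
      (partsIso T).hom ≫ tensHom (assocS hβ U V W).hom (𝟙 T)
      = tensHom (assocS hβ _ _ _).hom (𝟙 _) ≫ tensHom (tensHom
        (tensHom (partsIso U).hom (partsIso V).hom) (partsIso W).hom) (partsIso T).hom := by
    rw [tensHom_comp, tensHom_comp, Category.comp_id, Category.id_comp, assocS_naturality]
  have n1 := assocS_naturality hβ (partsIso U).hom (partsIso V).hom
    (tensHom (partsIso W).hom (partsIso T).hom)
  have n2 := assocS_naturality hβ (tensHom (partsIso U).hom (partsIso V).hom) (partsIso W).hom
    (partsIso T).hom
  have n3 := assocS_naturality hβ (partsIso U).hom (tensHom (partsIso V).hom (partsIso W).hom)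
    (partsIso T).hom
  have p := pentagon_D hβ (parts U) (parts V) (parts W) (parts T)
  rw [reassoc_of% n1, n2, reassoc_of% p, reassoc_of% h, reassoc_of% n3, h']

end Associator

/-! ### Units and the monoidal axioms of `Rep S` -/

section Unit

/-- The tensor unit of `Rep S`, not unfolded by `simp`. -/
def unt : RepS := unit

/-- The scalar given by an element of the tensor unit. -/
def uc (c : unt.carrier) : ℂ := c

/-- The left unit isomorphism. -/
def lu (U : RepS) : tens unt U ⟶ U := (leftUnitor U).hom

/-- The right unit isomorphism. -/
def ru (U : RepS) : tens U unt ⟶ U := (rightUnitor U).hom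

theorem lu_tm {U : RepS} (c u) : (lu U).lin (tm unt U c u) = uc c • u := rfl
theorem ru_tm {U : RepS} (u c) : (ru U).lin (tm U unt u c) = uc c • u := rfl

theorem unt_ρ (a : SAlg) (c : unt.carrier) : unt.ρ a c = counit a • c := rfl

theorem pure_unt (c : unt.carrier) : Pure unt 0 c := by
  intro b
  fin_cases b
  · exact (unt_ρ e0 c).trans (by rw [counit_e0, one_smul]; rfl)
  · exact (unt_ρ e1 c).trans (by rw [counit_e1, zero_smul]; rfl)

theorem pure_ρ_e {U : RepS} (a : Fin 2) (u : U.carrier) : Pure U a (U.ρ (e a) u) := by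
  intro b
  rw [← ρ_mul]
  fin_cases a <;> fin_cases b
  · exact congrArg (fun s => U.ρ s u) e0_e0
  · exact (congrArg (fun s => U.ρ s u) e1_e0).trans (by rw [map_zero]; rfl)
  · exact (congrArg (fun s => U.ρ s u) e0_e1).trans (by rw [map_zero]; rfl)
  · exact congrArg (fun s => U.ρ s u) e1_e1

theorem eq_sum_e {U : RepS} (u : U.carrier) : u = U.ρ (e 0) u + U.ρ (e 1) u := by
  change u = U.ρ e0 u + U.ρ e1 u
  rw [ρ_e0, sub_add_cancel]

/-- The unit lies in sector 0, so only the coefficients with middle index 0 matter. Three of them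
are `1`, and in `Λ^{101}` every other term has `x⁺` or `x⁻` in the middle slot, where it acts by
zero. -/
theorem as_Lam_unt (β : ℂ) {U V : RepS} (u c v) :
    as (Lam β) U unt V (tm _ _ u (tm _ _ c v)) = tm _ _ (tm _ _ u c) v := by
  have hp : unt.ρ xp c = 0 := by rw [unt_ρ, counit, lift_xp, zero_smul]
  have hm : unt.ρ xm c = 0 := by rw [unt_ρ, counit, lift_xm, zero_smul]
  have hω : unt.ω c = c := rfl
  have h : ∀ a b u v, Pure U a u → Pure V b v →
      as (Lam β) U unt V (tm _ _ u (tm _ _ c v)) = tm _ _ (tm _ _ u c) v := by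
    intro a b u v hu hv
    rw [as_Lam β hu (pure_unt c) hv]
    fin_cases a <;> fin_cases b
    · exact as_one _ _ _
    · exact as_one _ _ _
    · exact as_one _ _ _
    · refine (as_LamCoef_101 β u c v).trans ?_
      simp only [map_add, map_smul, LinearMap.add_apply, LinearMap.smul_apply, hω, hp, hm, map_zero,
        smul_zero, LinearMap.zero_apply, add_zero, sub_zero]
  rw [eq_sum_e u, eq_sum_e v]
  simp only [map_add, LinearMap.add_apply]
  rw [h _ _ _ _ (pure_ρ_e 0 u) (pure_ρ_e 0 v), h _ _ _ _ (pure_ρ_e 1 u) (pure_ρ_e 0 v),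
    h _ _ _ _ (pure_ρ_e 0 u) (pure_ρ_e 1 v), h _ _ _ _ (pure_ρ_e 1 u) (pure_ρ_e 1 v)]

theorem lu_naturality {U V : RepS} (f : U ⟶ V) : tensHom (𝟙 unt) f ≫ lu V = lu U ≫ f :=
  hom_ext (tens_ext (f := (tensHom (𝟙 unt) f ≫ lu V).lin) fun c u => by
    rw [comp_lin, comp_lin, tensHom_tm, lu_tm, lu_tm, map_smul]; rfl)

theorem ru_naturality {U V : RepS} (f : U ⟶ V) : tensHom f (𝟙 unt) ≫ ru V = ru U ≫ f :=
  hom_ext (tens_ext (f := (tensHom f (𝟙 unt) ≫ ru V).lin) fun u c => by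
    rw [comp_lin, comp_lin, tensHom_tm, ru_tm, ru_tm, map_smul]; rfl)

variable {β : ℂ} (hβ : β ^ 4 = -1)

theorem triangleS (U V : RepS) :
    (assocS hβ U unt V).hom ≫ tensHom (ru U) (𝟙 V) = tensHom (𝟙 U) (lu V) :=
  hom_ext (tens_ext₃ (f := ((assocS hβ U unt V).hom ≫ tensHom (ru U) (𝟙 V)).lin) fun u c v => by
    rw [comp_lin, assocS_hom_lin, as_Lam_unt, tensHom_tm, tensHom_tm, ru_tm, lu_tm, map_smul,
      map_smul, LinearMap.smul_apply]; rfl)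

theorem assocS_symm_naturality {U U' V V' W W' : RepS} (f : U ⟶ U') (g : V ⟶ V') (h : W ⟶ W') :
    tensHom (tensHom f g) h ≫ (assocS hβ U' V' W').inv
      = (assocS hβ U V W).inv ≫ tensHom f (tensHom g h) := by
  rw [Iso.eq_inv_comp, ← reassoc_of% assocS_naturality, Iso.hom_inv_id, Category.comp_id]

theorem triangleS_symm (U V : RepS) :
    (assocS hβ U unt V).inv ≫ tensHom (𝟙 U) (lu V) = tensHom (ru U) (𝟙 V) := by
  rw [← triangleS hβ, Iso.inv_hom_id_assoc]

theorem pentagonS_symm (U V W T : RepS) :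
    tensHom (assocS hβ U V W).inv (𝟙 T) ≫ (assocS hβ U (tens V W) T).inv ≫
        tensHom (𝟙 U) (assocS hβ V W T).inv
      = (assocS hβ (tens U V) W T).inv ≫ (assocS hβ U V (tens W T)).inv := by
  have h1 : tensHom (assocS hβ U V W).hom (𝟙 T) ≫ tensHom (assocS hβ U V W).inv (𝟙 T) = 𝟙 _ := by
    rw [tensHom_comp, Iso.hom_inv_id, Category.comp_id, tensHom_id]
  have h2 : tensHom (𝟙 U) (assocS hβ V W T).hom ≫ tensHom (𝟙 U) (assocS hβ V W T).inv = 𝟙 _ := by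
    rw [tensHom_comp, Iso.hom_inv_id, Category.comp_id, tensHom_id]
  -- As for `SF`, the pentagon is inverted by composing with the inverse of the right-hand side.
  rw [← cancel_epi ((assocS hβ U V (tens W T)).hom ≫ (assocS hβ (tens U V) W T).hom)]
  have h := pentagonS hβ U V W T
  conv_lhs => rw [h]
  simp only [Category.assoc]
  rw [reassoc_of% h1, Iso.hom_inv_id_assoc, h2, Iso.hom_inv_id_assoc, Iso.hom_inv_id]

/-- `Rep S` is a monoidal category. -/
theorem isMonoidal : IsMonoidal (monStruct fun U V W => (assocS hβ U V W).symm) :=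
  ⟨{ monStruct (fun U V W => (assocS hβ U V W).symm) with
      tensorHom_def := fun f g => by
        refine Eq.trans ?_ (tensHom_comp f (𝟙 _) (𝟙 _) g).symm
        rw [Category.comp_id, Category.id_comp]; rfl
      id_tensorHom_id := tensHom_id
      tensorHom_comp_tensorHom := fun f g f' g' => tensHom_comp f g f' g'
      whiskerLeft_id := tensHom_id
      id_whiskerRight := tensHom_id
      associator_naturality := assocS_symm_naturality hβ
      leftUnitor_naturality := lu_naturality
      rightUnitor_naturality := ru_naturality
      pentagon := pentagonS_symm hβ
      triangle := triangleS_symm hβ }, rfl⟩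

end Unit

end RepS

end

section

open SuperAlgebra STensor SAlg RepS SF

/-! ### `D` is a monoidal functor -/

/-- A functor with compatible isomorphisms is a monoidal functor. -/
theorem isMonoidalFunctor_of {C E : Type 1} [Category.{0} C] [Category.{0} E]
    (mC : MonoidalCategory C) (mE : MonoidalCategory E) (F : C ⥤ E)
    (Θ : ∀ X Y, F.obj (mC.tensorObj X Y) ≅ mE.tensorObj (F.obj X) (F.obj Y))
    (θ : F.obj mC.tensorUnit ≅ mE.tensorUnit)
    (nat_left : ∀ {X Y : C} (f : X ⟶ Y) (Z : C), (Θ X Z).hom ≫ mE.whiskerRight (F.map f) (F.obj Z)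
      = F.map (mC.whiskerRight f Z) ≫ (Θ Y Z).hom)
    (nat_right : ∀ {X Y : C} (Z : C) (f : X ⟶ Y), (Θ Z X).hom ≫ mE.whiskerLeft (F.obj Z) (F.map f)
      = F.map (mC.whiskerLeft Z f) ≫ (Θ Z Y).hom)
    (hassoc : ∀ X Y Z, (Θ X (mC.tensorObj Y Z)).hom ≫ mE.whiskerLeft (F.obj X) (Θ Y Z).hom ≫
        (mE.associator (F.obj X) (F.obj Y) (F.obj Z)).inv
      = F.map (mC.associator X Y Z).inv ≫ (Θ (mC.tensorObj X Y) Z).hom ≫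
        mE.whiskerRight (Θ X Y).hom (F.obj Z))
    (hleft : ∀ X, (Θ mC.tensorUnit X).hom ≫ mE.whiskerRight θ.hom (F.obj X) ≫
        (mE.leftUnitor (F.obj X)).hom = F.map (mC.leftUnitor X).hom)
    (hright : ∀ X, (Θ X mC.tensorUnit).hom ≫ mE.whiskerLeft (F.obj X) θ.hom ≫
        (mE.rightUnitor (F.obj X)).hom = F.map (mC.rightUnitor X).hom) :
    IsMonoidalFunctor mC mE F (fun X Y => (Θ X Y).hom) θ.hom := by
  let o : F.OplaxMonoidal :=
    { η := θ.hom
      δ := fun X Y => (Θ X Y).hom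
      δ_natural_left := nat_left
      δ_natural_right := nat_right
      oplax_associativity := fun X Y Z => by
        have h := hassoc X Y Z
        -- The hypothesis is stated for the inverse associators, which are the maps `α` of the
        -- theorem; the oplax axiom uses the associators themselves, so they are moved to the other
        -- sides.
        rw [← Category.assoc, Iso.comp_inv_eq, Category.assoc, Category.assoc] at h
        rw [h, ← Category.assoc (F.map _), ← F.map_comp, Iso.hom_inv_id, F.map_id, Category.id_comp]
      oplax_left_unitality := fun X => by
        rw [← cancel_mono (mE.leftUnitor (F.obj X)).hom, Iso.inv_hom_id, Category.assoc,
          Category.assoc, hleft, ← F.map_comp, Iso.inv_hom_id, F.map_id]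
      oplax_right_unitality := fun X => by
        rw [← cancel_mono (mE.rightUnitor (F.obj X)).hom, Iso.inv_hom_id, Category.assoc,
          Category.assoc, hright, ← F.map_comp, Iso.inv_hom_id, F.map_id] }
  have h1 : IsIso (Functor.OplaxMonoidal.η F) := θ.isIso_hom
  have h2 : ∀ X Y, IsIso (Functor.OplaxMonoidal.δ F X Y) := fun X Y => (Θ X Y).isIso_hom
  exact ⟨Functor.Monoidal.ofOplaxMonoidal F, fun X Y => rfl, rfl⟩

/-! ### Compatibility of `D` with the units -/

section Unit

theorem counit_toGrass (a : SAlg) : Grass.counit (toGrass a) = SAlg.counit a := by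
  have h : Grass.counit.comp toGrass = SAlg.counit := by
    apply SAlg.algHom_ext
    · rw [AlgHom.comp_apply, toGrass_xp, Grass.counit, Grass.lift_a1, SAlg.counit, lift_xp]
    · rw [AlgHom.comp_apply, toGrass_xm, Grass.counit, Grass.lift_a2, SAlg.counit, lift_xm]
    · rw [AlgHom.comp_apply, toGrass, lift_L, map_one, SAlg.counit, lift_L]
  exact AlgHom.congr_fun h a

theorem fst_bijective : Function.Bijective (LinearMap.fst ℂ ℂ (B ⊗[ℂ] PUnit.{1})) := by
  have h (v : B ⊗[ℂ] PUnit.{1}) : v = 0 :=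
    tensor_mem (⊥ : Submodule ℂ (B ⊗[ℂ] PUnit.{1})) (fun s _ => tmul_zero _ s) v
  exact ⟨fun x y hxy => Prod.ext hxy ((h _).trans (h _).symm), fun c => ⟨(c, 0), rfl⟩⟩

/-- The isomorphism `D 1 ≅ 1`. -/
def etaIso : D.obj SF.unit ≅ RepS.unit :=
  SRep.isoOfLin (U := D.obj SF.unit) (V := RepS.unit)
    (LinearEquiv.ofBijective (LinearMap.fst ℂ ℂ (B ⊗[ℂ] PUnit.{1})) fst_bijective)
    (fun _ => rfl) (fun a x => congrArg (· * x.1) (counit_toGrass a))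

/-- The isomorphism `D 1 ≅ 1`, not unfolded by `simp`. -/
def eta : D.obj SF.unt ≅ RepS.unt := etaIso

theorem eta_dl (c) : RepS.uc (eta.hom.lin (dl SF.unt c)) = SF.uc c := rfl

/-- Every correction term in the values of `Δ` involves `a₁` or `a₂` acting on the unit and so
vanishes, and the unit has no component in `SF₁`. The same argument applies on the right. -/
theorem delta_lu (X : SF) : (deltaIso SF.unt X).hom ≫ RepS.tensHom eta.hom (𝟙 _) ≫ RepS.lu (D.obj X)
    = D.map (SF.lu X) := by
  refine RepS.hom_ext fun v => mem_D_tens (LinearMap.eqLocus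
    ((deltaIso SF.unt X).hom ≫ RepS.tensHom eta.hom (𝟙 _) ≫ RepS.lu (D.obj X)).lin
    (D.map (SF.lu X)).lin) ?_ ?_ ?_ ?_ ?_ ?_ v <;> intros <;>
    rw [LinearMap.mem_eqLocus, RepS.comp_lin, RepS.comp_lin, deltaIso_hom_lin]
  · rw [delta_dl_i00, unit_ω, unit_a2, map_zero, map_zero, LinearMap.zero_apply, add_zero,
      RepS.tensHom_tm, RepS.lu_tm, D_map_dl, SF.lu_i00, eta_dl, map_smul]
    rfl
  · rename_i x y
    rw [SF.unit_1 x]; simp only [map_zero, LinearMap.zero_apply]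
  · rw [delta_db_i01, unit_ω, unit_a2, map_zero, map_zero, LinearMap.zero_apply, add_zero,
      RepS.tensHom_tm, RepS.lu_tm, D_map_dr, SF.lu_i01, eta_dl, map_smul]
    rfl
  · rename_i x y
    rw [SF.unit_1 x]; simp only [map_zero, LinearMap.zero_apply]
  · rw [delta_dc_i01, unit_ω, unit_a2, unit_a1]
    simp only [map_zero, LinearMap.zero_apply, add_zero, zero_add]
    rw [RepS.tensHom_tm, RepS.lu_tm, D_map_dr, SF.lu_i01, eta_dl, map_smul]
    rfl
  · rename_i x y
    rw [SF.unit_1 x]; simp only [map_zero, LinearMap.zero_apply]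

theorem delta_ru (X : SF) : (deltaIso X SF.unt).hom ≫ RepS.tensHom (𝟙 _) eta.hom ≫ RepS.ru (D.obj X)
    = D.map (SF.ru X) := by
  refine RepS.hom_ext fun v => mem_D_tens (LinearMap.eqLocus
    ((deltaIso X SF.unt).hom ≫ RepS.tensHom (𝟙 _) eta.hom ≫ RepS.ru (D.obj X)).lin
    (D.map (SF.ru X)).lin) ?_ ?_ ?_ ?_ ?_ ?_ v <;> intros <;>
    rw [LinearMap.mem_eqLocus, RepS.comp_lin, RepS.comp_lin, deltaIso_hom_lin]
  · rw [delta_dl_i00, unit_a1, map_zero, map_zero, add_zero,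
      RepS.tensHom_tm, RepS.ru_tm, D_map_dl, SF.ru_i00, eta_dl, map_smul]
    rfl
  · rename_i x y
    rw [SF.unit_1 y]; simp only [map_zero]
  · rename_i x y
    rw [SF.unit_1 y]; simp only [map_zero]
  · rw [delta_db_i10, unit_a2]
    simp only [map_zero, add_zero, smul_zero]
    rw [RepS.tensHom_tm, RepS.ru_tm, D_map_dr, SF.ru_i10, eta_dl, map_smul]
    rfl
  · rename_i x y
    rw [SF.unit_1 y]; simp only [map_zero]
  · rw [delta_dc_i10, unit_a1]
    simp only [map_zero, sub_zero, smul_zero]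
    rw [RepS.tensHom_tm, RepS.ru_tm, D_map_dr, SF.ru_i10, eta_dl, map_smul]
    rfl

end Unit

/-- The functor `D` is monoidal. -/
theorem D_isMonoidalFunctor {β : ℂ} (hβ : β ^ 4 = -1) :
    IsMonoidalFunctor (SF.isMonoidal hβ).monoidalCategory (RepS.isMonoidal hβ).monoidalCategory D
      (fun X Y => (deltaIso X Y).hom) etaIso.hom := by
  refine isMonoidalFunctor_of (SF.isMonoidal hβ).monoidalCategory
    (RepS.isMonoidal hβ).monoidalCategory D deltaIso etaIso ?_ ?_ ?_ ?_ ?_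
  · intro X Y f Z
    have h := deltaIso_naturality f (𝟙 Z)
    rw [D.map_id] at h
    exact h.symm
  · intro X Y Z f
    have h := deltaIso_naturality (𝟙 Z) f
    rw [D.map_id] at h
    exact h.symm
  · exact delta_assoc hβ
  · exact delta_lu
  · exact delta_ru

end

section

open SuperAlgebra STensor SAlg RepS SF

/-! ### The idempotents of `S ⊗ S ⊗ S` -/

namespace STensor

variable {A B : Type} [Ring A] [Algebra ℂ A] [SuperAlgebra A] [Ring B] [Algebra ℂ B]
  [SuperAlgebra B]

/-- Evenness of both factors is needed besides centrality, so that no sign arises in either order.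
-/
theorem pt_central {x : A} {y : B} (hx : par x = x) (hy : par y = y) (cx : ∀ a, x * a = a * x)
    (cy : ∀ b, y * b = b * y) (t : STensor A B) : pt x y * t = t * pt x y := by
  induction t using STensor.induction with
  | h_add s t hs ht => rw [mul_add, add_mul, hs, ht]
  | h_even a b hb => rw [pt_mul_even _ hy, pt_mul_even _ hb, cx, cy]
  | h_odd a b hb => rw [pt_mul_even _ hy, pt_mul_odd _ hb, hx, cx, cy]

end STensor

namespace SAlg

theorem e1_central (s : SAlg) : e1 * s = s * e1 := by
  induction s using gen_induction with
  | hp => exact xp_e1.symm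
  | hm => exact xm_e1.symm
  | hL => rw [L_eq, mul_sub, sub_mul, e1_e0, e0_e1]
  | hs c => exact (Algebra.commutes c e1).symm
  | hadd s t hs ht => rw [mul_add, add_mul, hs, ht]
  | hmul s t hs ht => rw [← mul_assoc, hs, mul_assoc, ht, mul_assoc]

theorem e_central (a : Fin 2) (s : SAlg) : e a * s = s * e a := by
  fin_cases a
  · change e0 * s = s * e0
    rw [e0_eq, sub_mul, mul_sub, one_mul, mul_one, e1_central]
  · exact e1_central s

theorem e_mul_self (a : Fin 2) : e a * e a = e a := by
  fin_cases a
  · exact e0_e0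
  · exact e1_e1

theorem t3_e_central (a b c : Fin 2) (t : S3) :
    t3 (e a) (e b) (e c) * t = t * t3 (e a) (e b) (e c) :=
  pt_central (by rw [par_pt, par_e, par_e]) (par_e c)
    (pt_central (par_e a) (par_e b) (e_central a) (e_central b)) (e_central c) t

theorem t3_e_mul_self (a b c : Fin 2) :
    t3 (e a) (e b) (e c) * t3 (e a) (e b) (e c) = t3 (e a) (e b) (e c) := by
  rw [t3, pt_mul_even _ (par_e c), pt_mul_even _ (par_e b), e_mul_self, e_mul_self, e_mul_self]

theorem LamSector_mul_t3 (β : ℂ) (a b c : Fin 2) :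
    LamSector β a b c * t3 (e a) (e b) (e c) = LamSector β a b c := by
  rw [LamSector, mul_assoc, t3_e_mul_self]

/-! ### The regular representation of `S` -/

/-- A spanning family of `S`. -/
def spanning (i : Fin 4 × Fin 2) : SAlg := ![1, xp, xm, xp * xm] i.1 * ![1, e1] i.2

theorem mul_mem_of_spanning {N : Submodule ℂ SAlg} {s : SAlg}
    (h : ∀ i, s * (![1, xp, xm, xp * xm] : Fin 4 → SAlg) i ∈ N) (hN : ∀ v ∈ N, v * e1 ∈ N) :
    ∀ v ∈ Submodule.span ℂ (Set.range spanning), s * v ∈ N := by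
  intro v hv
  refine Submodule.span_le (p := N.comap (LinearMap.mulLeft ℂ s)).mpr ?_ hv
  rintro _ ⟨⟨i, j⟩, rfl⟩
  change s * (_ * _) ∈ N
  rw [← mul_assoc]
  fin_cases j
  · exact (mul_one (s * _)).symm ▸ h i
  · exact hN _ (h i)

/-- The span contains `1` and is stable under left multiplication by the generators, hence is
everything. Independence of the family is irrelevant: only the finite dimension of `S` is needed,
for the regular representation to belong to `Rep S`. -/
theorem span_spanning : Submodule.span ℂ (Set.range spanning) = ⊤ := by
  set N := Submodule.span ℂ (Set.range spanning) with hN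
  have mem (i j) : spanning (i, j) ∈ N := Submodule.subset_span ⟨_, rfl⟩
  have m0 : (1 : SAlg) ∈ N := by simpa [spanning] using mem 0 0
  have he : ∀ v ∈ N, v * e1 ∈ N := by
    intro v hv
    refine Submodule.span_le (p := N.comap (LinearMap.mulRight ℂ e1)).mpr ?_ hv
    rintro _ ⟨⟨i, j⟩, rfl⟩
    change _ * _ * e1 ∈ N
    fin_cases j
    · have h := mem i 1
      rw [spanning] at h
      simpa using h
    · have h := mem i 1
      rw [spanning] at h
      simpa [mul_assoc, e1_e1] using h
  have m1 : xp ∈ N := by simpa [spanning] using mem 1 0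
  have m2 : xm ∈ N := by simpa [spanning] using mem 2 0
  have m3 : xp * xm ∈ N := by simpa [spanning] using mem 3 0
  have m4 : e1 ∈ N := by simpa using he _ m0
  have key : ∀ s : SAlg, ∀ v ∈ N, s * v ∈ N := by
    intro s
    induction s using gen_induction with
    | hp =>
      refine mul_mem_of_spanning (fun i => ?_) he
      fin_cases i
      · simpa using m1
      · simpa [xp_xp] using N.zero_mem
      · simpa using m3
      · simpa [← mul_assoc, xp_xp] using N.zero_mem
    | hm =>
      have hx : xm * xp = e1 - xp * xm := by rw [← anti']; abel
      refine mul_mem_of_spanning (fun i => ?_) he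
      fin_cases i
      · simpa using m2
      · simpa [hx] using N.sub_mem m4 m3
      · simpa [xm_xm] using N.zero_mem
      · simpa [← mul_assoc, hx, sub_mul, mul_assoc xp, xm_xm, ← xm_e1] using he _ m2
    | hL =>
      intro v hv
      rw [L_eq, e0_eq, sub_mul, sub_mul, one_mul, e1_central]
      exact N.sub_mem (N.sub_mem hv (he v hv)) (he v hv)
    | hs c =>
      intro v hv
      rw [← Algebra.smul_def]
      exact N.smul_mem c hv
    | hadd s t hs ht => intro v hv; rw [add_mul]; exact N.add_mem (hs v hv) (ht v hv)
    | hmul s t hs ht => intro v hv; rw [mul_assoc]; exact hs _ (ht v hv)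
  exact eq_top_iff.mpr fun v _ => mul_one v ▸ key v 1 m0

instance : FiniteDimensional ℂ SAlg :=
  Module.finite_def.mpr (span_spanning ▸ Submodule.fg_span (Set.finite_range spanning))

end SAlg

/-- The regular representation of `S`. -/
def RepS.regular : RepS where
  carrier := SAlg
  ω := (par (A := SAlg)).toLinearMap
  ω_ω := par_par
  ρ := lreg SAlg
  ω_ρ a x := map_mul par a x

/-- The product on `S ⊗ S ⊗ S` was defined through the same signed action, so `t` can be recovered
from its action on regular representations. -/
theorem as_regular (t : SAlg.S3) (x y z : SAlg) :
    as t regular regular regular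
    (tm regular (RepS.tens regular regular) x (tm regular regular y z)) = t * t3 x y z := by
  rfl

/-! ### Sectors -/

/-- The zero representation of the Grassmann algebra. -/
def zeroRep : SRep Grass where
  toSVect := SVect.zero
  ρ := Grass.lift 0 0 rfl rfl rfl
  ω_ρ _ _ := rfl

/-- The component of `X` in a sector. -/
def SF.sec (X : SF) : Fin 2 → SF
  | 0 => (X.1, SVect.zero)
  | 1 => (zeroRep, X.2)

theorem sec_inSector (X : SF) (a : Fin 2) : (sec X a).InSector a := by
  fin_cases a
  · exact inferInstanceAs (Subsingleton PUnit)
  · exact inferInstanceAs (Subsingleton PUnit)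

/-- The inclusion of the component of `X` in a sector. -/
def SF.secInc (X : SF) : ∀ a, sec X a ⟶ X
  | 0 => Prod.mkHom (𝟙 X.1) ⟨0, fun _ => (map_zero X.2.ω).symm⟩
  | 1 => Prod.mkHom ⟨0, fun _ => (map_zero X.1.ω).symm, fun a _ => (map_zero (X.1.ρ a)).symm⟩ (𝟙 X.2)

theorem exists_secInc {X : SF} {a : Fin 2} {v : (D.obj X).carrier} (hv : Pure (D.obj X) a v) :
    ∃ w, (D.map (secInc X a)).lin w = v := by
  obtain ⟨x, y, z, rfl⟩ := exists_D v
  have h := hv a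
  rw [if_pos rfl] at h
  fin_cases a
  · refine ⟨dl (sec X 0) x, (D_map_dl _ _).trans ?_⟩
    refine Eq.trans ?_ h
    simp only [Fin.zero_eta, map_add, ρ_e0_dl, ρ_e0_dr, add_zero]
    rfl
  · refine ⟨dr (sec X 1) bB y + dr (sec X 1) cB z, ?_⟩
    refine Eq.trans ?_ h
    simp only [Fin.mk_one, map_add, ρ_e1_dl', ρ_e1_dr', zero_add]
    exact congrArg₂ (· + ·) (D_map_dr (secInc X 1) bB y) (D_map_dr (secInc X 1) cB z)

/-- Every element of `V` in sector `a` comes from an object of `SF` in this sector. -/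
theorem exists_of_pure {V : RepS} {a : Fin 2} {v : V.carrier} (hv : Pure V a v) :
    ∃ w, (D.map (secInc (parts V) a) ≫ (partsIso V).hom).lin w = v := by
  have h : Pure (D.obj (parts V)) a ((partsIso V).inv.lin v) := fun b => by
    rw [← (partsIso V).inv.lin_ρ, hv b]
    split
    · rfl
    · exact map_zero _
  obtain ⟨w, hw⟩ := exists_secInc h
  exact ⟨w, by rw [RepS.comp_lin, hw, RepS.inv_hom_lin]⟩

/-! ### The uniqueness of `Λ` -/

section Unique

variable {β : ℂ} {t : SAlg.S3} {X Y Z : SF}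

theorem transportDiagram_iff : TransportDiagram β t X Y Z ↔ ∀ v,
    as t _ _ _ (lT (D.obj X) (delta Y Z) (delta X (SF.tens Y Z) v))
      = rT (delta X Y) (D.obj Z) (delta (SF.tens X Y) Z ((D.map (alHom β X Y Z)).lin v)) :=
  LinearMap.ext_iff

theorem transportDiagram_LamSector {a b c : Fin 2} (hX : X.InSector a) (hY : Y.InSector b)
    (hZ : Z.InSector c) : TransportDiagram β (LamSector β a b c) X Y Z :=
  transportDiagram_iff.mpr (transport_of_actsAs (actsAs_LamSector hX hY hZ))

/-- The transport diagram determines the action. -/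
theorem as_eq_of_transportDiagram {t' : SAlg.S3} (h : TransportDiagram β t X Y Z)
    (h' : TransportDiagram β t' X Y Z) (v) :
    as t (D.obj X) (D.obj Y) (D.obj Z) v = as t' (D.obj X) (D.obj Y) (D.obj Z) v := by
  have hv := RepS.inv_hom_lin (tensIso (Iso.refl (D.obj X)) (deltaIso Y Z)) v
  have hw := RepS.inv_hom_lin (deltaIso X (SF.tens Y Z))
    ((tensIso (Iso.refl (D.obj X)) (deltaIso Y Z)).inv.lin v)
  rw [← hw] at hv
  have e := (transportDiagram_iff.mp h _).trans (transportDiagram_iff.mp h'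
    ((deltaIso X (SF.tens Y Z)).inv.lin
      ((tensIso (Iso.refl (D.obj X)) (deltaIso Y Z)).inv.lin v))).symm
  exact (congrArg _ hv).symm.trans (e.trans (congrArg _ hv))

/-- For uniqueness, the vectors `e a`, `e b`, `e c` of the regular representation come from objects
of `SF` in the sectors `a`, `b`, `c`. The diagram fixes the action of `t` on those objects, and
naturality moves it to the regular representation, where the action of `t` on `e_a ⊗ e_b ⊗ e_c`
returns `t`. -/
theorem eq_LamSector_iff {a b c : Fin 2} :
    (t = t3 (e a) (e b) (e c) * t ∧ ∀ X Y Z : SF, X.InSector a → Y.InSector b → Z.InSector c →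
      TransportDiagram β t X Y Z) ↔ t = LamSector β a b c := by
  constructor
  · rintro ⟨ht, h⟩
    have hp : ∀ a : Fin 2, Pure regular a (e a) := fun a b => by
      have h := pure_ρ_e (U := regular) a (1 : SAlg) b
      rwa [show regular.ρ (e a) (1 : SAlg) = e a from mul_one (e a : SAlg)] at h
    obtain ⟨u, hu⟩ := exists_of_pure (hp a)
    obtain ⟨v, hv⟩ := exists_of_pure (hp b)
    obtain ⟨w, hw⟩ := exists_of_pure (hp c)
    have key := fun s => as_naturality s (D.map (secInc (parts regular) a) ≫ (partsIso regular).hom)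
      (D.map (secInc (parts regular) b) ≫ (partsIso regular).hom)
      (D.map (secInc (parts regular) c) ≫ (partsIso regular).hom) (tm _ _ u (tm _ _ v w))
    simp only [tensHom_tm, hu, hv, hw] at key
    have hX := sec_inSector (parts regular) a
    have hY := sec_inSector (parts regular) b
    have hZ := sec_inSector (parts regular) c
    have e := (key t).trans ((congrArg _ (as_eq_of_transportDiagram (h _ _ _ hX hY hZ)
      (transportDiagram_LamSector hX hY hZ) _)).trans (key (LamSector β a b c)).symm)
    -- Membership of `t` and of the component of `Λ` in `S_a ⊗ S_b ⊗ S_c` makes multiplication by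
    -- the idempotent disappear on both sides.
    rw [as_regular, as_regular, LamSector_mul_t3, ← t3_e_central, ← ht] at e
    exact e
  · rintro rfl
    exact ⟨by rw [t3_e_central, LamSector_mul_t3],
      fun X Y Z hX hY hZ => transportDiagram_LamSector hX hY hZ⟩

end Unique

end

end SympFerm

end


theorem mainTheorem7 (β : ℂ) (hβ : β ^ 4 = -1) :
    (∃ (aSF : ∀ X Y Z : SF, SF.tensor (SF.tensor X Y) Z ≅ SF.tensor X (SF.tensor Y Z))
        (aS : ∀ U V W : RepS,
          RepS.tensor (RepS.tensor U V) W ≅ RepS.tensor U (RepS.tensor V W))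
        (Δ : ∀ U V : SF, D.obj (SF.tensor U V) ≅ RepS.tensor (D.obj U) (D.obj V))
        (η : D.obj SF.unit ≅ RepS.unit),
      (∀ X Y Z, (aSF X Y Z).inv.1.lin = SF.assoc0 X Y Z ∧
        (aSF X Y Z).inv.2.lin = SF.assoc1 β X Y Z) ∧
      (∀ U V W, (aS U V W).inv.lin = RepS.assocBy (SAlg.Lam β) U V W) ∧
      (∀ U V, (Δ U V).hom.lin = deltaLin U V) ∧
      η.hom.lin = LinearMap.fst ℂ _ _ ∧
      D.IsEquivalence ∧
      ∃ (hSF : IsMonoidal (SF.monStruct aSF)) (hS : IsMonoidal (RepS.monStruct aS)),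
        IsMonoidalFunctor hSF.monoidalCategory hS.monoidalCategory D
          (fun U V => (Δ U V).hom) η.hom) ∧
    (∀ (a b c : Fin 2) (t : SAlg.S3),
      (t = SAlg.t3 (SAlg.e a) (SAlg.e b) (SAlg.e c) * t ∧
        ∀ X Y Z : SF, X.InSector a → Y.InSector b → Z.InSector c →
          TransportDiagram β t X Y Z) ↔
      t = SAlg.LamSector β a b c) :=
  ⟨⟨SF.alIso hβ, fun U V W => (RepS.assocS hβ U V W).symm, deltaIso, etaIso,
    fun _ _ _ => ⟨rfl, rfl⟩, fun U V W => LinearMap.ext (RepS.assocS_hom_lin hβ U V W),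
    fun _ _ => rfl, rfl, D_isEquivalence, SF.isMonoidal hβ, RepS.isMonoidal hβ,
    D_isMonoidalFunctor hβ⟩, fun _ _ _ _ => eq_LamSector_iff⟩
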